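/- The bit-size of a rational number $a/d$ in lowest terms ($d\ge 1$) is $1$ plus the number of binary digits of $|a|$ plus the number of binary digits of $d$; the bit-size of a rational vector or matrix is the sum of the bit-sizes of its entries. The complexity of a rational polyhedron $Q$ is the smallest bit-size of a rational matrix $[A'\ b']$ with $Q=\{x : A'x\le b'\}$. For a finite set $S$ of vectors, $\mathrm{int.cone}(S)$ is the set of all combinations $\sum_{r\in S}\lambda_r r$ with $\lambda_r\in\mathbb Z_+$. A pointed polyhedral cone is simple if the number of its extreme rays equals its dimension. The extreme rays of a polyhedron are those of its recession cone. There is a polynomial $f$ such that for all $p,q,m\ge 0$, all $A\in\mathbb Q^{m\times(p+q)}$ and $b\in\mathbb Q^m$ for which the polyhedron $P=\{x\in\mathbb R^{p+q} : Ax\le b\}$ is pointed (contains no line), there are a finite family $\{P_i\}_i$ of rational polytopes and a finite family $\{R_K\}_{K\in\mathcal K}$ of sets of extreme rays of $P$ (each ray that occurs being represented by one fixed generating vector, the same in all $R_K$) with the following properties: 1. $P\cap(\mathbb Z^p\times\mathbb R^q)=\bigcup_{i,\,K\in\mathcal K}\bigl(P_i+\mathrm{int.cone}(R_K)\bigr)$;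 2. each polytope $P_i$ has complexity at most $f(\sigma)$ and each vector in each $R_K$ has bit-size at most $f(\sigma)$, where $\sigma$ is the bit-size of $[A\ b]$; 3. for each $K\in\mathcal K$, all vectors in $R_K$ are integral; 4. for each $K\in\mathcal K$, the cone $\mathrm{cone}(R_K)$ is simple. Moreover, mixed-integer linear feasibility is in NP. This is the following decision problem: given $p$, $q$ and a rational system $Ax\le b$ in $p+q$ variables, encoded in binary, is there $x\in\mathbb Z^p\times\mathbb R^q$ with $Ax\le b$? -/

import Mathlib

open scoped Pointwise

/-! ### Bit-sizes -/

/-- Number of bits of a rational number in lowest terms: one sign bit, and the binary digits of the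
numerator and of the denominator. -/
def ratSize (r : ℚ) : ℕ := 1 + Nat.size r.num.natAbs + Nat.size r.den

/-- Complexity of a rational vector. -/
def vecSize {ι : Type*} [Fintype ι] (r : ι → ℚ) : ℕ := ∑ j, ratSize (r j)

/-- Complexity of the rational matrix `[A b]`. -/
def systemSize {ι : Type*} [Fintype ι] {m : ℕ} (A : Matrix (Fin m) ι ℚ) (b : Fin m → ℚ) : ℕ :=
  ∑ i, (vecSize (A i) + ratSize (b i))

/-! ### Polyhedra, cones and rays -/

/-- The polyhedron `{x ∈ ℝ^ι : A x ≤ b}` for real `A`, `b`. -/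
def polyhedron {ι : Type*} [Fintype ι] {m : ℕ} (A : Matrix (Fin m) ι ℝ) (b : Fin m → ℝ) :
    Set (ι → ℝ) :=
  {x | ∀ i, ∑ j, A i j * x j ≤ b i}

/-- The rational polyhedron `{x ∈ ℝ^ι : A x ≤ b}` for rational `A`, `b`. -/
def ratPolyhedron {ι : Type*} [Fintype ι] {m : ℕ} (A : Matrix (Fin m) ι ℚ) (b : Fin m → ℚ) :
    Set (ι → ℝ) :=
  polyhedron (fun i j => (A i j : ℝ)) (fun i => (b i : ℝ))

/-- A rational polytope: a bounded rational polyhedron. -/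
def IsRatPolytope {ι : Type*} [Fintype ι] (S : Set (ι → ℝ)) : Prop :=
  Bornology.IsBounded S ∧
    ∃ (m : ℕ) (A : Matrix (Fin m) ι ℚ) (b : Fin m → ℚ), S = ratPolyhedron A b

/-- Complexity of a rational polyhedron: the smallest complexity of a rational matrix `[A b]` with
`S = {x : A x ≤ b}`. -/
noncomputable def polyhedronSize {ι : Type*} [Fintype ι] (S : Set (ι → ℝ)) : ℕ :=
  sInf {s | ∃ (m : ℕ) (A : Matrix (Fin m) ι ℚ) (b : Fin m → ℚ),
    S = ratPolyhedron A b ∧ s = systemSize A b}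

/-- A set is pointed if it contains no line. -/
def IsPointed {ι : Type*} (S : Set (ι → ℝ)) : Prop :=
  ∀ x ∈ S, ∀ v : ι → ℝ, (∀ t : ℝ, x + t • v ∈ S) → v = 0

/-- The recession cone of a set. -/
def recessionCone {ι : Type*} (S : Set (ι → ℝ)) : Set (ι → ℝ) :=
  {v | ∀ x ∈ S, ∀ t : ℝ, 0 ≤ t → x + t • v ∈ S}

/-- The half-line `{t r : t ≥ 0}`. -/
def halfLine {ι : Type*} (r : ι → ℝ) : Set (ι → ℝ) := {x | ∃ t : ℝ, 0 ≤ t ∧ x = t • r}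

/-- The nonzero vector `r` generates an extreme ray of the cone `C`: whenever `r` is a sum of two
elements of `C`, both of them lie on the half-line of `r`. -/
def GeneratesExtremeRay {ι : Type*} (C : Set (ι → ℝ)) (r : ι → ℝ) : Prop :=
  r ∈ C ∧ r ≠ 0 ∧
    ∀ x ∈ C, ∀ y ∈ C, x + y = r → x ∈ halfLine r ∧ y ∈ halfLine r

/-- The set of extreme rays of a cone; each extreme ray is a half-line. -/
def extremeRays {ι : Type*} (C : Set (ι → ℝ)) : Set (Set (ι → ℝ)) :=
  {L | ∃ r, GeneratesExtremeRay C r ∧ L = halfLine r}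

/-- A simple cone: a pointed polyhedral cone whose number of extreme rays equals its (affine)
dimension. -/
def IsSimpleCone {ι : Type*} [Fintype ι] (C : Set (ι → ℝ)) : Prop :=
  (∃ (m : ℕ) (A : Matrix (Fin m) ι ℝ), C = polyhedron A 0) ∧ IsPointed C ∧
    (extremeRays C).Finite ∧ (extremeRays C).ncard = Module.finrank ℝ (vectorSpan ℝ C)

/-- A rational vector, seen as a real vector. -/
def castVec {ι : Type*} (r : ι → ℚ) : ι → ℝ := fun j => (r j : ℝ)

/-- The conic hull of a finite set of rational vectors. -/
def coneHull {ι : Type*} (R : Finset (ι → ℚ)) : Set (ι → ℝ) :=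
  {x | ∃ c : (ι → ℚ) → ℝ, (∀ r ∈ R, 0 ≤ c r) ∧ x = ∑ r ∈ R, c r • castVec r}

/-- All nonnegative integer combinations of a finite set of rational vectors. -/
def intCone {ι : Type*} (R : Finset (ι → ℚ)) : Set (ι → ℝ) :=
  {x | ∃ c : (ι → ℚ) → ℕ, x = ∑ r ∈ R, c r • castVec r}

/-- The set `ℤ^p × ℝ^q` inside `ℝ^(p+q)`. -/
def mixedInteger (p q : ℕ) : Set (Fin p ⊕ Fin q → ℝ) :=
  {x | ∀ i : Fin p, ∃ z : ℤ, x (Sum.inl i) = z}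

/-! ### The mixed-integer feasibility problem as a decision problem -/

/-- An instance of mixed-integer linear feasibility: a rational system `A x ≤ b` with `p` integer
variables and `q` continuous ones. -/
structure MIPInstance where
  p : ℕ
  q : ℕ
  m : ℕ
  A : Matrix (Fin m) (Fin p ⊕ Fin q) ℚ
  b : Fin m → ℚ

/-- The instance has a solution in `ℤ^p × ℝ^q`. -/
def MIPInstance.Feasible (I : MIPInstance) : Prop :=
  (ratPolyhedron I.A I.b ∩ mixedInteger I.p I.q).Nonempty

/-- Binary encoding of a rational in lowest terms: a sign bit, the binary digits of the numerator,
a comma, the binary digits of the denominator, a comma. -/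
def encodeRat (r : ℚ) : List Computability.Γ' :=
  .bit (decide (r < 0)) ::
    ((Nat.bits r.num.natAbs).map .bit ++ .comma :: ((Nat.bits r.den).map .bit ++ [.comma]))

/-- Encoding of a row of `[A b]`: its entries between two brackets. -/
def encodeRow (l : List ℚ) : List Computability.Γ' :=
  .bra :: (l.flatMap encodeRat ++ [.ket])

/-- The `i`-th row of `[A b]`. -/
def MIPInstance.row (I : MIPInstance) (i : Fin I.m) : List ℚ :=
  List.ofFn (fun j => I.A i (Sum.inl j)) ++ (List.ofFn (fun j => I.A i (Sum.inr j)) ++ [I.b i])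

/-- Encoding of an instance: one bit for every variable, which tells whether the variable is
integer, followed by the rows of `[A b]`. -/
def encodeMIP (I : MIPInstance) : List Computability.Γ' :=
  List.replicate I.p (.bit true) ++ (List.replicate I.q (.bit false) ++
    (List.ofFn I.row).flatMap encodeRow)

theorem map_bit_append_cancel (x y : Computability.Γ') (hx : ∀ c, x ≠ .bit c)
    (hy : ∀ c, y ≠ .bit c) :
    ∀ (a a' : List Bool) (l l' : List Computability.Γ'),
      a.map Computability.Γ'.bit ++ x :: l = a'.map Computability.Γ'.bit ++ y :: l' →
        a = a' ∧ x :: l = y :: l'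
  | [], [], l, l', h => ⟨rfl, by simpa using h⟩
  | [], c :: a', l, l', h => by simp at h; exact absurd h.1 (hx c)
  | c :: a, [], l, l', h => by simp at h; exact absurd h.1.symm (hy c)
  | c :: a, c' :: a', l, l', h => by
      simp only [List.map_cons, List.cons_append, List.cons.injEq, Computability.Γ'.bit.injEq] at h
      obtain ⟨h1, h2⟩ := map_bit_append_cancel x y hx hy a a' l l' h.2
      exact ⟨by rw [h.1, h1], h2⟩

theorem bits_injective : Function.Injective Nat.bits := by
  intro a b h
  have key : ∀ n : ℕ, Nat.ofDigits 2 (n.bits.map fun c => cond c 1 0) = n := by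
    intro n
    rw [← Nat.digits_two_eq_bits, Nat.ofDigits_digits]
  rw [← key a, ← key b, h]

theorem encodeRat_append_cancel (r r' : ℚ) (l l' : List Computability.Γ')
    (h : encodeRat r ++ l = encodeRat r' ++ l') : r = r' ∧ l = l' := by
  simp only [encodeRat, List.cons_append, List.append_assoc, List.cons.injEq,
    Computability.Γ'.bit.injEq, List.nil_append] at h
  obtain ⟨h0, h⟩ := h
  obtain ⟨h1, h⟩ := map_bit_append_cancel _ _ (by simp) (by simp) _ _ _ _ h
  simp only [List.cons.injEq, true_and] at h
  obtain ⟨h2, h⟩ := map_bit_append_cancel _ _ (by simp) (by simp) _ _ _ _ h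
  simp only [List.cons.injEq, true_and] at h
  refine ⟨?_, h⟩
  have h1 := bits_injective h1
  have h2 := bits_injective h2
  have hs : (r < 0) ↔ (r' < 0) := by simpa using h0
  rw [← Rat.num_neg, ← Rat.num_neg] at hs
  exact Rat.ext (by omega) h2

theorem encodeRats_append_cancel : ∀ (a a' : List ℚ) (l l' : List Computability.Γ'),
    a.flatMap encodeRat ++ .ket :: l = a'.flatMap encodeRat ++ .ket :: l' → a = a' ∧ l = l'
  | [], [], l, l', h => ⟨rfl, by simpa using h⟩
  | [], c :: a', l, l', h => by simp [encodeRat] at h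
  | c :: a, [], l, l', h => by simp [encodeRat] at h
  | c :: a, c' :: a', l, l', h => by
      simp only [List.flatMap_cons, List.append_assoc] at h
      obtain ⟨h1, h⟩ := encodeRat_append_cancel _ _ _ _ h
      obtain ⟨h2, h⟩ := encodeRats_append_cancel _ _ _ _ h
      exact ⟨by rw [h1, h2], h⟩

theorem encodeRows_injective : ∀ (a a' : List (List ℚ)),
    a.flatMap encodeRow = a'.flatMap encodeRow → a = a'
  | [], [], _ => rfl
  | [], c :: a', h => by simp [encodeRow] at h
  | c :: a, [], h => by simp [encodeRow] at h
  | c :: a, c' :: a', h => by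
      simp only [List.flatMap_cons, encodeRow, List.cons_append, List.append_assoc,
        List.cons.injEq, true_and, List.nil_append] at h
      obtain ⟨h1, h⟩ := encodeRats_append_cancel _ _ _ _ h
      rw [h1, encodeRows_injective _ _ h]

theorem replicate_append_cancel (x : Computability.Γ') :
    ∀ (n n' : ℕ) (l l' : List Computability.Γ'), l.head? ≠ some x → l'.head? ≠ some x →
      List.replicate n x ++ l = List.replicate n' x ++ l' → n = n' ∧ l = l'
  | 0, 0, _, _, _, _, h => ⟨rfl, by simpa using h⟩
  | 0, n' + 1, l, l', hl, _, h => by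
      simp [List.replicate_succ] at h; simp [h] at hl
  | n + 1, 0, l, l', _, hl, h => by
      simp [List.replicate_succ] at h; simp [← h] at hl
  | n + 1, n' + 1, l, l', hl, hl', h => by
      simp only [List.replicate_succ, List.cons_append, List.cons.injEq, true_and] at h
      obtain ⟨h1, h2⟩ := replicate_append_cancel x n n' l l' hl hl' h
      exact ⟨by rw [h1], h2⟩

theorem head_rows (c : Bool) (a : List (List ℚ)) :
    (a.flatMap encodeRow).head? ≠ some (.bit c) := by
  cases a <;> simp [encodeRow]

theorem encodeMIP_injective : Function.Injective encodeMIP := by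
  rintro ⟨p, q, m, A, b⟩ ⟨p', q', m', A', b'⟩ h
  simp only [encodeMIP] at h
  have aux : ∀ (q : ℕ) (a : List (List ℚ)),
      (List.replicate q (Computability.Γ'.bit false) ++ a.flatMap encodeRow).head? ≠
        some (.bit true) := by
    intro q a
    cases q with
    | zero => simpa using head_rows true a
    | succ q => simp [List.replicate_succ]
  obtain ⟨rfl, h⟩ := replicate_append_cancel _ _ _ _ _ (aux _ _) (aux _ _) h
  obtain ⟨rfl, h⟩ := replicate_append_cancel _ _ _ _ _ (head_rows _ _) (head_rows _ _) h
  have h := encodeRows_injective _ _ h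
  have hm : m = m' := by simpa using congrArg List.length h
  subst hm
  have hrow := List.ofFn_injective h
  have key : ∀ i, (∀ j, A i j = A' i j) ∧ b i = b' i := by
    intro i
    have hi := congrFun hrow i
    simp only [MIPInstance.row] at hi
    obtain ⟨h1, h2⟩ := List.append_inj hi (by simp)
    obtain ⟨h2, h3⟩ := List.append_inj h2 (by simp)
    refine ⟨?_, by simpa using h3⟩
    rintro (j | j)
    · exact congrFun (List.ofFn_injective h1) j
    · exact congrFun (List.ofFn_injective h2) j
  have hA : A = A' := by ext i j; exact (key i).1 j
  have hb : b = b' := by ext i; rw [(key i).2]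
  rw [hA, hb]

/-- The binary encoding of instances, as an encoding with a decoding map. -/
noncomputable def mipEncoding : Computability.Encoding MIPInstance Computability.Γ' where
  encode := encodeMIP
  decode := Function.partialInv encodeMIP
  decode_encode := fun I => Function.partialInv_left encodeMIP_injective I

/-- Encoding of a pair made of an instance and a certificate (a string over `Δ`). -/
def encodePair {α Γ Δ : Type} (e : Computability.Encoding α Γ) (x : α × List Δ) : List (Γ ⊕ Δ) :=
  (e.encode x.1).map Sum.inl ++ x.2.map Sum.inr

/-- The decision problem with set of yes-instances `S`, whose instances are encoded by `e` over a
finite alphabet, is in NP: there are a finite certificate alphabet `Δ`, a polynomial `g` and a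
verifier `V`, computed by a Turing machine in time polynomial in the length of its input, such that
an instance `x` belongs to `S` if and only if `V` accepts `(x, c)` for some certificate `c` of length
at most `g (length of the encoding of x)`. -/
def InNP {α Γ : Type} [Fintype Γ] (e : Computability.Encoding α Γ) (S : Set α) : Prop :=
  ∃ (Δ : Type) (_ : Fintype Δ) (g : Polynomial ℕ) (V : α × List Δ → Bool),
    Nonempty (Turing.TM2ComputableInPolyTime (encodePair e) Computability.encodeBool V) ∧
      ∀ x : α, x ∈ S ↔
        ∃ c : List Δ, c.length ≤ g.eval (e.encode x).length ∧ V (x, c) = true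

/-! Decomposition. Scale the rows of `A x ≤ b` to integers. As the polyhedron P is pointed, each of
its points is a convex combination of vertices plus an element of the recession cone
(`exists_vertex_add_cone`), and that element is a nonnegative combination of linearly independent
extreme rays (`exists_nonneg_combination`). Cramer's rule (`exists_small_solution`) bounds the
vertices and gives every extreme ray an integral generator with polynomially many bits; one
generator per ray is fixed. Split each multiplier of a ray into integer part and fractional part.
The integer parts form an element of int.cone(R_K); the convex combination together with the
fractional parts is a point y of P whose coordinates are at most some B with polynomially many bits
(`exists_small_add_intCone`). The rays are integral, so y has integral first p coordinates if the
given point has. Hence the P_i can be the slices of P ∩ [-B, B]^(p+q) on which the first p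
coordinates are fixed integers, and the R_K all linearly independent sets of chosen generators.
Independence makes the cones simple (`isSimpleCone_familyCone`).

Membership in NP. A solution lies in some orthant, and the intersection of P with an orthant is
pointed; the same argument yields a solution with small integer part, and a vertex of the slice with
this integer part is a rational solution with polynomially many bits
(`exists_small_mixedInteger_solution`). The verification is written as a nondeterministic stack
program, that is, as a regular language of instruction words: products, sums and stars of languages
are sequencing, choice and loops. A certificate is a word of instructions. A fixed Turing machine
runs a finite automaton on the word while executing it, and accepts if the word is in the language
and all its instructions succeed (`inNP_of_isRegular`). It remains to exhibit a program that has a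
successful run exactly on the encodings of feasible instances, and then a short one (`main_sound`,
`main_complete`). Nondeterminism simplifies the arithmetic: quotients and slacks are guessed, so
that only addition, multiplication and a test of equality are needed. -/

open scoped Computability

/-! ### Closure properties of regular languages -/

namespace Language

variable {α : Type*}

/-- The union of a set of languages. -/
def sUnion (S : Set (Language α)) : Language α := {y | ∃ B ∈ S, y ∈ B}

theorem isRegular_zero : (0 : Language α).IsRegular := by
  refine IsRegular.of_finite_range_leftQuotient (Set.Finite.subset (Set.finite_singleton 0) ?_)
  rintro _ ⟨x, rfl⟩
  ext y
  simp [mem_leftQuotient]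

theorem isRegular_one : (1 : Language α).IsRegular := by
  refine IsRegular.of_finite_range_leftQuotient (Set.Finite.subset (Set.toFinite {1, 0}) ?_)
  rintro _ ⟨x, rfl⟩
  cases x with
  | nil => simp
  | cons a x =>
    right
    ext y
    simp [mem_leftQuotient]

theorem isRegular_singleton (a : α) : ({[a]} : Language α).IsRegular := by
  refine IsRegular.of_finite_range_leftQuotient
    (Set.Finite.subset (Set.toFinite {({[a]} : Language α), 1, 0}) ?_)
  rintro _ ⟨x, rfl⟩
  match x with
  | [] => simp
  | [b] =>
    right
    by_cases h : b = a
    · left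
      subst h
      ext y
      rw [mem_leftQuotient, mem_one]
      change _ = _ ↔ _
      simp
    · right
      ext y
      rw [mem_leftQuotient]
      change _ = _ ↔ _
      simp [h]
  | b :: c :: x =>
    right; right
    ext y
    rw [mem_leftQuotient]
    change _ = _ ↔ _
    simp

/-- By Myhill–Nerode it suffices to bound the number of left quotients. When `x` is continued to a
word of the product, the cut between the factors lies after `x` or inside it. So the quotient by `x`
is determined by one quotient of `L₁` and a set of quotients of `L₂`, which leaves finitely many
possibilities. -/
theorem IsRegular.mul {L₁ L₂ : Language α} (h₁ : L₁.IsRegular) (h₂ : L₂.IsRegular) :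
    (L₁ * L₂).IsRegular := by
  have f₁ := h₁.finite_range_leftQuotient
  have f₂ := h₂.finite_range_leftQuotient
  refine IsRegular.of_finite_range_leftQuotient
    (Set.Finite.subset (Set.Finite.image2 (fun (A : Language α) (S : Set (Language α)) =>
      A * L₂ + sUnion S) f₁ f₂.finite_subsets) ?_)
  rintro _ ⟨x, rfl⟩
  refine ⟨L₁.leftQuotient x, ⟨x, rfl⟩,
    {B | ∃ u v, x = u ++ v ∧ u ∈ L₁ ∧ B = L₂.leftQuotient v}, ?_, ?_⟩
  · rintro _ ⟨u, v, -, -, rfl⟩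
    exact ⟨v, rfl⟩
  · ext y
    rw [mem_leftQuotient, mem_add, mem_mul, mem_mul]
    constructor
    · rintro (⟨a, ha, b, hb, rfl⟩ | ⟨_, ⟨u, v, rfl, hu, rfl⟩, hy⟩)
      · exact ⟨x ++ a, ha, b, hb, by simp⟩
      · exact ⟨u, hu, v ++ y, hy, by simp⟩
    · rintro ⟨a, ha, b, hb, hab⟩
      rcases List.append_eq_append_iff.1 hab with ⟨c, rfl, rfl⟩ | ⟨c, rfl, rfl⟩
      · exact Or.inr ⟨_, ⟨a, c, rfl, ha, rfl⟩, hb⟩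
      · exact Or.inl ⟨c, ha, b, hb, rfl⟩

theorem append_mem_kstar {L : Language α} {a b : List α} (ha : a ∈ L) (hb : b ∈ L∗) :
    a ++ b ∈ L∗ := by
  rw [← one_add_self_mul_kstar_eq_kstar]
  exact Or.inr (append_mem_mul ha hb)

theorem kstar_append_mem_kstar {L : Language α} {a b : List α} (ha : a ∈ L∗) (hb : b ∈ L∗) :
    a ++ b ∈ L∗ := by
  obtain ⟨l, rfl, hl⟩ := mem_kstar.1 ha
  obtain ⟨l', rfl, hl'⟩ := mem_kstar.1 hb
  exact mem_kstar.2 ⟨l ++ l', by simp, by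
    simp only [List.mem_append]
    rintro y (hy | hy)
    exacts [hl y hy, hl' y hy]⟩

/-- `v ++ a` is the factor that begins before the end of `x` and ends there or later. It exists
because `x` is nonempty. -/
theorem exists_split_of_append_mem_kstar {L : Language α} : ∀ {x y : List α}, x ≠ [] →
    x ++ y ∈ L∗ → ∃ u v a b, x = u ++ v ∧ y = a ++ b ∧ u ∈ L∗ ∧ v ++ a ∈ L ∧ b ∈ L∗ := by
  intro x y hx h
  obtain ⟨l, hl, hL⟩ := mem_kstar.1 h
  induction l generalizing x with
  | nil => simp_all
  | cons w l ih =>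
    have hw := hL w (by simp)
    have hL' : ∀ y ∈ l, y ∈ L := fun y hy => hL y (by simp [hy])
    rw [List.flatten_cons] at hl
    rcases List.append_eq_append_iff.1 hl with ⟨c, rfl, hc⟩ | ⟨c, rfl, hc⟩
    · exact ⟨[], x, c, l.flatten, by simp, hc, nil_mem_kstar _, hw, join_mem_kstar hL'⟩
    · by_cases hc0 : c = []
      · subst hc0
        refine ⟨[], w, [], y, by simp, by simp, nil_mem_kstar _, by simpa using hw, ?_⟩
        rw [List.nil_append] at hc
        exact hc ▸ join_mem_kstar hL'
      · obtain ⟨u, v, a, b, rfl, rfl, hu, hv, hb⟩ :=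
          ih hc0 (hc ▸ join_mem_kstar hL') hc.symm hL'
        exact ⟨w ++ u, v, a, b, by simp, rfl, append_mem_kstar hw hu, hv, hb⟩

/-- The quotient by a nonempty word is a union of quotients of `L`, followed by `L∗`. There are
finitely many such unions, and the empty word adds only `L∗` itself. -/
theorem IsRegular.kstar {L : Language α} (h : L.IsRegular) : (L∗).IsRegular := by
  have f := h.finite_range_leftQuotient
  refine IsRegular.of_finite_range_leftQuotient
    (Set.Finite.subset ((Set.Finite.image (fun (S : Set (Language α)) =>
      sUnion S * L∗) f.finite_subsets).union
        (Set.finite_singleton (L∗))) ?_)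
  rintro _ ⟨x, rfl⟩
  by_cases hx : x = []
  · right; simp [hx]
  left
  refine ⟨{B | ∃ u v, x = u ++ v ∧ u ∈ L∗ ∧ B = L.leftQuotient v}, ?_, ?_⟩
  · rintro _ ⟨u, v, -, -, rfl⟩
    exact ⟨v, rfl⟩
  · ext y
    rw [mem_leftQuotient, mem_mul]
    constructor
    · rintro ⟨a, ⟨_, ⟨u, v, rfl, hu, rfl⟩, ha⟩, b, hb, rfl⟩
      rw [show (u ++ v) ++ (a ++ b) = u ++ ((v ++ a) ++ b) by simp]
      exact kstar_append_mem_kstar hu (append_mem_kstar ha hb)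
    · intro hxy
      obtain ⟨u, v, a, b, rfl, rfl, hu, hv, hb⟩ := exists_split_of_append_mem_kstar hx hxy
      exact ⟨a, ⟨_, ⟨u, v, rfl, hu, rfl⟩, hv⟩, b, hb, rfl⟩

end Language

/-! ### Instructions on stacks and nondeterministic programs -/

/-- Elementary instructions on stacks: push a symbol, pop a given symbol, check emptiness. -/
inductive StackInstr (K Γ : Type)
  | push (k : K) (a : Γ)
  | pop (k : K) (a : Γ)
  | empty (k : K)

namespace StackInstr

variable {K Γ : Type}

instance [Finite K] [Finite Γ] : Finite (StackInstr K Γ) := by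
  let f : StackInstr K Γ → Fin 3 × K × Option Γ := fun
    | push k a => (0, k, some a)
    | pop k a => (1, k, some a)
    | empty k => (2, k, none)
  refine Finite.of_injective f ?_
  rintro (⟨k, a⟩ | ⟨k, a⟩ | ⟨k⟩) (⟨k', a'⟩ | ⟨k', a'⟩ | ⟨k'⟩) h <;>
    simp_all [f]

/-- The condition under which an instruction succeeds. -/
def Enabled (s : K → List Γ) : StackInstr K Γ → Prop
  | push _ _ => True
  | pop k a => (s k).head? = some a
  | empty k => s k = []

variable [DecidableEq K]

/-- The effect of an instruction on the stacks. -/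
def apply (s : K → List Γ) : StackInstr K Γ → K → List Γ
  | push k a => Function.update s k (a :: s k)
  | pop k _ => Function.update s k (s k).tail
  | empty _ => s

end StackInstr

/-- The successful execution of a word of instructions. -/
def Exec {K Γ : Type} [DecidableEq K] : List (StackInstr K Γ) → (K → List Γ) → (K → List Γ) → Prop
  | [], s, t => t = s
  | i :: w, s, t => i.Enabled s ∧ Exec w (i.apply s) t

theorem exec_append {K Γ : Type} [DecidableEq K] (w w' : List (StackInstr K Γ)) :
    ∀ s t : K → List Γ, Exec (w ++ w') s t ↔ ∃ u, Exec w s u ∧ Exec w' u t := by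
  induction w with
  | nil => intro s t; simp [Exec]
  | cons i w ih =>
    intro s t
    simp only [List.cons_append, Exec, ih]
    constructor
    · rintro ⟨h, u, h1, h2⟩; exact ⟨u, ⟨h, h1⟩, h2⟩
    · rintro ⟨u, ⟨h, h1⟩, h2⟩; exact ⟨h, u, h1, h2⟩

/-- A nondeterministic program: a language of instruction words. -/
abbrev StackProg (K Γ : Type) := Language (StackInstr K Γ)

namespace StackProg

variable {K Γ : Type} [DecidableEq K]

/-- The program `L` can lead from `s` to `t` in at most `n` instructions. -/
def RunsIn (L : StackProg K Γ) (n : ℕ) (s t : K → List Γ) : Prop :=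
  ∃ w ∈ L, w.length ≤ n ∧ Exec w s t

/-- The program `L` can lead from `s` to `t`. -/
def Runs (L : StackProg K Γ) (s t : K → List Γ) : Prop := ∃ w ∈ L, Exec w s t

variable {L L₁ L₂ : StackProg K Γ} {n m : ℕ} {s t u : K → List Γ}

theorem RunsIn.runs (h : RunsIn L n s t) : Runs L s t :=
  let ⟨w, h1, _, h2⟩ := h
  ⟨w, h1, h2⟩

theorem RunsIn.mono (h : RunsIn L n s t) (hn : n ≤ m) : RunsIn L m s t :=
  let ⟨w, h1, h3, h2⟩ := h
  ⟨w, h1, h3.trans hn, h2⟩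

theorem RunsIn.mul (h : RunsIn L₁ n s t) (h' : RunsIn L₂ m t u) : RunsIn (L₁ * L₂) (n + m) s u := by
  obtain ⟨w, h1, h2, h3⟩ := h
  obtain ⟨w', h1', h2', h3'⟩ := h'
  exact ⟨w ++ w', Language.append_mem_mul h1 h1', by simp; omega, (exec_append _ _ _ _).2 ⟨t, h3, h3'⟩⟩

theorem runs_mul : Runs (L₁ * L₂) s u ↔ ∃ t, Runs L₁ s t ∧ Runs L₂ t u := by
  constructor
  · rintro ⟨_, ⟨w, hw, w', hw', rfl⟩, h⟩
    obtain ⟨t, h1, h2⟩ := (exec_append _ _ _ _).1 h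
    exact ⟨t, ⟨w, hw, h1⟩, ⟨w', hw', h2⟩⟩
  · rintro ⟨t, ⟨w, hw, h1⟩, ⟨w', hw', h2⟩⟩
    exact ⟨_, Language.append_mem_mul hw hw', (exec_append _ _ _ _).2 ⟨t, h1, h2⟩⟩

theorem RunsIn.inl (h : RunsIn L₁ n s t) : RunsIn (L₁ + L₂) n s t :=
  let ⟨w, h1, h2, h3⟩ := h
  ⟨w, Or.inl h1, h2, h3⟩

theorem RunsIn.inr (h : RunsIn L₂ n s t) : RunsIn (L₁ + L₂) n s t :=
  let ⟨w, h1, h2, h3⟩ := h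
  ⟨w, Or.inr h1, h2, h3⟩

theorem runs_add : Runs (L₁ + L₂) s t ↔ Runs L₁ s t ∨ Runs L₂ s t := by
  constructor
  · rintro ⟨w, h | h, h'⟩
    exacts [Or.inl ⟨w, h, h'⟩, Or.inr ⟨w, h, h'⟩]
  · rintro (⟨w, h, h'⟩ | ⟨w, h, h'⟩)
    exacts [⟨w, Or.inl h, h'⟩, ⟨w, Or.inr h, h'⟩]

theorem runsIn_one : RunsIn (1 : StackProg K Γ) 0 s s :=
  ⟨[], Language.nil_mem_one, le_rfl, rfl⟩

theorem runs_one : Runs (1 : StackProg K Γ) s t ↔ t = s := by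
  constructor
  · rintro ⟨w, h, h'⟩
    rw [Language.mem_one] at h
    subst h
    exact h'
  · rintro rfl
    exact runsIn_one.runs

theorem RunsIn.star_nil : RunsIn (L∗ : StackProg K Γ) 0 s s :=
  ⟨[], Language.nil_mem_kstar _, le_rfl, rfl⟩

theorem RunsIn.star_cons (h : RunsIn L n s t) (h' : RunsIn (L∗ : StackProg K Γ) m t u) :
    RunsIn (L∗ : StackProg K Γ) (n + m) s u := by
  rw [← Language.one_add_self_mul_kstar_eq_kstar]
  exact (h.mul h').inr

theorem runs_star : Runs (L∗ : StackProg K Γ) s t ↔ Relation.ReflTransGen (Runs L) s t := by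
  constructor
  · rintro ⟨w, hw, h⟩
    obtain ⟨l, rfl, hl⟩ := Language.mem_kstar.1 hw
    clear hw
    induction l generalizing s with
    | nil => simp only [List.flatten_nil, Exec] at h; subst h; exact .refl
    | cons w l ih =>
      rw [List.flatten_cons, exec_append] at h
      obtain ⟨u, h1, h2⟩ := h
      exact .head ⟨w, hl w (by simp), h1⟩ (ih (fun y hy => hl y (by simp [hy])) h2)
  · intro h
    induction h using Relation.ReflTransGen.head_induction_on with
    | refl => exact RunsIn.star_nil.runs
    | head h _ ih =>
      rw [← Language.one_add_self_mul_kstar_eq_kstar, runs_add, runs_mul]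
      exact Or.inr ⟨_, h, ih⟩

theorem runs_star_cases (h : Runs (L∗ : StackProg K Γ) s u) :
    s = u ∨ ∃ t, Runs L s t ∧ Runs (L∗ : StackProg K Γ) t u := by
  rw [runs_star] at h
  rcases h.cases_head with h | ⟨t, h, h'⟩
  exacts [Or.inl h, Or.inr ⟨t, h, runs_star.2 h'⟩]

/-- The program with the single instruction `push k a`. -/
def push (k : K) (a : Γ) : StackProg K Γ := {[.push k a]}

/-- The program with the single instruction `pop k a`. -/
def pop (k : K) (a : Γ) : StackProg K Γ := {[.pop k a]}

/-- The program with the single instruction `empty k`. -/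
def empty (k : K) : StackProg K Γ := {[.empty k]}

theorem runs_singleton {i : StackInstr K Γ} :
    Runs ({[i]} : StackProg K Γ) s t ↔ i.Enabled s ∧ t = i.apply s := by
  constructor
  · rintro ⟨w, h, h'⟩
    obtain rfl : w = [i] := h
    exact h'
  · rintro ⟨h, rfl⟩
    exact ⟨[i], rfl, h, rfl⟩

theorem runsIn_singleton {i : StackInstr K Γ} (h : i.Enabled s) :
    RunsIn ({[i]} : StackProg K Γ) 1 s (i.apply s) :=
  ⟨[i], rfl, le_rfl, h, rfl⟩

theorem runs_push {k : K} {a : Γ} : Runs (push k a) s t ↔ t = Function.update s k (a :: s k) :=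
  runs_singleton.trans (by simp [StackInstr.Enabled, StackInstr.apply])

theorem runs_pop {k : K} {a : Γ} :
    Runs (pop k a) s t ↔ ∃ l, s k = a :: l ∧ t = Function.update s k l := by
  refine runs_singleton.trans ?_
  simp only [StackInstr.Enabled, StackInstr.apply]
  cases s k <;> simp

theorem runs_empty {k : K} : Runs (empty k : StackProg K Γ) s t ↔ s k = [] ∧ t = s :=
  runs_singleton.trans (by simp [StackInstr.Enabled, StackInstr.apply])

theorem runsIn_push (k : K) (a : Γ) : RunsIn (push k a) 1 s (Function.update s k (a :: s k)) :=
  runsIn_singleton trivial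

theorem runsIn_pop {k : K} {a : Γ} {l : List Γ} (h : s k = a :: l) :
    RunsIn (pop k a) 1 s (Function.update s k l) := by
  have := runsIn_singleton (s := s) (i := .pop k a) (by simp [StackInstr.Enabled, h])
  rwa [StackInstr.apply, h, List.tail_cons] at this

theorem runsIn_empty {k : K} (h : s k = []) : RunsIn (empty k : StackProg K Γ) 1 s s :=
  runsIn_singleton (i := .empty k) h

/-- Nondeterministic choice of a Boolean. -/
def choice (f : Bool → StackProg K Γ) : StackProg K Γ := f false + f true

theorem runs_choice {f : Bool → StackProg K Γ} : Runs (choice f) s t ↔ ∃ b, Runs (f b) s t := by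
  rw [choice, runs_add, Bool.exists_bool]

theorem RunsIn.choice {f : Bool → StackProg K Γ} {b : Bool} (h : RunsIn (f b) n s t) :
    RunsIn (choice f) n s t := by
  cases b
  exacts [h.inl, h.inr]

end StackProg

namespace StackProg

theorem isRegular_push {K Γ : Type} (k : K) (a : Γ) : (push k a).IsRegular := Language.isRegular_singleton _

theorem isRegular_pop {K Γ : Type} (k : K) (a : Γ) : (pop k a).IsRegular := Language.isRegular_singleton _

theorem isRegular_empty {K Γ : Type} (k : K) : (empty k : StackProg K Γ).IsRegular :=
  Language.isRegular_singleton _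

theorem isRegular_choice {K Γ : Type} {f : Bool → StackProg K Γ} (h : ∀ b, (f b).IsRegular) :
    (choice f).IsRegular := (h _).add (h _)

end StackProg

/-! ### A Turing machine that executes instruction words -/

/-- The stacks of the verifier: input, output, and the working stacks. -/
inductive VStack (K : Type)
  | inp
  | out
  | work (k : K)

namespace VStack

variable {K : Type}

instance [DecidableEq K] : DecidableEq (VStack K) := fun a b =>
  match a, b with
  | inp, inp => isTrue rfl
  | out, out => isTrue rfl
  | work k, work l => if h : k = l then isTrue (h ▸ rfl) else isFalse (fun e => by cases e; exact h rfl)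
  | inp, out => isFalse (by simp)
  | inp, work _ => isFalse (by simp)
  | out, inp => isFalse (by simp)
  | out, work _ => isFalse (by simp)
  | work _, inp => isFalse (by simp)
  | work _, out => isFalse (by simp)

instance [Finite K] : Finite (VStack K) := by
  refine Finite.of_injective (β := Option (Option K))
    (fun | inp => none | out => some none | work k => some (some k)) ?_
  rintro (_ | _ | k) (_ | _ | l) h <;> simp_all

/-- The alphabets of the stacks of the verifier. -/
abbrev Alph (Γ₀ Δ Γ : Type) : VStack K → Type
  | inp => Γ₀ ⊕ Δ
  | out => Bool
  | work _ => Γ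

/-- The contents of all stacks. -/
def contents {Γ₀ Δ Γ : Type} (a : List (Γ₀ ⊕ Δ)) (o : List Bool) (w : K → List Γ) :
    ∀ k : VStack K, List (Alph Γ₀ Δ Γ k)
  | inp => a
  | out => o
  | work k => w k

variable [DecidableEq K] {Γ₀ Δ Γ : Type} (a a' : List (Γ₀ ⊕ Δ)) (o o' : List Bool) (w : K → List Γ)

theorem update_inp : Function.update (contents a o w) inp a' = contents a' o w := by
  funext k; cases k <;> simp [Function.update, contents]

theorem update_out : Function.update (contents a o w) out o' = contents a o' w := by
  funext k; cases k <;> simp [Function.update, contents]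

theorem update_work (k : K) (l : List Γ) :
    Function.update (contents a o w) (work k) l = contents a o (Function.update w k l) := by
  funext k'
  rcases k' with _ | _ | k'
  · simp [Function.update, contents]
  · simp [Function.update, contents]
  · by_cases h : k' = k
    · subst h; simp [contents]
    · simp [contents, h]

end VStack

namespace Verifier

open VStack Turing

variable {K Γ Γ₀ Q : Type}

/-- Labels of the verifier. -/
inductive Label (K Γ Γ₀ : Type)
  | main
  | load (c : Γ₀)
  | exec (i : StackInstr K Γ)
  | clear
  | output

instance [Finite K] [Finite Γ] [Finite Γ₀] : Finite (Label K Γ Γ₀) := by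
  refine Finite.of_injective (β := Option (Option (Option (Γ₀ ⊕ StackInstr K Γ))))
    (fun | .main => none | .clear => some none | .output => some (some none)
         | .load c => some (some (some (.inl c))) | .exec i => some (some (some (.inr i)))) ?_
  rintro (_ | _ | _ | _ | _) (_ | _ | _ | _ | _) h <;> simp_all

/-- Internal memory of the verifier: the symbol just read, the state of the automaton, a bit that
tells whether all instructions succeeded so far, and a bit used for clearing the stacks. -/
structure Var (K Γ Γ₀ Q : Type) where
  cur : Option (Γ₀ ⊕ StackInstr K Γ)
  st : Q
  ok : Bool
  dirty : Bool

instance [Finite K] [Finite Γ] [Finite Γ₀] [Finite Q] : Finite (Var K Γ Γ₀ Q) := by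
  refine Finite.of_injective (β := Option (Γ₀ ⊕ StackInstr K Γ) × Q × Bool × Bool)
    (fun v => (v.cur, v.st, v.ok, v.dirty)) ?_
  rintro ⟨⟩ ⟨⟩ h
  simp_all

/-- Statements of the verifier. -/
abbrev VStmt (K Γ Γ₀ Q : Type) :=
  TM2.Stmt (K := VStack K) (Alph Γ₀ (StackInstr K Γ) Γ) (Label K Γ Γ₀) (Var K Γ Γ₀ Q)

/-- Pop one symbol of every stack of a list of working stacks, recording if there was one. -/
def popAll : List K → VStmt K Γ Γ₀ Q → VStmt K Γ Γ₀ Q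
  | [], q => q
  | k :: ks, q => .pop (work k) (fun v o => { v with dirty := v.dirty || o.isSome }) (popAll ks q)

/-- The label that treats a given input symbol. -/
def next : Option (Γ₀ ⊕ StackInstr K Γ) → Label K Γ Γ₀
  | none => .clear
  | some (.inl c) => .load c
  | some (.inr i) => .exec i

open Classical in
/-- The program of the verifier. -/
noncomputable def program (M : DFA (StackInstr K Γ) Q) (ks : List K) (kin : K) (emb : Γ₀ → Γ) :
    Label K Γ Γ₀ → VStmt K Γ Γ₀ Q
  | .main => .pop inp (fun v o => { v with cur := o }) (.goto fun v => next v.cur)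
  | .load c => .push (work kin) (fun _ => emb c) (.goto fun _ => .main)
  | .exec (.push k a) => .push (work k) (fun _ => a)
      (.load (fun v => { v with st := M.step v.st (.push k a) }) (.goto fun _ => .main))
  -- A failure does not stop the machine. It is recorded in `ok`, and the stack is popped all the
  -- same, as in `StackInstr.apply`.
  | .exec (.pop k a) => .pop (work k) (fun v o => { v with ok := v.ok && decide (o = some a) })
      (.load (fun v => { v with st := M.step v.st (.pop k a) }) (.goto fun _ => .main))
  | .exec (.empty k) => .peek (work k) (fun v o => { v with ok := v.ok && decide (o = none) })
      (.load (fun v => { v with st := M.step v.st (.empty k) }) (.goto fun _ => .main))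
  -- A halting configuration must have empty stacks apart from the output, and the initial memory.
  -- The working stacks are therefore popped in rounds until a round finds all of them empty.
  | .clear => .load (fun v => { v with dirty := false })
      (popAll ks (.branch (fun v => v.dirty) (.goto fun _ => .clear) (.goto fun _ => .output)))
  | .output => .push out (fun v => v.ok && decide (v.st ∈ M.accept))
      (.load (fun _ => ⟨none, M.start, true, false⟩) .halt)

variable [DecidableEq K]

/-- The verifier as a bundled machine. -/
noncomputable def machine [Fintype K] [Fintype Γ] [Fintype Γ₀] [Fintype Q]
    (M : DFA (StackInstr K Γ) Q) (kin : K) (emb : Γ₀ → Γ) : FinTM2 where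
  K := VStack K
  kFin := Fintype.ofFinite _
  k₀ := inp
  k₁ := out
  Γ := Alph Γ₀ (StackInstr K Γ) Γ
  Λ := Label K Γ Γ₀
  main := .main
  ΛFin := Fintype.ofFinite _
  σ := Var K Γ Γ₀ Q
  initialState := ⟨none, M.start, true, false⟩
  σFin := Fintype.ofFinite _
  Γk₀Fin := Fintype.ofFinite (Γ₀ ⊕ StackInstr K Γ)
  m := program M Finset.univ.toList kin emb

/-- `a` leads to `b` in at most `n` steps. -/
def Within {C : Type*} (f : C → Option C) (n : ℕ) (a b : C) : Prop :=
  ∃ k ≤ n, (flip bind f)^[k] (some a) = some b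

theorem Within.trans {C : Type*} {f : C → Option C} {n m : ℕ} {a b c : C} (h : Within f n a b)
    (h' : Within f m b c) : Within f (n + m) a c := by
  obtain ⟨k, hk, h⟩ := h
  obtain ⟨l, hl, h'⟩ := h'
  exact ⟨l + k, by omega, by rw [Function.iterate_add_apply, h, h']⟩

theorem Within.single {C : Type*} {f : C → Option C} {a b : C} (h : f a = some b) :
    Within f 1 a b := ⟨1, le_rfl, h⟩

theorem Within.refl {C : Type*} {f : C → Option C} {a : C} : Within f 0 a a := ⟨0, le_rfl, rfl⟩

theorem Within.mono {C : Type*} {f : C → Option C} {n m : ℕ} {a b : C} (h : Within f n a b)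
    (hn : n ≤ m) : Within f m a b :=
  let ⟨k, hk, h⟩ := h
  ⟨k, hk.trans hn, h⟩

open Classical in
/-- Whether a word of instructions succeeds. -/
noncomputable def succeeds : List (StackInstr K Γ) → (K → List Γ) → Bool
  | [], _ => true
  | i :: w, s => decide (i.Enabled s) && succeeds w (i.apply s)

theorem succeeds_iff (w : List (StackInstr K Γ)) (s : K → List Γ) :
    succeeds w s = true ↔ ∃ t, Exec w s t := by
  induction w generalizing s with
  | nil => simp [succeeds, Exec]
  | cons i w ih => simp [succeeds, Exec, ih]

/-- The contents of the working stacks after a word of instructions. -/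
def applyWord (w : List (StackInstr K Γ)) (s : K → List Γ) : K → List Γ :=
  w.foldl (fun s i => i.apply s) s

theorem length_apply_le (i : StackInstr K Γ) (s : K → List Γ) (k : K) :
    (i.apply s k).length ≤ (s k).length + 1 := by
  rcases i with ⟨k', a⟩ | ⟨k', a⟩ | ⟨k'⟩
  · by_cases h : k = k'
    · subst h; simp [StackInstr.apply]
    · simp [StackInstr.apply, h]
  · by_cases h : k = k'
    · subst h; simp [StackInstr.apply]; omega
    · simp [StackInstr.apply, h]
  · simp [StackInstr.apply]

theorem length_applyWord_le (w : List (StackInstr K Γ)) (s : K → List Γ) (k : K) :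
    (applyWord w s k).length ≤ (s k).length + w.length := by
  induction w generalizing s with
  | nil => simp [applyWord]
  | cons i w ih =>
    have h1 := ih (i.apply s)
    have h2 := length_apply_le i s k
    simp only [applyWord, List.foldl_cons, List.length_cons] at *
    omega

/-- A whole round of pops is one step of the machine. As `ks` has no repetition, each stack loses at
most one symbol. -/
theorem stepAux_popAll (q : VStmt K Γ Γ₀ Q) (ks : List K) (hks : ks.Nodup) (v : Var K Γ Γ₀ Q) (a o)
    (w : K → List Γ) :
    TM2.stepAux (popAll ks q) v (contents a o w) =
      TM2.stepAux q { v with dirty := v.dirty || ks.any fun k => !(w k).isEmpty }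
        (contents a o fun k => if k ∈ ks then (w k).tail else w k) := by
  induction ks generalizing v w with
  | nil => simp [popAll]
  | cons k ks ih =>
    rw [List.nodup_cons] at hks
    rw [popAll, TM2.stepAux]
    rw [show (contents a o w (work k)).tail = (w k).tail from rfl, update_work, ih hks.2]
    congr 1
    · congr 1
      simp only [List.any_cons, ← Bool.or_assoc]
      congr 1
      · congr 1
        rw [show contents a o w (work k) = w k from rfl]
        cases w k <;> rfl
      · rw [Bool.eq_iff_iff]
        simp only [List.any_eq_true]
        refine exists_congr fun k' => and_congr_right fun hk' => ?_
        rw [Function.update_of_ne (fun h : k' = k => hks.1 (by rw [← h]; exact hk'))]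
    · congr 1
      funext k'
      by_cases h : k' = k
      · subst h; simp [hks.1]
      · simp [h]

variable (M : DFA (StackInstr K Γ) Q) (kin : K) (emb : Γ₀ → Γ) (ks : List K)

theorem step_main_nil (v : Var K Γ Γ₀ Q) (o) (w : K → List Γ) :
    Within (TM2.step (program M ks kin emb)) 1 ⟨some .main, v, contents [] o w⟩
      ⟨some .clear, { v with cur := none }, contents [] o w⟩ := by
  refine Within.single ?_
  simp only [TM2.step, program, TM2.stepAux]
  rw [show (contents [] o w inp).tail = ([] : List (Γ₀ ⊕ StackInstr K Γ)) from rfl, update_inp]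
  rfl

theorem step_main_cons (v : Var K Γ Γ₀ Q) (x : Γ₀ ⊕ StackInstr K Γ) (a o) (w : K → List Γ) :
    Within (TM2.step (program M ks kin emb)) 1 ⟨some .main, v, contents (x :: a) o w⟩
      ⟨some (next (some x)), { v with cur := some x }, contents a o w⟩ := by
  refine Within.single ?_
  simp only [TM2.step, program, TM2.stepAux]
  rw [show (contents (x :: a) o w inp).tail = a from rfl, update_inp]
  rfl

/-- Pushing symbol by symbol reverses the instance, which explains the `reverse` in all later
descriptions of the initial stacks. -/
theorem steps_load (l : List Γ₀) (a o) (v : Var K Γ Γ₀ Q) (w : K → List Γ) :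
    ∃ c, Within (TM2.step (program M ks kin emb)) (2 * l.length)
      ⟨some .main, v, contents (l.map .inl ++ a) o w⟩
      ⟨some .main, { v with cur := c },
        contents a o (Function.update w kin ((l.map emb).reverse ++ w kin))⟩ := by
  induction l generalizing v w with
  | nil => exact ⟨v.cur, by simpa using Within.refl⟩
  | cons x l ih =>
    obtain ⟨c, hc⟩ := ih { v with cur := some (.inl x) } (Function.update w kin (emb x :: w kin))
    refine ⟨c, ?_⟩
    have h1 := step_main_cons M kin emb ks v (.inl x) (l.map .inl ++ a) o w
    have h2 : Within (TM2.step (program M ks kin emb)) 1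
        ⟨some (next (some (.inl x))), { v with cur := some (.inl x) },
          contents (l.map .inl ++ a) o w⟩
        ⟨some .main, { v with cur := some (.inl x) },
          contents (l.map .inl ++ a) o (Function.update w kin (emb x :: w kin))⟩ := by
      refine Within.single ?_
      simp only [TM2.step, program, TM2.stepAux, next]
      rw [show contents (l.map .inl ++ a) o w (work kin) = w kin from rfl, update_work]
    have := (h1.trans h2).trans hc
    simp only [List.map_cons, List.reverse_cons, List.append_assoc, List.cons_append,
      List.nil_append, Function.update_idem, Function.update_self, List.length_cons] at this ⊢
    exact this.mono (by omega)

theorem steps_exec (l : List (StackInstr K Γ)) (o) (v : Var K Γ Γ₀ Q) (w : K → List Γ) :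
    ∃ c, Within (TM2.step (program M ks kin emb)) (2 * l.length)
      ⟨some .main, v, contents (l.map .inr) o w⟩
      ⟨some .main, ⟨c, M.evalFrom v.st l, v.ok && succeeds l w, v.dirty⟩,
        contents [] o (applyWord l w)⟩ := by
  classical
  induction l generalizing v w with
  | nil => exact ⟨v.cur, by simpa [succeeds, applyWord] using Within.refl⟩
  | cons i l ih =>
    obtain ⟨c, hc⟩ := ih ⟨some (.inr i), M.step v.st i, v.ok && decide (i.Enabled w), v.dirty⟩
      (i.apply w)
    refine ⟨c, ?_⟩
    have h1 := step_main_cons M kin emb ks v (.inr i) (l.map .inr) o w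
    have h2 : Within (TM2.step (program M ks kin emb)) 1
        ⟨some (next (some (.inr i))), { v with cur := some (.inr i) }, contents (l.map .inr) o w⟩
        ⟨some .main, ⟨some (.inr i), M.step v.st i, v.ok && decide (i.Enabled w), v.dirty⟩,
          contents (l.map .inr) o (i.apply w)⟩ := by
      refine Within.single ?_
      rcases i with ⟨k, b⟩ | ⟨k, b⟩ | ⟨k⟩
      · simp only [TM2.step, program, TM2.stepAux, next]
        rw [show contents (l.map .inr) o w (work k) = w k from rfl, update_work]
        simp [StackInstr.Enabled, StackInstr.apply]
        exact fun _ => @decide_eq_true _ (Classical.propDecidable _) trivial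
      · simp only [TM2.step, program, TM2.stepAux, next]
        rw [show contents (l.map .inr) o w (work k) = w k from rfl, update_work]
        simp [StackInstr.Enabled, StackInstr.apply]
        congr
      · simp only [TM2.step, program, TM2.stepAux, next]
        rw [show contents (l.map .inr) o w (work k) = w k from rfl]
        simp [StackInstr.Enabled, StackInstr.apply]
        congr
    have := (h1.trans h2).trans hc
    rw [Bool.and_assoc] at this
    exact this.mono (by rw [List.length_cons]; omega)

/-- Each round shortens all nonempty stacks by one; one more round notices that nothing is left. -/
theorem steps_clear (hks : ks.Nodup) (hall : ∀ k, k ∈ ks) (n : ℕ) (o) (v : Var K Γ Γ₀ Q)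
    (w : K → List Γ) (hw : ∀ k, (w k).length ≤ n) :
    Within (TM2.step (program M ks kin emb)) (n + 1)
      ⟨some .clear, v, contents [] o w⟩
      ⟨some .output, { v with dirty := false }, contents [] o fun _ => []⟩ := by
  have key : TM2.step (program M ks kin emb) ⟨some .clear, v, contents [] o w⟩ =
      some ⟨some (cond (ks.any fun k => !(w k).isEmpty) .clear .output),
        { v with dirty := ks.any fun k => !(w k).isEmpty }, contents [] o fun k => (w k).tail⟩ := by
    simp only [TM2.step, program, TM2.stepAux]
    rw [stepAux_popAll _ _ hks]
    simp only [hall, if_true, Bool.false_or, TM2.stepAux]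
    cases ks.any fun k => !(w k).isEmpty <;> rfl
  induction n generalizing v w with
  | zero =>
    have hw0 : ∀ k, w k = [] := fun k => List.length_eq_zero_iff.1 (Nat.le_zero.1 (hw k))
    refine Within.single ?_
    have h0 : (ks.any fun k => !(w k).isEmpty) = false := List.any_eq_false.2 (by simp [hw0])
    rw [key, h0]
    simp [hw0]
  | succ n ih =>
    by_cases h : (ks.any fun k => !(w k).isEmpty) = true
    · rw [h] at key
      have := ih { v with dirty := true } (fun k => (w k).tail)
        (fun k => by have := hw k; simp; omega) (by
          simp only [TM2.step, program, TM2.stepAux]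
          rw [stepAux_popAll _ _ hks]
          simp only [hall, if_true, Bool.false_or, TM2.stepAux]
          cases ks.any fun k => !((w k).tail).isEmpty <;> rfl)
      exact ((Within.single key).trans this).mono (by omega)
    · rw [Bool.not_eq_true] at h
      rw [h] at key
      have hw0 : ∀ k, w k = [] := by simpa [hall] using h
      refine Within.mono (Within.single ?_) (by omega : 1 ≤ n + 1 + 1)
      rw [key]
      simp [hw0]

open Classical in
theorem steps_output (v : Var K Γ Γ₀ Q) :
    Within (TM2.step (program M ks kin emb)) 1
      ⟨some .output, v, contents [] [] fun _ => []⟩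
      ⟨none, ⟨none, M.start, true, false⟩,
        contents [] [v.ok && decide (v.st ∈ M.accept)] fun _ => []⟩ := by
  refine Within.single ?_
  simp only [TM2.step, program, TM2.stepAux]
  rw [show contents [] [] (fun _ => []) (out : VStack K) = ([] : List Bool) from rfl]
  exact congrArg some (congrArg _ (update_out _ _ _ _))

-- Two steps for each symbol of the instance and the certificate, one to notice the end of the
-- input, at most `l.length + c.length + 1` rounds of clearing since no stack is higher than
-- `l.length + c.length`, and one step for the output.
open Classical in
theorem steps_total (hks : ks.Nodup) (hall : ∀ k, k ∈ ks) (l : List Γ₀)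
    (c : List (StackInstr K Γ)) :
    Within (TM2.step (program M ks kin emb)) (3 * (l.length + c.length) + 3)
      ⟨some .main, ⟨none, M.start, true, false⟩,
        contents (l.map .inl ++ c.map .inr) [] fun _ => []⟩
      ⟨none, ⟨none, M.start, true, false⟩,
        contents [] [succeeds c (Function.update (fun _ => []) kin (l.map emb).reverse) &&
          decide (c ∈ M.accepts)] fun _ => []⟩ := by
  obtain ⟨c1, h1⟩ := steps_load M kin emb ks l (c.map .inr) [] ⟨none, M.start, true, false⟩
    (fun _ => [])
  rw [List.append_nil] at h1
  obtain ⟨c2, h2⟩ := steps_exec M kin emb ks c [] ⟨c1, M.start, true, false⟩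
    (Function.update (fun _ => []) kin (l.map emb).reverse)
  have h3 := step_main_nil M kin emb ks ⟨c2, M.evalFrom M.start c,
    true && succeeds c (Function.update (fun _ => []) kin (l.map emb).reverse), false⟩ []
    (applyWord c (Function.update (fun _ => []) kin (l.map emb).reverse))
  have h4 := steps_clear M kin emb ks hks hall (l.length + c.length) [] ⟨none, M.evalFrom M.start c,
    true && succeeds c (Function.update (fun _ => []) kin (l.map emb).reverse), false⟩
    (applyWord c (Function.update (fun _ => []) kin (l.map emb).reverse)) (by
      intro k
      refine (length_applyWord_le _ _ _).trans ?_
      by_cases h : k = kin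
      · subst h; simp
      · simp [h])
  have h5 := steps_output M kin emb ks ⟨none, M.evalFrom M.start c,
    true && succeeds c (Function.update (fun _ => []) kin (l.map emb).reverse), false⟩
  have := ((((h1.trans h2).trans h3).trans h4).trans h5).mono
    (by omega : _ ≤ 3 * (l.length + c.length) + 3)
  simpa only [Bool.true_and, DFA.mem_accepts, DFA.eval] using this

/-- A problem is in NP if its instances are recognized by a regular set of instruction words on
finitely many stacks. -/
theorem inNP_of_isRegular {α K Γ Γ₀ : Type} [DecidableEq K] [Fintype K] [Fintype Γ] [Fintype Γ₀]
    (e : Computability.Encoding α Γ₀) (S : Set α) (kin : K) (emb : Γ₀ → Γ) {L : StackProg K Γ}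
    (hL : L.IsRegular) (g : Polynomial ℕ)
    (hsound : ∀ x t, L.Runs (Function.update (fun _ => []) kin ((e.encode x).map emb).reverse) t →
      x ∈ S)
    (hcompl : ∀ x ∈ S, ∃ t, L.RunsIn (g.eval (e.encode x).length)
      (Function.update (fun _ => []) kin ((e.encode x).map emb).reverse) t) :
    InNP e S := by
  classical
  obtain ⟨Q, _, M, hM⟩ := hL
  -- The certificate is the instruction word itself, so the nondeterminism of the program is
  -- resolved by the certificate.
  refine ⟨StackInstr K Γ, Fintype.ofFinite _, g,
    fun x => succeeds x.2 (Function.update (fun _ => []) kin ((e.encode x.1).map emb).reverse) &&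
      decide (x.2 ∈ M.accepts), ⟨?_⟩, ?_⟩
  · refine
      { tm := machine M kin emb
        inputAlphabet := Equiv.refl _
        outputAlphabet := Equiv.refl _
        time := Polynomial.C 3 * Polynomial.X + Polynomial.C 3
        outputsFun := ?_ }
    rintro ⟨x, c⟩
    have h := steps_total M kin emb Finset.univ.toList (Finset.nodup_toList _) (by simp)
      (e.encode x) c
    refine Classical.choice ?_
    obtain ⟨k, hk, h⟩ := h
    refine ⟨⟨⟨k, ?_⟩, ?_⟩⟩
    · have h1 : initList (machine M kin emb) (List.map (Equiv.refl _).invFun (encodePair e (x, c))) =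
          ⟨some .main, ⟨none, M.start, true, false⟩,
            contents ((e.encode x).map .inl ++ c.map .inr) [] fun _ => []⟩ := by
        simp only [initList, machine]
        congr 1
        funext k'
        rcases k' with _ | _ | k'
        · exact List.map_id _
        · rfl
        · rfl
      have h2 : ∀ b : Bool, haltList (machine M kin emb)
          (List.map (Equiv.refl _).invFun (Computability.encodeBool b)) =
          ⟨none, ⟨none, M.start, true, false⟩, contents [] [b] fun _ => []⟩ := by
        intro b
        simp only [haltList, machine]
        congr 1
        funext k'
        rcases k' with _ | _ | k' <;> rfl
      rw [Option.map_some]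
      erw [h1, h2]
      exact h
    · refine hk.trans ?_
      simp [encodePair]
  · intro x
    constructor
    · intro hx
      obtain ⟨t, w, hw, hlen, h⟩ := hcompl x hx
      refine ⟨w, hlen, ?_⟩
      rw [Bool.and_eq_true, succeeds_iff, decide_eq_true_eq, hM]
      exact ⟨⟨t, h⟩, hw⟩
    · rintro ⟨c, -, h⟩
      rw [Bool.and_eq_true, succeeds_iff, decide_eq_true_eq, hM] at h
      obtain ⟨⟨t, h⟩, hc⟩ := h
      exact hsound x t ⟨c, hc, h⟩

end Verifier

/-! ### Arithmetic of binary numbers on stacks -/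

namespace MIPVerifier

open Computability StackProg

/-- The stacks of the verifier for mixed-integer feasibility. -/
inductive Reg
  -- `I` is the reversed input and `J` its unread part. `X` is the guessed vector; `G` holds, in
  -- reverse, what has been guessed or read of it. `Tr` collects garbage. `R` and `Z` are the
  -- operands of the multiplication, with scratch stacks `R2`, `Z2` and the carry `Cy`. `W` is a
  -- common denominator, `F` a sign, `S` a product kept for comparison, `C` a guessed number; `P`
  -- and `M` add up the positive and the negative terms.
  | I | J | X | G | Tr | R | Z | R2 | Z2 | Cy | W | F | S | C | P | M
  deriving DecidableEq

instance : Fintype Reg :=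
  ⟨{.I, .J, .X, .G, .Tr, .R, .Z, .R2, .Z2, .Cy, .W, .F, .S, .C, .P, .M}, fun x => by
    cases x <;> decide⟩

/-- Contents of all stacks. -/
abbrev Mem := Reg → List Γ'

/-- Programs on the stacks. -/
abbrev Prog := StackProg Reg Γ'

/-- The number whose bits are on top of a stack, least significant bit first. -/
def val : List Γ' → ℕ
  | .bit b :: l => b.toNat + 2 * val l
  | _ => 0

@[simp] theorem val_nil : val [] = 0 := rfl

@[simp] theorem val_bit (b : Bool) (l : List Γ') : val (.bit b :: l) = b.toNat + 2 * val l := rfl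

/-- All symbols of the list are bits. -/
def IsBits (l : List Γ') : Prop := ∀ x ∈ l, ∃ b, x = .bit b

@[simp] theorem isBits_nil : IsBits [] := by simp [IsBits]

@[simp] theorem isBits_cons {x : Γ'} {l : List Γ'} :
    IsBits (x :: l) ↔ (∃ b, x = .bit b) ∧ IsBits l := by simp [IsBits]

@[simp] theorem isBits_map (l : List Bool) : IsBits (l.map .bit) := by
  intro x hx
  obtain ⟨b, -, rfl⟩ := List.mem_map.1 hx
  exact ⟨b, rfl⟩

@[simp] theorem isBits_reverse {l : List Γ'} : IsBits l.reverse ↔ IsBits l := by simp [IsBits]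

/-- Nondeterministic choice of a symbol. -/
def anySym (f : Γ' → Prog) : Prog :=
  choice (fun b => f (.bit b)) + (f .comma + (f .bra + (f .ket + f .blank)))

theorem runs_anySym {f : Γ' → Prog} {s t : Mem} : Runs (anySym f) s t ↔ ∃ x, Runs (f x) s t := by
  simp only [anySym, runs_add, runs_choice]
  constructor
  · rintro (⟨b, h⟩ | h | h | h | h) <;> exact ⟨_, h⟩
  · rintro ⟨_ | b | _ | _ | _, h⟩
    · simp [h]
    · exact Or.inl ⟨b, h⟩
    all_goals simp [h]

theorem runsIn_anySym {f : Γ' → Prog} {s t : Mem} {n : ℕ} (x : Γ') (h : RunsIn (f x) n s t) :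
    RunsIn (anySym f) n s t := by
  rcases x with _ | b | _ | _ | _
  · exact h.inr.inr.inr.inr
  · exact (RunsIn.choice h).inl
  · exact h.inl.inr.inr
  · exact h.inl.inr.inr.inr
  · exact h.inl.inr

theorem isRegular_anySym {f : Γ' → Prog} (h : ∀ x, (f x).IsRegular) : (anySym f).IsRegular :=
  (isRegular_choice fun b => h (.bit b)).add
    ((h .comma).add ((h .bra).add ((h .ket).add (h .blank))))

/-- Move the contents of the stack `a` to the stack `b`. -/
def move (a b : Reg) : Prog := (anySym fun x => pop a x * push b x)∗ * empty a

theorem isRegular_move (a b : Reg) : (move a b).IsRegular :=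
  (isRegular_anySym fun _ => (isRegular_pop _ _).mul (isRegular_push _ _)).kstar.mul
    (isRegular_empty _)

/-- A run that leaves the loop too early is blocked by the final `empty a`. In this way a star
followed by a test acts as a while loop. -/
theorem move_sound {a b : Reg} (hab : a ≠ b) {s t : Mem} (h : Runs (move a b) s t) :
    t a = [] ∧ t b = (s a).reverse ++ s b ∧ ∀ k ∉ [a, b], t k = s k := by
  obtain ⟨u, h1, h2⟩ := runs_mul.1 h
  obtain ⟨h2, rfl⟩ := runs_empty.1 h2
  rw [runs_star] at h1
  clear h
  induction h1 using Relation.ReflTransGen.head_induction_on with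
  | refl => simp [h2]
  | head h _ ih =>
    obtain ⟨x, h⟩ := runs_anySym.1 h
    obtain ⟨v, hv, hw⟩ := runs_mul.1 h
    obtain ⟨l, hl, rfl⟩ := runs_pop.1 hv
    rw [runs_push] at hw
    subst hw
    obtain ⟨i1, i2, i3⟩ := ih
    refine ⟨i1, ?_, fun k hk => ?_⟩
    · rw [i2]; simp [hab, hab.symm, hl]
    · rw [i3 k hk]
      simp only [List.mem_cons, List.not_mem_nil, or_false, not_or] at hk
      simp [hk.1, hk.2]

theorem move_complete {a b : Reg} (hab : a ≠ b) (s : Mem) :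
    ∃ t, RunsIn (move a b) (2 * (s a).length + 1) s t := by
  suffices H : ∀ n (s : Mem), (s a).length = n →
      ∃ t, RunsIn (anySym fun x => pop a x * push b x)∗ (2 * n) s t ∧ t a = [] by
    obtain ⟨t, ht, h⟩ := H _ s rfl
    exact ⟨t, ht.mul (runsIn_empty h)⟩
  intro n
  induction n with
  | zero => exact fun s hs => ⟨s, RunsIn.star_nil, List.length_eq_zero_iff.1 hs⟩
  | succ n ih =>
    intro s hs
    obtain ⟨x, l, hl⟩ := List.exists_cons_of_length_eq_add_one hs
    obtain ⟨t, ht, h⟩ := ih (Function.update (Function.update s a l) b (x :: Function.update s a l b))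
      (by simp [hab, hl] at hs ⊢; exact hs)
    refine ⟨t, ?_, h⟩
    exact (RunsIn.star_cons (runsIn_anySym x ((runsIn_pop hl).mul (runsIn_push _ _))) ht).mono
      (by omega)

/-- Empty the stack `a`. -/
def clear (a : Reg) : Prog := (anySym fun x => pop a x)∗ * empty a

theorem isRegular_clear (a : Reg) : (clear a).IsRegular :=
  (isRegular_anySym fun _ => isRegular_pop _ _).kstar.mul (isRegular_empty _)

theorem clear_sound {a : Reg} {s t : Mem} (h : Runs (clear a) s t) :
    t a = [] ∧ ∀ k ∉ [a], t k = s k := by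
  obtain ⟨u, h1, h2⟩ := runs_mul.1 h
  obtain ⟨h2, rfl⟩ := runs_empty.1 h2
  rw [runs_star] at h1
  clear h
  induction h1 using Relation.ReflTransGen.head_induction_on with
  | refl => simp [h2]
  | head h _ ih =>
    obtain ⟨x, h⟩ := runs_anySym.1 h
    obtain ⟨l, hl, rfl⟩ := runs_pop.1 h
    refine ⟨h2, fun k hk => ?_⟩
    rw [ih.2 k hk]
    simp only [List.mem_cons, List.not_mem_nil, or_false] at hk
    simp [hk]

theorem clear_complete (a : Reg) (s : Mem) :
    ∃ t, RunsIn (clear a) ((s a).length + 1) s t := by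
  suffices H : ∀ n (s : Mem), (s a).length = n →
      ∃ t, RunsIn (anySym fun x => pop a x)∗ n s t ∧ t a = [] by
    obtain ⟨t, ht, h⟩ := H _ s rfl
    exact ⟨t, ht.mul (runsIn_empty h)⟩
  intro n
  induction n with
  | zero => exact fun s hs => ⟨s, RunsIn.star_nil, List.length_eq_zero_iff.1 hs⟩
  | succ n ih =>
    intro s hs
    obtain ⟨x, l, hl⟩ := List.exists_cons_of_length_eq_add_one hs
    obtain ⟨t, ht, h⟩ := ih (Function.update s a l) (by simp [hl] at hs ⊢; exact hs)
    exact ⟨t, (RunsIn.star_cons (runsIn_anySym x (runsIn_pop hl)) ht).mono (by omega), h⟩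

/-! ### Reading bits and comparing numbers -/

/-- Remove the last bit `b` of the number on `r`; nothing is removed from an empty stack. -/
def getBit (r : Reg) (b : Bool) : Prog := pop r (.bit b) + bif b then 0 else empty r

theorem isRegular_getBit (r : Reg) (b : Bool) : (getBit r b).IsRegular :=
  (isRegular_pop _ _).add (by cases b; exacts [isRegular_empty _, Language.isRegular_zero])

theorem not_runs_zero {s t : Mem} : ¬ Runs (0 : Prog) s t := fun ⟨_, h, _⟩ => h

/-- An empty stack delivers the bit `false`, so numbers of different lengths are treated as if
padded with leading zeros. -/
theorem getBit_sound {r : Reg} {b : Bool} {s t : Mem} (h : Runs (getBit r b) s t) :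
    val (s r) = b.toNat + 2 * val (t r) ∧ ∀ k ∉ [r], t k = s k := by
  rcases runs_add.1 h with h | h
  · obtain ⟨l, hl, rfl⟩ := runs_pop.1 h
    refine ⟨by simp [hl], fun k hk => ?_⟩
    simp only [List.mem_cons, List.not_mem_nil, or_false] at hk
    simp [hk]
  · cases b
    · obtain ⟨h, rfl⟩ := runs_empty.1 h
      simp [h]
    · exact absurd h not_runs_zero

theorem exists_val_eq {l : List Γ'} (hl : IsBits l) {n : ℕ} (hn : l.length ≤ n + 1) :
    (∃ b l', l = .bit b :: l' ∧ IsBits l' ∧ l'.length ≤ n) ∨ l = [] := by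
  rcases l with _ | ⟨x, l⟩
  · exact Or.inr rfl
  · obtain ⟨⟨b, rfl⟩, h⟩ := isBits_cons.1 hl
    exact Or.inl ⟨b, l, rfl, h, by simpa using hn⟩

theorem getBit_complete {r : Reg} {s : Mem} (h : IsBits (s r)) {n : ℕ}
    (hn : (s r).length ≤ n + 1) : ∃ b l, RunsIn (getBit r b) 1 s (Function.update s r l) ∧
      IsBits l ∧ l.length ≤ n ∧ val (s r) = b.toNat + 2 * val l := by
  rcases exists_val_eq h hn with ⟨b, l, hl, hb, hln⟩ | h0
  · exact ⟨b, l, (runsIn_pop hl).inl, hb, hln, by simp [hl]⟩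
  · refine ⟨false, [], ?_, isBits_nil, by simp, by simp [h0]⟩
    have := (runsIn_empty (Γ := Γ') h0)
    rw [show Function.update s r [] = s by rw [← h0, Function.update_eq_self]]
    exact RunsIn.inr this

/-- Check that two numbers are equal; this empties both stacks. -/
def eqCheck (a b : Reg) : Prog := (choice fun x => getBit a x * getBit b x)∗ * (empty a * empty b)

theorem isRegular_eqCheck (a b : Reg) : (eqCheck a b).IsRegular :=
  (isRegular_choice fun _ => (isRegular_getBit _ _).mul (isRegular_getBit _ _)).kstar.mul
    ((isRegular_empty _).mul (isRegular_empty _))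

theorem eqCheck_sound {a b : Reg} (hab : a ≠ b) {s t : Mem} (h : Runs (eqCheck a b) s t) :
    val (s a) = val (s b) ∧ t a = [] ∧ t b = [] ∧ ∀ k ∉ [a, b], t k = s k := by
  obtain ⟨u, h1, h2⟩ := runs_mul.1 h
  obtain ⟨v, h2, h3⟩ := runs_mul.1 h2
  obtain ⟨h2, rfl⟩ := runs_empty.1 h2
  obtain ⟨h3, rfl⟩ := runs_empty.1 h3
  rw [runs_star] at h1
  clear h
  induction h1 using Relation.ReflTransGen.head_induction_on with
  | refl => simp [h2, h3]
  | head h _ ih =>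
    obtain ⟨x, h⟩ := runs_choice.1 h
    obtain ⟨v, hv, hw⟩ := runs_mul.1 h
    obtain ⟨e1, f1⟩ := getBit_sound hv
    obtain ⟨e2, f2⟩ := getBit_sound hw
    obtain ⟨i0, -, -, i3⟩ := ih
    rw [f2 a (by simpa using hab)] at i0
    rw [f1 b (by simpa using hab.symm)] at e2
    refine ⟨by omega, h2, h3, fun k hk => ?_⟩
    rw [i3 k hk, f2 k (by simp_all), f1 k (by simp_all)]

theorem eqCheck_complete {a b : Reg} (hab : a ≠ b) {s : Mem} {n : ℕ} (ha : IsBits (s a))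
    (hb : IsBits (s b)) (han : (s a).length ≤ n) (hbn : (s b).length ≤ n)
    (h : val (s a) = val (s b)) : ∃ t, RunsIn (eqCheck a b) (2 * n + 2) s t := by
  suffices H : ∀ n (s : Mem), IsBits (s a) → IsBits (s b) → (s a).length ≤ n → (s b).length ≤ n →
      val (s a) = val (s b) →
      ∃ t, RunsIn (choice fun x => getBit a x * getBit b x)∗ (2 * n) s t ∧ t a = [] ∧ t b = [] by
    obtain ⟨t, ht, h1, h2⟩ := H n s ha hb han hbn h
    exact ⟨t, ht.mul ((runsIn_empty h1).mul (runsIn_empty h2))⟩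
  intro n
  induction n with
  | zero =>
    exact fun s _ _ h1 h2 _ => ⟨s, RunsIn.star_nil, List.length_eq_zero_iff.1 (Nat.le_zero.1 h1),
      List.length_eq_zero_iff.1 (Nat.le_zero.1 h2)⟩
  | succ n ih =>
    intro s ha hb han hbn h
    obtain ⟨x, l, r1, hl, hln, e1⟩ := getBit_complete ha han
    obtain ⟨y, m, r2, hm, hmn, e2⟩ := getBit_complete (s := Function.update s a l) (r := b)
      (by simpa [hab.symm] using hb) (by simpa [hab.symm] using hbn)
    rw [Function.update_of_ne hab.symm] at e2
    have hxy : x = y := by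
      cases x <;> cases y <;> simp at e1 e2 ⊢ <;> omega
    subst hxy
    obtain ⟨t, ht, h1, h2⟩ := ih (Function.update (Function.update s a l) b m)
      (by simpa [hab] using hl) (by simpa using hm) (by simpa [hab] using hln)
      (by simpa using hmn) (by simp [hab]; omega)
    exact ⟨t, (RunsIn.star_cons (RunsIn.choice (b := x) (r1.mul r2)) ht).mono (by omega), h1, h2⟩

/-- Like `getBit`, but the removed bit is pushed on `r'`. -/
def keepBit (r r' : Reg) (b : Bool) : Prog :=
  pop r (.bit b) * push r' (.bit b) + bif b then 0 else empty r

theorem isRegular_keepBit (r r' : Reg) (b : Bool) : (keepBit r r' b).IsRegular :=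
  ((isRegular_pop _ _).mul (isRegular_push _ _)).add
    (by cases b; exacts [isRegular_empty _, Language.isRegular_zero])

/-- The equation between the two stacks is the invariant that lets the operand be restored
afterwards: only genuine bits are transferred, never a padding zero. -/
theorem keepBit_sound {r r' : Reg} (hr : r ≠ r') {b : Bool} {s t : Mem}
    (h : Runs (keepBit r r' b) s t) :
    val (s r) = b.toNat + 2 * val (t r) ∧ (t r).reverse ++ t r' = (s r).reverse ++ s r' ∧
      ∀ k ∉ [r, r'], t k = s k := by
  rcases runs_add.1 h with h | h
  · obtain ⟨u, h1, h2⟩ := runs_mul.1 h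
    obtain ⟨l, hl, rfl⟩ := runs_pop.1 h1
    rw [runs_push] at h2
    subst h2
    refine ⟨by simp [hl, hr], by simp [hl, hr, hr.symm], fun k hk => ?_⟩
    simp only [List.mem_cons, List.not_mem_nil, or_false, not_or] at hk
    simp [hk.1, hk.2]
  · cases b
    · obtain ⟨h, rfl⟩ := runs_empty.1 h
      simp [h]
    · exact absurd h not_runs_zero

theorem keepBit_complete {r r' : Reg} (hr : r ≠ r') {s : Mem} (h : IsBits (s r)) {n : ℕ}
    (hn : (s r).length ≤ n + 1) : ∃ b t, RunsIn (keepBit r r' b) 2 s t ∧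
      IsBits (t r) ∧ (t r).length ≤ n := by
  rcases exists_val_eq h hn with ⟨b, l, hl, hb, hln⟩ | h0
  · refine ⟨b, _, ((runsIn_pop hl).mul (runsIn_push _ _)).inl, ?_, ?_⟩
    · simpa [hr] using hb
    · simpa [hr] using hln
  · exact ⟨false, s, ((runsIn_empty h0).mono (by omega)).inr, by simp [h0], by simp [h0]⟩

/-! ### Addition -/

/-- One step of the addition of `r` to `z`. -/
def addStep (r z : Reg) : Prog :=
  choice fun c => choice fun x => choice fun y =>
    pop .Cy (.bit c) * (keepBit r .R2 x * (getBit z y *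
      (push .Z2 (.bit (xor c (xor x y))) * push .Cy (.bit ((c && x) || (c && y) || (x && y))))))

theorem isRegular_addStep (r z : Reg) : (addStep r z).IsRegular :=
  isRegular_choice fun _ => isRegular_choice fun _ => isRegular_choice fun _ =>
    (isRegular_pop _ _).mul ((isRegular_keepBit _ _ _).mul ((isRegular_getBit _ _).mul
      ((isRegular_push _ _).mul (isRegular_push _ _))))

/-- The stacks used by the addition. -/
abbrev addScratch : List Reg := [.R2, .Z2, .Cy]

/-- A full adder. The carry plus both operands equals the digit that is written plus twice the same
quantity after the step. -/
theorem addStep_sound {r z : Reg} (hrz : r ≠ z) (hr : r ∉ addScratch) (hz : z ∉ addScratch)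
    {c : Bool} {s t : Mem} (hc : s .Cy = [.bit c]) (h : Runs (addStep r z) s t) :
    ∃ c' d : Bool, t .Cy = [.bit c'] ∧ t .Z2 = .bit d :: s .Z2 ∧
      c.toNat + val (s r) + val (s z) = d.toNat + 2 * (c'.toNat + val (t r) + val (t z)) ∧
      (t r).reverse ++ t .R2 = (s r).reverse ++ s .R2 ∧
      ∀ k ∉ r :: z :: addScratch, t k = s k := by
  simp only [List.mem_cons, List.not_mem_nil, or_false, not_or] at hr hz
  obtain ⟨hr1, hr2, hr3⟩ := hr
  obtain ⟨hz1, hz2, hz3⟩ := hz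
  simp only [addStep, runs_choice] at h
  obtain ⟨c', x, y, h⟩ := h
  obtain ⟨s1, h1, h⟩ := runs_mul.1 h
  obtain ⟨s2, h2, h⟩ := runs_mul.1 h
  obtain ⟨s3, h3, h⟩ := runs_mul.1 h
  obtain ⟨s4, h4, h5⟩ := runs_mul.1 h
  obtain ⟨l, hl, rfl⟩ := runs_pop.1 h1
  rw [hc] at hl
  obtain ⟨rfl, rfl⟩ : c = c' ∧ l = [] := by simpa [eq_comm] using hl
  obtain ⟨e2, i2, f2⟩ := keepBit_sound hr1 h2
  obtain ⟨e3, f3⟩ := getBit_sound h3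
  rw [runs_push] at h4 h5
  subst h4 h5
  have a1 : s2 z = s z := by rw [f2 z (by simp [hrz.symm, hz1])]; simp [hz3]
  have a2 : s3 r = s2 r := f3 r (by simp [hrz])
  have a3 : s3 .R2 = s2 .R2 := f3 _ (by simp [Ne.symm hz1])
  have a4 : s3 .Z2 = s .Z2 := by
    rw [f3 _ (by simp [Ne.symm hz2]), f2 _ (by simp [Ne.symm hr2])]; simp
  have a5 : s3 .Cy = [] := by
    rw [f3 _ (by simp [Ne.symm hz3]), f2 _ (by simp [Ne.symm hr3])]; simp
  rw [Function.update_of_ne hr3] at e2 i2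
  rw [a1] at e3
  rw [Function.update_of_ne (by simp)] at i2
  refine ⟨(c && x) || (c && y) || (x && y), xor c (xor x y), ?_, ?_, ?_, ?_, ?_⟩
  · simp [a5]
  · simp [a4]
  · simp only [Function.update_of_ne hr3, Function.update_of_ne hr2, Function.update_of_ne hz3,
      Function.update_of_ne hz2, a2, e2, e3]
    cases c <;> cases x <;> cases y <;> simp <;> ring
  · simp [hr3, hr2, a2, a3, i2]
  · intro k hk
    simp only [List.mem_cons, List.not_mem_nil, or_false, not_or] at hk
    obtain ⟨k1, k2, k3, k4, k5⟩ := hk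
    rw [Function.update_of_ne k5, Function.update_of_ne k4, f3 k (by simp [k2]),
      f2 k (by simp [k1, k3]), Function.update_of_ne k5]

theorem addLoop_sound {r z : Reg} (hrz : r ≠ z) (hr : r ∉ addScratch) (hz : z ∉ addScratch)
    {c : Bool} {s t : Mem} (hc : s .Cy = [.bit c]) (h : Runs (addStep r z)∗ s t)
    (htr : t r = []) (htz : t z = []) (hct : t .Cy = [.bit false]) :
    (∃ l, t .Z2 = l ++ s .Z2 ∧ val l.reverse = c.toNat + val (s r) + val (s z)) ∧
      t .R2 = (s r).reverse ++ s .R2 ∧ ∀ k ∉ r :: z :: addScratch, t k = s k := by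
  rw [runs_star] at h
  induction h using Relation.ReflTransGen.head_induction_on generalizing c with
  | refl =>
    rw [hct] at hc
    obtain rfl : c = false := by simpa [eq_comm] using hc
    exact ⟨⟨[], by simp [htr, htz]⟩, by simp [htr], fun _ _ => rfl⟩
  | head h _ ih =>
    obtain ⟨c', d, h1, h2, h3, h4, h5⟩ := addStep_sound hrz hr hz hc h
    obtain ⟨⟨l, hl, hv⟩, i2, i3⟩ := ih h1
    refine ⟨⟨l ++ [.bit d], by simp [hl, h2], ?_⟩, by rw [i2, h4], fun k hk => ?_⟩
    · rw [List.reverse_append, List.reverse_singleton, List.singleton_append, val_bit, hv]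
      exact h3.symm
    · rw [i3 k hk, h5 k hk]

/-- Operands of at most `n` bits are consumed after `n` steps; one further step may be needed to
write the last carry. Each step takes 6 instructions. -/
theorem addLoop_complete {r z : Reg} (hrz : r ≠ z) (hr : r ∉ addScratch) (hz : z ∉ addScratch)
    (n : ℕ) {c : Bool} {s : Mem} (hc : s .Cy = [.bit c]) (hbr : IsBits (s r)) (hbz : IsBits (s z))
    (hnr : (s r).length ≤ n) (hnz : (s z).length ≤ n) (hb : IsBits (s .Z2)) :
    ∃ t, RunsIn (addStep r z)∗ (6 * (n + 1)) s t ∧ t r = [] ∧ t z = [] ∧ t .Cy = [.bit false] ∧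
      IsBits (t .Z2) ∧ (t .Z2).length ≤ (s .Z2).length + (n + 1) := by
  have step : ∀ (m : ℕ) (c : Bool) (s : Mem), s .Cy = [.bit c] → IsBits (s r) → IsBits (s z) →
      (s r).length ≤ m + 1 → (s z).length ≤ m + 1 →
      ∃ c' t, RunsIn (addStep r z) 6 s t ∧ IsBits (t r) ∧ IsBits (t z) ∧ (t r).length ≤ m ∧
        (t z).length ≤ m ∧ t .Cy = [.bit c'] ∧ ∃ d, t .Z2 = .bit d :: s .Z2 := by
    intro m c s hc hbr hbz hnr hnz
    have hr' := hr
    have hz' := hz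
    simp only [List.mem_cons, List.not_mem_nil, or_false, not_or] at hr hz
    obtain ⟨hr1, hr2, hr3⟩ := hr
    obtain ⟨hz1, hz2, hz3⟩ := hz
    obtain ⟨x, s2, r2, b2, l2⟩ := keepBit_complete hr1 (s := Function.update s .Cy []) (n := m)
      (by simpa [hr3] using hbr) (by simpa [hr3] using hnr)
    obtain ⟨e2, i2, f2⟩ := keepBit_sound hr1 r2.runs
    have a1 : s2 z = s z := by rw [f2 z (by simp [hrz.symm, hz1])]; simp [hz3]
    obtain ⟨y, l, r3, b3, l3, e3⟩ := getBit_complete (s := s2) (r := z) (n := m)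
      (by rwa [a1]) (by rwa [a1])
    have hrun : RunsIn (addStep r z) 6 s _ :=
      RunsIn.choice (b := c) (RunsIn.choice (b := x) (RunsIn.choice (b := y)
        ((runsIn_pop hc).mul (r2.mul (r3.mul ((runsIn_push _ _).mul (runsIn_push _ _)))))))
    obtain ⟨c', d, h1, h2, -, -, -⟩ := addStep_sound hrz hr' hz' hc hrun.runs
    refine ⟨c', _, hrun, ?_, ?_, ?_, ?_, h1, d, h2⟩
    · simpa [hr3, hr2, hrz] using b2
    · simpa [hz3, hz2] using b3
    · simpa [hr3, hr2, hrz] using l2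
    · simpa [hz3, hz2] using l3
  induction n generalizing s c with
  | zero =>
    have hsr : s r = [] := List.length_eq_zero_iff.1 (Nat.le_zero.1 hnr)
    have hsz : s z = [] := List.length_eq_zero_iff.1 (Nat.le_zero.1 hnz)
    cases c
    · exact ⟨s, RunsIn.star_nil.mono (by omega), hsr, hsz, hc, hb, by omega⟩
    · obtain ⟨c', t, h1, -, -, h4, h5, h6, d, h7⟩ := step 0 _ s hc hbr hbz (by omega) (by omega)
      have htr : t r = [] := List.length_eq_zero_iff.1 (Nat.le_zero.1 h4)
      have htz : t z = [] := List.length_eq_zero_iff.1 (Nat.le_zero.1 h5)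
      refine ⟨t, (RunsIn.star_cons h1 RunsIn.star_nil).mono (by omega), htr, htz, ?_, ?_, ?_⟩
      · obtain ⟨c'', d', k1, -, k3, -⟩ := addStep_sound hrz hr hz hc h1.runs
        rw [hsr, hsz, htr, htz] at k3
        rw [k1]
        cases c'' <;> cases d' <;> simp at k3 ⊢
      · simp [h7, hb]
      · simp [h7]
  | succ n ih =>
    obtain ⟨c', t, h1, h2, h3, h4, h5, h6, d, h7⟩ := step n _ s hc hbr hbz hnr hnz
    obtain ⟨u, k1, k2, k3, k4, k5, k6⟩ := ih h6 h2 h3 h4 h5 (by simp [h7, hb])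
    refine ⟨u, (RunsIn.star_cons h1 k1).mono (by omega), k2, k3, k4, k5, ?_⟩
    rw [h7] at k6
    simp only [List.length_cons] at k6
    omega

/-- Add the number on `r` to the number on `z`. -/
def add (r z : Reg) : Prog :=
  push .Cy (.bit false) * ((addStep r z)∗ * (pop .Cy (.bit false) * (empty r * (empty z *
    (move .R2 r * move .Z2 z)))))

theorem isRegular_add (r z : Reg) : (add r z).IsRegular :=
  (isRegular_push _ _).mul ((isRegular_addStep _ _).kstar.mul ((isRegular_pop _ _).mul
    ((isRegular_empty _).mul ((isRegular_empty _).mul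
      ((isRegular_move _ _).mul (isRegular_move _ _))))))

theorem add_sound {r z : Reg} (hrz : r ≠ z) (hr : r ∉ addScratch) (hz : z ∉ addScratch)
    {s t : Mem} (hs : ∀ k ∈ addScratch, s k = []) (h : Runs (add r z) s t) :
    val (t z) = val (s z) + val (s r) ∧ ∀ k ∉ [z], t k = s k := by
  have hr' := hr
  have hz' := hz
  simp only [List.mem_cons, List.not_mem_nil, or_false, not_or] at hr hz
  obtain ⟨hr1, hr2, hr3⟩ := hr
  obtain ⟨hz1, hz2, hz3⟩ := hz
  obtain ⟨s1, h1, h⟩ := runs_mul.1 h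
  obtain ⟨s2, h2, h⟩ := runs_mul.1 h
  obtain ⟨s3, h3, h⟩ := runs_mul.1 h
  obtain ⟨s4, h4, h⟩ := runs_mul.1 h
  obtain ⟨s5, h5, h⟩ := runs_mul.1 h
  obtain ⟨s6, h6, h7⟩ := runs_mul.1 h
  rw [runs_push, hs .Cy (by simp)] at h1
  subst h1
  obtain ⟨l, hl, rfl⟩ := runs_pop.1 h3
  obtain ⟨e4, rfl⟩ := runs_empty.1 h4
  obtain ⟨e5, rfl⟩ := runs_empty.1 h5
  rw [Function.update_of_ne hr3] at e4
  rw [Function.update_of_ne hz3] at e5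
  obtain ⟨m1, m2, m3⟩ := move_sound (Ne.symm hr1) h6
  obtain ⟨n1, n2, n3⟩ := move_sound (Ne.symm hz2) h7
  -- The loop keeps exactly one symbol on `Cy`, so nothing lies below the carry that is popped.
  have hlen : l = [] := by
    have : ∀ u v : Mem, Runs (addStep r z)∗ u v → (∃ c, u .Cy = [.bit c]) →
        ∃ c, v .Cy = [.bit c] := by
      intro u v huv
      rw [runs_star] at huv
      induction huv using Relation.ReflTransGen.head_induction_on with
      | refl => exact id
      | head h _ ih =>
        rintro ⟨c, hc⟩
        obtain ⟨c', d, k1, -⟩ := addStep_sound hrz hr' hz' hc h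
        exact ih ⟨c', k1⟩
    obtain ⟨c, hc⟩ := this _ _ h2 ⟨false, by simp⟩
    rw [hc] at hl
    simpa [eq_comm] using (List.cons.inj hl).2
  subst hlen
  obtain ⟨⟨l, hl2, hv⟩, i2, i3⟩ := addLoop_sound hrz hr' hz' (c := false) (by simp) h2 e4 e5 hl
  simp only [Function.update_of_ne hr3, Function.update_of_ne hz3,
    Function.update_of_ne (show Reg.Z2 ≠ .Cy by decide),
    Function.update_of_ne (show Reg.R2 ≠ .Cy by decide), hs .Z2 (by simp), hs .R2 (by simp),
    List.append_nil] at hl2 i2 hv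
  rw [Function.update_of_ne (by decide), Function.update_of_ne hr3, i2, e4, List.append_nil,
    List.reverse_reverse] at m2
  have z6 : s6 .Z2 = l := by
    rw [m3 .Z2 (by simp [Ne.symm hr2]), Function.update_of_ne (by decide), hl2]
  have z6' : s6 z = [] := by
    rw [m3 z (by simp [hz1, hrz.symm]), Function.update_of_ne hz3, e5]
  rw [z6, z6', List.append_nil] at n2
  refine ⟨by rw [n2, hv]; simp; ring, fun k hk => ?_⟩
  simp only [List.mem_cons, List.not_mem_nil, or_false] at hk
  by_cases k1 : k = r
  · subst k1
    rw [n3 k (by simp [hrz, hr2]), m2]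
  by_cases k2 : k = .R2
  · subst k2
    rw [n3 _ (by simp [hk]), m1, hs _ (by simp)]
  by_cases k3 : k = .Z2
  · subst k3
    rw [n1, hs _ (by simp)]
  by_cases k4 : k = .Cy
  · subst k4
    rw [n3 _ (by simp [hk]), m3 _ (by simp [k1]), hs _ (by simp)]
    simp
  rw [n3 k (by simp [hk, k3]), m3 k (by simp [k1, k2]), Function.update_of_ne k4,
    i3 k (by simp [k1, k2, k3, k4, hk]), Function.update_of_ne k4]

theorem add_complete {r z : Reg} (hrz : r ≠ z) (hr : r ∉ addScratch) (hz : z ∉ addScratch)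
    {s : Mem} (hs : ∀ k ∈ addScratch, s k = []) {n : ℕ} (hbr : IsBits (s r)) (hbz : IsBits (s z))
    (hnr : (s r).length ≤ n) (hnz : (s z).length ≤ n) :
    ∃ t, RunsIn (add r z) (14 * (n + 1)) s t ∧ IsBits (t z) ∧ (t z).length ≤ n + 1 := by
  have hr' := hr
  have hz' := hz
  simp only [List.mem_cons, List.not_mem_nil, or_false, not_or] at hr hz
  obtain ⟨hr1, hr2, hr3⟩ := hr
  obtain ⟨hz1, hz2, hz3⟩ := hz
  have h1 := runsIn_push (s := s) Reg.Cy (Γ'.bit false)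
  rw [hs .Cy (by simp)] at h1
  obtain ⟨s2, h2, k2, k3, k4, k5, k6⟩ := addLoop_complete hrz hr' hz' n (c := false)
    (s := Function.update s .Cy [.bit false]) (by simp) (by simpa [hr3] using hbr)
    (by simpa [hz3] using hbz) (by simpa [hr3] using hnr) (by simpa [hz3] using hnz)
    (by simp [hs .Z2])
  obtain ⟨-, i2, -⟩ := addLoop_sound hrz hr' hz' (c := false) (by simp) h2.runs k2 k3 k4
  have h3 := runsIn_pop k4
  have h4 : RunsIn (empty r : Prog) 1 (Function.update s2 .Cy []) _ :=
    runsIn_empty (by simp [hr3, k2])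
  have h5 : RunsIn (empty z : Prog) 1 (Function.update s2 .Cy []) _ :=
    runsIn_empty (by simp [hz3, k3])
  obtain ⟨s6, h6⟩ := move_complete (Ne.symm hr1) (Function.update s2 .Cy [])
  obtain ⟨s7, h7⟩ := move_complete (Ne.symm hz2) s6
  obtain ⟨m1, m2, m3⟩ := move_sound (Ne.symm hr1) h6.runs
  obtain ⟨n1, n2, n3⟩ := move_sound (Ne.symm hz2) h7.runs
  have z6 : s6 .Z2 = s2 .Z2 := by
    rw [m3 .Z2 (by simp [Ne.symm hr2]), Function.update_of_ne (by decide)]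
  have z6' : s6 z = [] := by
    rw [m3 z (by simp [hz1, hrz.symm]), Function.update_of_ne hz3, k3]
  have k6' : (s2 .Z2).length ≤ n + 1 := by simpa [hs .Z2] using k6
  have i2' : (s2 .R2).length ≤ n := by
    rw [i2]; simpa [hr3, hs .R2] using hnr
  refine ⟨s7, (h1.mul (h2.mul (h3.mul (h4.mul (h5.mul (h6.mul h7)))))).mono ?_, ?_, ?_⟩
  · rw [z6, Function.update_of_ne (by decide)]
    omega
  · rw [n2, z6, z6']; simpa using k5
  · rw [n2, z6, z6']; simpa using k6'

/-! ### Multiplication -/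

/-- One step of the multiplication of `R` by a number that is read from `src` and copied to `dst`. -/
def mulStep (src dst : Reg) : Prog :=
  choice fun b => pop src (.bit b) * (push dst (.bit b) *
    ((bif b then add .R .Z else 1) * push .R (.bit false)))

theorem isRegular_mulStep (src dst : Reg) : (mulStep src dst).IsRegular :=
  isRegular_choice fun b => (isRegular_pop _ _).mul ((isRegular_push _ _).mul
    (Language.IsRegular.mul (by cases b; exacts [Language.isRegular_one, isRegular_add _ _])
      (isRegular_push _ _)))

/-- The stacks used by the multiplication. -/
abbrev mulScratch : List Reg := [.R, .Z, .R2, .Z2, .Cy]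

theorem mulStep_sound {src dst : Reg} (hsd : src ≠ dst) (hs : src ∉ mulScratch)
    (hd : dst ∉ mulScratch) {s t : Mem} (hc : ∀ k ∈ addScratch, s k = [])
    (h : Runs (mulStep src dst) s t) :
    ∃ b : Bool, s src = .bit b :: t src ∧ t dst = .bit b :: s dst ∧
      val (t .Z) = val (s .Z) + b.toNat * val (s .R) ∧ t .R = .bit false :: s .R ∧
      ∀ k ∉ [src, dst, .R, .Z], t k = s k := by
  simp only [List.mem_cons, List.not_mem_nil, or_false, not_or] at hs hd
  obtain ⟨hs1, hs2, hs3, hs4, hs5⟩ := hs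
  obtain ⟨hd1, hd2, hd3, hd4, hd5⟩ := hd
  obtain ⟨b, h⟩ := runs_choice.1 h
  obtain ⟨s1, h1, h⟩ := runs_mul.1 h
  obtain ⟨s2, h2, h⟩ := runs_mul.1 h
  obtain ⟨s3, h3, h4⟩ := runs_mul.1 h
  obtain ⟨l, hl, rfl⟩ := runs_pop.1 h1
  rw [runs_push] at h2 h4
  subst h2 h4
  have key : val (s3 .Z) = val (s .Z) + b.toNat * val (s .R) ∧ ∀ k ∉ [Reg.Z], s3 k =
      Function.update (Function.update s src l) dst (.bit b :: Function.update s src l dst) k := by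
    cases b
    · rw [cond_false, runs_one] at h3
      subst h3
      simp [Ne.symm hd2, Ne.symm hs2]
    · rw [cond_true] at h3
      have := add_sound (by decide) (by decide) (by decide) (fun k hk => ?_) h3
      · obtain ⟨e, f⟩ := this
        refine ⟨?_, f⟩
        rw [e]
        simp [Ne.symm hd2, Ne.symm hs2, Ne.symm hd1, Ne.symm hs1]
      · have := hc k hk
        simp only [List.mem_cons, List.not_mem_nil, or_false] at hk
        rw [Function.update_of_ne (by rintro rfl; tauto),
          Function.update_of_ne (by rintro rfl; tauto), this]
  obtain ⟨k1, k2⟩ := key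
  refine ⟨b, ?_, ?_, ?_, ?_, fun k hk => ?_⟩
  · rw [Function.update_of_ne hs1, k2 src (by simpa using hs2)]
    simp [hsd, hl]
  · rw [Function.update_of_ne hd1, k2 dst (by simpa using hd2)]
    simp [hsd.symm]
  · rw [Function.update_of_ne (by decide), k1]
  · rw [Function.update_self, k2 .R (by decide)]
    simp [Ne.symm hd1, Ne.symm hs1]
  · simp only [List.mem_cons, List.not_mem_nil, or_false, not_or] at hk
    rw [Function.update_of_ne hk.2.2.1, k2 k (by simpa using hk.2.2.2)]
    simp [hk.1, hk.2.1]

/-- Binary multiplication from the least significant bit: `R` is doubled at every bit and added to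
`Z` at the bits that are set. The comma after the multiplier fixes the number of rounds, because a
round can only pop a bit. -/
theorem mulLoop_sound {src dst : Reg} (hsd : src ≠ dst) (hs : src ∉ mulScratch)
    (hd : dst ∉ mulScratch) (l : List Bool) {rest rest' : List Γ'} {s t : Mem}
    (hc : ∀ k ∈ addScratch, s k = []) (hsrc : s src = l.map .bit ++ .comma :: rest)
    (h : Runs (mulStep src dst)∗ s t) (ht : t src = .comma :: rest') :
    rest' = rest ∧ t dst = (l.map .bit).reverse ++ s dst ∧
      val (t .Z) = val (s .Z) + val (l.map .bit) * val (s .R) ∧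
      ∀ k ∉ [src, dst, .R, .Z], t k = s k := by
  induction l generalizing s with
  | nil =>
    rcases runs_star_cases h with rfl | ⟨u, h1, h2⟩
    · rw [ht] at hsrc
      simp at hsrc
      simp [hsrc]
    · obtain ⟨b, e, -⟩ := mulStep_sound hsd hs hd hc h1
      rw [hsrc] at e
      simp at e
  | cons b l ih =>
    rcases runs_star_cases h with rfl | ⟨u, h1, h2⟩
    · rw [ht] at hsrc
      simp at hsrc
    · obtain ⟨b', e1, e2, e3, e4, e5⟩ := mulStep_sound hsd hs hd hc h1
      rw [hsrc] at e1
      simp only [List.map_cons, List.cons_append, List.cons.injEq, Γ'.bit.injEq] at e1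
      obtain ⟨rfl, e1⟩ := e1
      have hu : ∀ k ∈ addScratch, u k = [] := by
        intro k hk
        rw [e5 k _, hc k hk]
        simp only [List.mem_cons, List.not_mem_nil, or_false, not_or] at hk hs hd ⊢
        refine ⟨?_, ?_, ?_, ?_⟩ <;> rintro rfl <;> simp_all
      obtain ⟨i1, i2, i3, i4⟩ := ih hu e1.symm h2
      refine ⟨i1, ?_, ?_, fun k hk => ?_⟩
      · rw [i2, e2]; simp
      · rw [i3, e3, e4]; simp; ring
      · rw [i4 k hk, e5 k hk]

/-- The bound of the length of `Z` by that of `R` plus one is an invariant: an addition makes `Z` at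
most two symbols longer than the old `R`, and then `R` grows by one symbol. -/
theorem mulLoop_complete {src dst : Reg} (hsd : src ≠ dst) (hs : src ∉ mulScratch)
    (hd : dst ∉ mulScratch) (l : List Bool) {rest : List Γ'} {s : Mem} {n : ℕ}
    (hc : ∀ k ∈ addScratch, s k = []) (hsrc : s src = l.map .bit ++ .comma :: rest)
    (hR : IsBits (s .R)) (hZ : IsBits (s .Z)) (hRZ : (s .Z).length ≤ (s .R).length + 1)
    (hn : (s .R).length + l.length ≤ n) :
    ∃ t, RunsIn (mulStep src dst)∗ (l.length * (14 * (n + 2) + 3)) s t ∧ t src = .comma :: rest ∧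
      IsBits (t .R) ∧ IsBits (t .Z) ∧ (t .R).length = (s .R).length + l.length ∧
      (t .Z).length ≤ (t .R).length + 1 := by
  induction l generalizing s with
  | nil => exact ⟨s, by simpa using RunsIn.star_nil, by simpa using hsrc, hR, hZ, by simp, hRZ⟩
  | cons b l ih =>
    have hs' := hs
    have hd' := hd
    simp only [List.mem_cons, List.not_mem_nil, or_false, not_or] at hs hd
    obtain ⟨hs1, hs2, hs3, hs4, hs5⟩ := hs
    obtain ⟨hd1, hd2, hd3, hd4, hd5⟩ := hd
    rw [List.length_cons] at hn
    have h1 : RunsIn (pop src (.bit b)) 1 s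
        (Function.update s src (l.map .bit ++ .comma :: rest)) := runsIn_pop hsrc
    have h2 := runsIn_push (s := Function.update s src (l.map .bit ++ .comma :: rest)) dst (.bit b)
    set s2 := Function.update (Function.update s src (l.map .bit ++ .comma :: rest)) dst
      (.bit b :: Function.update s src (l.map .bit ++ .comma :: rest) dst) with hs2
    have e2R : s2 .R = s .R := by simp [hs2, Ne.symm hd1, Ne.symm hs1]
    have e2Z : s2 .Z = s .Z := by
      rw [hs2, Function.update_of_ne (Ne.symm hd2), Function.update_of_ne (Ne.symm ‹¬src = .Z›)]
    have key : ∃ s3, RunsIn (bif b then add .R .Z else 1) (14 * (n + 2)) s2 s3 ∧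
        IsBits (s3 .Z) ∧ (s3 .Z).length ≤ (s .R).length + 2 := by
      cases b
      · exact ⟨s2, runsIn_one.mono (by omega), by rwa [e2Z], by rw [e2Z]; omega⟩
      · obtain ⟨t, k1, k2, k3⟩ := add_complete (r := .R) (z := .Z) (s := s2)
          (n := (s .R).length + 1) (by decide) (by decide) (by decide) (fun k hk => by
            have := hc k hk
            simp only [List.mem_cons, List.not_mem_nil, or_false] at hk
            rw [hs2, Function.update_of_ne (by rintro rfl; tauto),
              Function.update_of_ne (by rintro rfl; tauto), this]) (by rwa [e2R]) (by rwa [e2Z])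
          (by rw [e2R]; omega) (by rw [e2Z]; omega)
        exact ⟨t, k1.mono (by omega), k2, k3⟩
    obtain ⟨s3, h3, k1, k2⟩ := key
    have hrun : RunsIn (mulStep src dst) (14 * (n + 2) + 3) s
        (Function.update s3 .R (.bit false :: s3 .R)) :=
      (RunsIn.choice (b := b) (h1.mul (h2.mul (h3.mul (runsIn_push _ _))))).mono (by omega)
    obtain ⟨b', e1, e2, e3, e4, e5⟩ := mulStep_sound hsd hs' hd' hc hrun.runs
    rw [hsrc] at e1
    simp only [List.map_cons, List.cons_append, List.cons.injEq, Γ'.bit.injEq] at e1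
    obtain ⟨t, i1, i2, i3, i4, i5, i6⟩ := ih (s := Function.update s3 .R (.bit false :: s3 .R))
      (fun k hk => by
        rw [e5 k _, hc k hk]
        simp only [List.mem_cons, List.not_mem_nil, or_false] at hk ⊢
        rintro (rfl | rfl | rfl | rfl) <;> tauto) e1.2.symm (by rw [e4]; simpa using hR)
      (by rw [Function.update_of_ne (by decide)]; exact k1)
      (by rw [e4, Function.update_of_ne (by decide)]; simpa using k2)
      (by rw [e4]; simp only [List.length_cons]; omega)
    refine ⟨t, (RunsIn.star_cons hrun i1).mono ?_, i2, i3, i4, ?_, i6⟩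
    · rw [List.length_cons]; ring_nf; omega
    · rw [i5, e4]; simp only [List.length_cons]; omega

/-- Multiply the number on `R` by a number that is read from `src` and copied to `dst`. -/
def mul (src dst : Reg) : Prog :=
  (mulStep src dst)∗ * (pop src .comma * (push dst .comma * (clear .R * (move .Z .R2 *
    move .R2 .R))))

theorem isRegular_mul (src dst : Reg) : (mul src dst).IsRegular :=
  (isRegular_mulStep _ _).kstar.mul ((isRegular_pop _ _).mul ((isRegular_push _ _).mul
    ((isRegular_clear _).mul ((isRegular_move _ _).mul (isRegular_move _ _)))))

theorem mul_sound {src dst : Reg} (hsd : src ≠ dst) (hs : src ∉ mulScratch)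
    (hd : dst ∉ mulScratch) (l : List Bool) {rest : List Γ'} {s t : Mem}
    (hc : ∀ k ∈ addScratch, s k = []) (hZ : s .Z = [])
    (hsrc : s src = l.map .bit ++ .comma :: rest) (h : Runs (mul src dst) s t) :
    t src = rest ∧ t dst = .comma :: ((l.map .bit).reverse ++ s dst) ∧
      val (t .R) = val (l.map .bit) * val (s .R) ∧ ∀ k ∉ [src, dst, .R], t k = s k := by
  obtain ⟨s1, h1, h⟩ := runs_mul.1 h
  obtain ⟨s2, h2, h⟩ := runs_mul.1 h
  obtain ⟨s3, h3, h⟩ := runs_mul.1 h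
  obtain ⟨s4, h4, h⟩ := runs_mul.1 h
  obtain ⟨s5, h5, h6⟩ := runs_mul.1 h
  obtain ⟨l', hl', rfl⟩ := runs_pop.1 h2
  rw [runs_push] at h3
  obtain ⟨rfl, i2, i3, i4⟩ := mulLoop_sound hsd hs hd l hc hsrc h1 hl'
  obtain ⟨c1, c2⟩ := clear_sound h4
  obtain ⟨m1, m2, m3⟩ := move_sound (by decide) h5
  obtain ⟨n1, n2, n3⟩ := move_sound (by decide) h6
  simp only [List.mem_cons, List.not_mem_nil, or_false, not_or] at hs hd
  obtain ⟨hs1, hs2, hs3, hs4, hs5⟩ := hs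
  obtain ⟨hd1, hd2, hd3, hd4, hd5⟩ := hd
  have a3 : ∀ k, k ≠ dst → s3 k = Function.update s1 src l' k := fun k hk => by
    rw [h3, Function.update_of_ne hk]
  have z4 : s4 .Z = s1 .Z := by
    rw [c2 _ (by decide), a3 _ (Ne.symm hd2), Function.update_of_ne (Ne.symm hs2)]
  have r4 : s4 .R2 = [] := by
    rw [c2 _ (by decide), a3 _ (Ne.symm hd3), Function.update_of_ne (Ne.symm hs3),
      i4 _ (by simp [Ne.symm hs3, Ne.symm hd3]), hc _ (by simp)]
  have r5 : s5 .R = [] := by rw [m3 _ (by decide), c1]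
  rw [m2, z4, r4, r5] at n2
  simp only [List.append_nil, List.reverse_reverse] at n2
  refine ⟨?_, ?_, ?_, fun k hk => ?_⟩
  · rw [n3 _ (by simp [hs1, hs3]), m3 _ (by simp [hs2, hs3]), c2 _ (by simp [hs1]), a3 _ hsd]
    simp
  · rw [n3 _ (by simp [hd1, hd3]), m3 _ (by simp [hd2, hd3]), c2 _ (by simp [hd1]), h3]
    simp [hsd.symm, i2]
  · rw [n2, i3, hZ]; simp
  · simp only [List.mem_cons, List.not_mem_nil, or_false, not_or] at hk
    obtain ⟨k1, k2, k3⟩ := hk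
    by_cases q1 : k = .R2
    · subst q1
      rw [n1, hc _ (by simp)]
    by_cases q2 : k = .Z
    · subst q2
      rw [n3 _ (by decide), m1, hZ]
    rw [n3 _ (by simp [k3, q1]), m3 _ (by simp [q1, q2]), c2 _ (by simp [k3]), a3 _ k2,
      Function.update_of_ne k1, i4 _ (by simp [k1, k2, k3, q2])]

theorem mul_complete {src dst : Reg} (hsd : src ≠ dst) (hs : src ∉ mulScratch)
    (hd : dst ∉ mulScratch) (l : List Bool) {rest : List Γ'} {s : Mem} {n : ℕ}
    (hc : ∀ k ∈ addScratch, s k = []) (hZ : s .Z = [])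
    (hsrc : s src = l.map .bit ++ .comma :: rest) (hR : IsBits (s .R))
    (hn : (s .R).length + l.length ≤ n) :
    ∃ t, RunsIn (mul src dst) (40 * (n + 1) ^ 2) s t ∧ IsBits (t .R) ∧ (t .R).length ≤ n + 1 := by
  obtain ⟨s1, h1, k1, k2, k3, k4, k5⟩ := mulLoop_complete hsd hs hd l hc hsrc hR (by simp [hZ])
    (by simp [hZ]) hn
  obtain ⟨-, -, -, i4⟩ := mulLoop_sound hsd hs hd l hc hsrc h1.runs k1
  have h2 := runsIn_pop k1
  have h3 := runsIn_push (s := Function.update s1 src rest) dst Γ'.comma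
  set s3 := Function.update (Function.update s1 src rest) dst
    (Γ'.comma :: Function.update s1 src rest dst) with e3
  obtain ⟨s4, h4⟩ := clear_complete .R s3
  obtain ⟨s5, h5⟩ := move_complete (a := .Z) (b := .R2) (by decide) s4
  obtain ⟨s6, h6⟩ := move_complete (a := .R2) (b := .R) (by decide) s5
  obtain ⟨c1, c2⟩ := clear_sound h4.runs
  obtain ⟨m1, m2, m3⟩ := move_sound (by decide) h5.runs
  obtain ⟨n1, n2, n3⟩ := move_sound (by decide) h6.runs
  simp only [List.mem_cons, List.not_mem_nil, or_false, not_or] at hs hd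
  obtain ⟨hs1, hs2, hs3, hs4, hs5⟩ := hs
  obtain ⟨hd1, hd2, hd3, hd4, hd5⟩ := hd
  have a3 : ∀ k, k ≠ dst → k ≠ src → s3 k = s1 k := fun k hk hk' => by
    rw [e3, Function.update_of_ne hk, Function.update_of_ne hk']
  have z4 : s4 .Z = s1 .Z := by
    rw [c2 _ (by decide), a3 _ (Ne.symm hd2) (Ne.symm hs2)]
  have r3 : s3 .R = s1 .R := a3 _ (Ne.symm hd1) (Ne.symm hs1)
  have r4 : s4 .R2 = [] := by
    rw [c2 _ (by decide), a3 _ (Ne.symm hd3) (Ne.symm hs3),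
      i4 _ (by simp [Ne.symm hs3, Ne.symm hd3]), hc _ (by simp)]
  have r5 : s5 .R = [] := by rw [m3 _ (by decide), c1]
  rw [z4, r4, List.append_nil] at m2
  rw [m2, r5] at n2
  simp only [List.append_nil, List.reverse_reverse] at n2
  refine ⟨s6, (h1.mul (h2.mul (h3.mul (h4.mul (h5.mul h6))))).mono ?_, ?_, ?_⟩
  · rw [m2, r3, z4, List.length_reverse]
    have : l.length * (14 * (n + 2) + 3) ≤ n * (14 * (n + 2) + 3) :=
      Nat.mul_le_mul_right _ (by omega)
    nlinarith
  · rwa [n2]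
  · rw [n2]; omega

/-- Copy the number on `W` to `R`. -/
def copyW : Prog :=
  (choice fun b => pop .W (.bit b) * (push .Z2 (.bit b) * push .R2 (.bit b)))∗ *
    (empty .W * (move .Z2 .W * move .R2 .R))

theorem isRegular_copyW : copyW.IsRegular :=
  (isRegular_choice fun _ => (isRegular_pop _ _).mul ((isRegular_push _ _).mul
    (isRegular_push _ _))).kstar.mul ((isRegular_empty _).mul
      ((isRegular_move _ _).mul (isRegular_move _ _)))

theorem copyW_sound {s t : Mem} (hR : s .R = []) (hR2 : s .R2 = []) (hZ2 : s .Z2 = [])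
    (h : Runs copyW s t) : t .R = s .W ∧ ∀ k ∉ [Reg.R], t k = s k := by
  obtain ⟨s1, h1, h⟩ := runs_mul.1 h
  obtain ⟨s2, h2, h⟩ := runs_mul.1 h
  obtain ⟨s3, h3, h4⟩ := runs_mul.1 h
  obtain ⟨e, rfl⟩ := runs_empty.1 h2
  have key : s2 .Z2 = (s .W).reverse ++ s .Z2 ∧ s2 .R2 = (s .W).reverse ++ s .R2 ∧
      ∀ k ∉ [Reg.W, .Z2, .R2], s2 k = s k := by
    rw [runs_star] at h1
    clear * - h1 e
    induction h1 using Relation.ReflTransGen.head_induction_on with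
    | refl => simp [e]
    | head h _ ih =>
      obtain ⟨b, h⟩ := runs_choice.1 h
      obtain ⟨u, h1, h⟩ := runs_mul.1 h
      obtain ⟨v, h2, h3⟩ := runs_mul.1 h
      obtain ⟨l, hl, rfl⟩ := runs_pop.1 h1
      rw [runs_push] at h2 h3
      subst h2 h3
      obtain ⟨i1, i2, i3⟩ := ih
      refine ⟨by rw [i1]; simp [hl], by rw [i2]; simp [hl], fun k hk => ?_⟩
      rw [i3 k hk]
      simp only [List.mem_cons, List.not_mem_nil, or_false, not_or] at hk
      simp [hk.1, hk.2.1, hk.2.2]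
  obtain ⟨i1, i2, i3⟩ := key
  obtain ⟨m1, m2, m3⟩ := move_sound (by decide) h3
  obtain ⟨n1, n2, n3⟩ := move_sound (by decide) h4
  rw [m3 .R2 (by decide), m3 .R (by decide), i3 .R (by decide), hR, i2, hR2] at n2
  rw [i1, hZ2, e] at m2
  simp only [List.append_nil, List.reverse_reverse] at m2 n2
  refine ⟨n2, fun k hk => ?_⟩
  by_cases q1 : k = .R2
  · subst q1; rw [n1, hR2]
  by_cases q2 : k = .Z2
  · subst q2; rw [n3 _ (by decide), m1, hZ2]
  by_cases q3 : k = .W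
  · subst q3; rw [n3 _ (by decide), m2]
  simp only [List.mem_cons, List.not_mem_nil, or_false] at hk
  rw [n3 k (by simp [hk, q1]), m3 k (by simp [q2, q3]), i3 k (by simp [q1, q2, q3])]

theorem copyW_complete {s : Mem} {n : ℕ} (hW : IsBits (s .W)) (hn : (s .W).length ≤ n)
    (hR2 : s .R2 = []) (hZ2 : s .Z2 = []) : ∃ t, RunsIn copyW (7 * n + 3) s t := by
  have H : ∀ n (s : Mem), (s .W).length = n → IsBits (s .W) → ∃ t,
      RunsIn (choice fun b => pop .W (.bit b) * (push .Z2 (.bit b) * push .R2 (.bit b)))∗ (3 * n)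
        s t ∧ t .W = [] ∧ (t .Z2).length = (s .Z2).length + n ∧
        (t .R2).length = (s .R2).length + n := by
    intro n
    induction n with
    | zero => exact fun s hs _ => ⟨s, RunsIn.star_nil, List.length_eq_zero_iff.1 hs, rfl, rfl⟩
    | succ n ih =>
      intro s hs hb
      obtain ⟨x, l, hl⟩ := List.exists_cons_of_length_eq_add_one hs
      rw [hl, isBits_cons] at hb
      obtain ⟨⟨b, rfl⟩, hb⟩ := hb
      have hrun := RunsIn.choice (f := fun b : Bool => (pop .W (.bit b) * (push .Z2 (.bit b) *
        push .R2 (.bit b)) : Prog)) (b := b) ((runsIn_pop hl).mul ((runsIn_push .Z2 (.bit b)).mul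
          (runsIn_push .R2 (.bit b))))
      obtain ⟨t, ht, h1, h2, h3⟩ := ih (Function.update (Function.update (Function.update s .W l) .Z2
        (.bit b :: s .Z2)) .R2 (.bit b :: s .R2)) (by simpa [hl] using hs) (by simpa using hb)
      simp only [Function.update_of_ne (show Reg.Z2 ≠ .W by decide),
        Function.update_of_ne (show Reg.R2 ≠ .W by decide),
        Function.update_of_ne (show Reg.R2 ≠ .Z2 by decide)] at hrun
      refine ⟨t, (RunsIn.star_cons hrun ht).mono (by omega), h1, ?_, ?_⟩
      · rw [h2]; simp; omega
      · rw [h3]; simp; omega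
  obtain ⟨s1, h1, k1, k2, k3⟩ := H _ s rfl hW
  obtain ⟨s2, h2⟩ := move_complete (a := .Z2) (b := .W) (by decide) s1
  obtain ⟨s3, h3⟩ := move_complete (a := .R2) (b := .R) (by decide) s2
  obtain ⟨m1, m2, m3⟩ := move_sound (by decide) h2.runs
  refine ⟨s3, (h1.mul ((runsIn_empty k1).mul (h2.mul h3))).mono ?_⟩
  rw [m3 _ (by decide), k2, k3, hR2, hZ2]
  simp
  omega

/-! ### Guessing numbers -/

/-- Push the same guessed bits on `a` and `b`. -/
def guess (a b : Reg) : Prog := (choice fun x => push a (.bit x) * push b (.bit x))∗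

theorem isRegular_guess (a b : Reg) : (guess a b).IsRegular :=
  (isRegular_choice fun _ => (isRegular_push _ _).mul (isRegular_push _ _)).kstar

/-- Two copies are made because a check consumes its operands. When a single copy is wanted, the
other one goes to `Tr`. -/
theorem guess_sound {a b : Reg} (hab : a ≠ b) {s t : Mem} (h : Runs (guess a b) s t) :
    ∃ l : List Bool, t a = l.map .bit ++ s a ∧ t b = l.map .bit ++ s b ∧
      ∀ k ∉ [a, b], t k = s k := by
  rw [guess, runs_star] at h
  induction h using Relation.ReflTransGen.head_induction_on with
  | refl => exact ⟨[], by simp⟩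
  | head h _ ih =>
    obtain ⟨x, h⟩ := runs_choice.1 h
    obtain ⟨u, h1, h2⟩ := runs_mul.1 h
    rw [runs_push] at h1 h2
    subst h1 h2
    obtain ⟨l, i1, i2, i3⟩ := ih
    refine ⟨l ++ [x], by rw [i1]; simp [hab], by rw [i2]; simp [hab.symm], fun k hk => ?_⟩
    rw [i3 k hk]
    simp only [List.mem_cons, List.not_mem_nil, or_false, not_or] at hk
    simp [hk.1, hk.2]

theorem guess_complete {a b : Reg} (hab : a ≠ b) (l : List Bool) (s : Mem) :
    ∃ t, RunsIn (guess a b) (2 * l.length) s t ∧ t a = l.map .bit ++ s a ∧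
      t b = l.map .bit ++ s b ∧ ∀ k ∉ [a, b], t k = s k := by
  induction l using List.reverseRecOn generalizing s with
  | nil => exact ⟨s, RunsIn.star_nil, by simp⟩
  | append_singleton l x ih =>
    obtain ⟨t, h, i1, i2, i3⟩ := ih (Function.update (Function.update s a (.bit x :: s a)) b
      (.bit x :: Function.update s a (.bit x :: s a) b))
    refine ⟨t, (RunsIn.star_cons (RunsIn.choice (b := x) ((runsIn_push _ _).mul
      (runsIn_push _ _))) h).mono ?_, by rw [i1]; simp [hab], by rw [i2]; simp [hab.symm],
      fun k hk => ?_⟩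
    · simp; omega
    rw [i3 k hk]
    simp only [List.mem_cons, List.not_mem_nil, or_false, not_or] at hk
    simp [hk.1, hk.2]

/-! ### Fractions, and the product of one coefficient with one variable -/

/-- A sign, the bits of a numerator and the bits of a denominator. -/
abbrev Quo := Bool × List Bool × List Bool

/-- Encoding of a fraction. -/
def enc (u : Quo) : List Γ' :=
  .bit u.1 :: (u.2.1.map .bit ++ .comma :: (u.2.2.map .bit ++ [.comma]))

/-- The numerator of a fraction. -/
def numer (u : Quo) : ℕ := val (u.2.1.map .bit)

/-- The denominator of a fraction. -/
def denom (u : Quo) : ℕ := val (u.2.2.map .bit)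

/-- The rational number that is represented by a fraction. -/
def value (u : Quo) : ℚ := (bif u.1 then -1 else 1) * (numer u / denom u)

/-- The stacks that are empty before and after the treatment of an entry. -/
abbrev scratch : List Reg := [.R, .Z, .R2, .Z2, .Cy, .F, .S, .C]

/-- Read the signs of the current coefficient and of the current variable. -/
def readSigns : Prog :=
  choice fun a => choice fun b =>
    pop .J (.bit a) * (pop .X (.bit b) * (push .G (.bit b) * push .F (.bit (xor a b))))

theorem isRegular_readSigns : readSigns.IsRegular :=
  isRegular_choice fun _ => isRegular_choice fun _ => (isRegular_pop _ _).mul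
    ((isRegular_pop _ _).mul ((isRegular_push _ _).mul (isRegular_push _ _)))

theorem readSigns_sound {s t : Mem} (h : Runs readSigns s t) :
    ∃ a b : Bool, s .J = .bit a :: t .J ∧ s .X = .bit b :: t .X ∧ t .G = .bit b :: s .G ∧
      t .F = .bit (xor a b) :: s .F ∧ ∀ k ∉ [Reg.J, .X, .G, .F], t k = s k := by
  simp only [readSigns, runs_choice, runs_mul, runs_pop, runs_push] at h
  obtain ⟨a, b, s1, ⟨l, hl, rfl⟩, s2, ⟨m, hm, rfl⟩, s3, rfl, rfl⟩ := h
  rw [Function.update_of_ne (by decide)] at hm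
  refine ⟨a, b, by simpa using hl, by simpa using hm, by simp, by simp, fun k hk => ?_⟩
  simp only [List.mem_cons, List.not_mem_nil, or_false, not_or] at hk
  simp [hk]

theorem readSigns_complete {s : Mem} {a b : Bool} {l m : List Γ'} (hJ : s .J = .bit a :: l)
    (hX : s .X = .bit b :: m) : ∃ t, RunsIn readSigns 4 s t := by
  refine ⟨_, RunsIn.choice (b := a) (RunsIn.choice (b := b) ((runsIn_pop hJ).mul
    (RunsIn.mul (runsIn_pop (l := m) ?_) ((runsIn_push _ _).mul (runsIn_push _ _)))))⟩
  rw [Function.update_of_ne (by decide), hX]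

/-- Add `C` to `P` or to `M`, depending on the sign. -/
def accum : Prog := choice fun f => pop .F (.bit f) * bif f then add .C .M else add .C .P

theorem isRegular_accum : accum.IsRegular :=
  isRegular_choice fun b => (isRegular_pop _ _).mul (by cases b <;> exact isRegular_add _ _)

theorem accum_sound {s t : Mem} {f : Bool} (hF : s .F = [.bit f]) (hc : ∀ k ∈ addScratch, s k = [])
    (h : Runs accum s t) : t .F = [] ∧
      val (t .M) = val (s .M) + (bif f then val (s .C) else 0) ∧
      val (t .P) = val (s .P) + (bif f then 0 else val (s .C)) ∧
      ∀ k ∉ [Reg.F, .P, .M], t k = s k := by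
  obtain ⟨f', h⟩ := runs_choice.1 h
  obtain ⟨s1, h1, h2⟩ := runs_mul.1 h
  obtain ⟨l, hl, rfl⟩ := runs_pop.1 h1
  rw [hF] at hl
  obtain ⟨rfl, rfl⟩ : f = f' ∧ l = [] := by simpa [eq_comm] using hl
  have hc' : ∀ k ∈ addScratch, Function.update s .F [] k = [] := by
    intro k hk
    by_cases hkF : k = .F
    · subst hkF; simp
    · rw [Function.update_of_ne hkF, hc k hk]
  cases f
  · rw [cond_false] at h2
    obtain ⟨e, g⟩ := add_sound (by decide) (by decide) (by decide) hc' h2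
    refine ⟨by rw [g _ (by decide)]; simp, by rw [g _ (by decide)]; simp, by rw [e]; simp,
      fun k hk => ?_⟩
    simp only [List.mem_cons, List.not_mem_nil, or_false, not_or] at hk
    rw [g _ (by simp [hk]), Function.update_of_ne hk.1]
  · rw [cond_true] at h2
    obtain ⟨e, g⟩ := add_sound (by decide) (by decide) (by decide) hc' h2
    refine ⟨by rw [g _ (by decide)]; simp, by rw [e]; simp, by rw [g _ (by decide)]; simp,
      fun k hk => ?_⟩
    simp only [List.mem_cons, List.not_mem_nil, or_false, not_or] at hk
    rw [g _ (by simp [hk]), Function.update_of_ne hk.1]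

theorem accum_complete {s : Mem} {f : Bool} {n : ℕ} (hF : s .F = [.bit f])
    (hc : ∀ k ∈ addScratch, s k = []) (hC : IsBits (s .C)) (hP : IsBits (s .P))
    (hM : IsBits (s .M)) (nC : (s .C).length ≤ n) (nP : (s .P).length ≤ n)
    (nM : (s .M).length ≤ n) :
    ∃ t, RunsIn accum (1 + 14 * (n + 1)) s t ∧ IsBits (t .P) ∧ IsBits (t .M) ∧
      (t .P).length ≤ n + 1 ∧ (t .M).length ≤ n + 1 := by
  have hc' : ∀ k ∈ addScratch, Function.update s .F [] k = [] := by
    intro k hk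
    by_cases hkF : k = .F
    · subst hkF; simp
    · rw [Function.update_of_ne hkF, hc k hk]
  cases f
  · obtain ⟨t, h, k1, k2⟩ := add_complete (r := .C) (z := .P) (s := Function.update s .F [])
      (by decide) (by decide) (by decide) hc' (n := n) (by simpa using hC) (by simpa using hP)
      (by simpa using nC) (by simpa using nP)
    obtain ⟨-, g⟩ := add_sound (by decide) (by decide) (by decide) hc' h.runs
    have e : t .M = s .M := by rw [g _ (by decide)]; simp
    exact ⟨t, RunsIn.choice (b := false) ((runsIn_pop hF).mul h), k1, by rwa [e], k2,
      by rw [e]; omega⟩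
  · obtain ⟨t, h, k1, k2⟩ := add_complete (r := .C) (z := .M) (s := Function.update s .F [])
      (by decide) (by decide) (by decide) hc' (n := n) (by simpa using hC) (by simpa using hM)
      (by simpa using nC) (by simpa using nM)
    obtain ⟨-, g⟩ := add_sound (by decide) (by decide) (by decide) hc' h.runs
    have e : t .P = s .P := by rw [g _ (by decide)]; simp
    exact ⟨t, RunsIn.choice (b := true) ((runsIn_pop hF).mul h), by rwa [e], k1, by rw [e]; omega,
      k2⟩

/-- Multiply `R` by the next two numbers, one from `J` and one from `X`. -/
def mulBoth : Prog := mul .J .Tr * mul .X .G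

theorem isRegular_mulBoth : mulBoth.IsRegular := (isRegular_mul _ _).mul (isRegular_mul _ _)

theorem mulBoth_sound {s t : Mem} (l m : List Bool) {restJ restX : List Γ'}
    (hc : ∀ k ∈ addScratch, s k = []) (hZ : s .Z = [])
    (hJ : s .J = l.map .bit ++ .comma :: restJ) (hX : s .X = m.map .bit ++ .comma :: restX)
    (h : Runs mulBoth s t) : t .J = restJ ∧ t .X = restX ∧
      t .G = .comma :: ((m.map .bit).reverse ++ s .G) ∧
      val (t .R) = val (l.map .bit) * val (m.map .bit) * val (s .R) ∧
      ∀ k ∉ [Reg.J, .X, .G, .Tr, .R], t k = s k := by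
  obtain ⟨s1, h1, h2⟩ := runs_mul.1 h
  obtain ⟨e1, e2, e3, e4⟩ := mul_sound (by decide) (by decide) (by decide) l hc hZ hJ h1
  obtain ⟨f1, f2, f3, f4⟩ := mul_sound (by decide) (by decide) (by decide) m
    (fun k hk => by
      rw [e4 k, hc k hk]
      simp only [List.mem_cons, List.not_mem_nil, or_false] at hk
      rcases hk with rfl | rfl | rfl <;> decide) (by rw [e4 _ (by decide), hZ])
      (by rw [e4 _ (by decide), hX]) h2
  refine ⟨by rw [f4 _ (by decide), e1], f1, by rw [f2, e4 _ (by decide)], by rw [f3, e3]; ring,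
    fun k hk => ?_⟩
  simp only [List.mem_cons, List.not_mem_nil, or_false, not_or] at hk
  rw [f4 _ (by simp [hk]), e4 _ (by simp [hk])]

theorem mulBoth_complete {s : Mem} (l m : List Bool) {restJ restX : List Γ'} {n : ℕ}
    (hc : ∀ k ∈ addScratch, s k = []) (hZ : s .Z = [])
    (hJ : s .J = l.map .bit ++ .comma :: restJ) (hX : s .X = m.map .bit ++ .comma :: restX)
    (hR : IsBits (s .R)) (hn : (s .R).length ≤ n) (hl : l.length ≤ n) (hm : m.length ≤ n) :
    ∃ t, RunsIn mulBoth (600 * (n + 1) ^ 2) s t ∧ IsBits (t .R) ∧ (t .R).length ≤ 3 * n + 2 := by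
  obtain ⟨s1, h1, k1, k2⟩ := mul_complete (src := .J) (dst := .Tr) (n := 2 * n) (by decide)
    (by decide) (by decide) l hc hZ hJ hR (by omega)
  obtain ⟨e1, e2, e3, e4⟩ := mul_sound (by decide) (by decide) (by decide) l hc hZ hJ h1.runs
  obtain ⟨s2, h2, k3, k4⟩ := mul_complete (src := .X) (dst := .G) (n := 3 * n + 1) (s := s1)
    (rest := restX) (by decide) (by decide) (by decide) m
    (fun k hk => by
      rw [e4 k, hc k hk]
      simp only [List.mem_cons, List.not_mem_nil, or_false] at hk
      rcases hk with rfl | rfl | rfl <;> decide) (by rw [e4 _ (by decide), hZ])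
      (by rw [e4 _ (by decide), hX]) k1 (by omega)
  exact ⟨s2, (h1.mul h2).mono (by nlinarith), k3, by omega⟩

/-- Treat one coefficient and one variable: guess a numerator of their product over the common
denominator `W`, verify it, and add it to `P` or `M`. -/
def entry : Prog :=
  readSigns * (copyW * (mulBoth * (move .R .Z2 * (move .Z2 .S * (guess .R .C * (mulBoth *
    (eqCheck .R .S * (accum * clear .C))))))))

theorem isRegular_entry : entry.IsRegular :=
  isRegular_readSigns.mul (isRegular_copyW.mul (isRegular_mulBoth.mul ((isRegular_move _ _).mul
    ((isRegular_move _ _).mul ((isRegular_guess _ _).mul (isRegular_mulBoth.mul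
      ((isRegular_eqCheck _ _).mul (isRegular_accum.mul (isRegular_clear _)))))))))

/-- No division is carried out: a numerator `c` of the absolute value of the product over the
denominator `W` is guessed and verified by cross-multiplication. One copy of `c` is spent on this
test, the other is added to `P` or `M` according to the sign. -/
theorem entry_sound {s t : Mem} {u v : Quo} {restJ restX : List Γ'}
    (hc : ∀ k ∈ scratch, s k = []) (hJ : s .J = enc u ++ restJ) (hX : s .X = enc v ++ restX)
    (h : Runs entry s t) :
    t .J = restJ ∧ t .X = restX ∧ t .G = (enc v).reverse ++ s .G ∧
      (∃ c : ℕ, c * (denom u * denom v) = numer u * numer v * val (s .W) ∧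
        val (t .M) = val (s .M) + (bif xor u.1 v.1 then c else 0) ∧
        val (t .P) = val (s .P) + (bif xor u.1 v.1 then 0 else c)) ∧
      ∀ k ∉ [Reg.J, .X, .G, .Tr, .P, .M], t k = s k := by
  obtain ⟨s1, h1, h⟩ := runs_mul.1 h
  obtain ⟨s2, h2, h⟩ := runs_mul.1 h
  obtain ⟨s3, h3, h⟩ := runs_mul.1 h
  obtain ⟨s4, h4, h⟩ := runs_mul.1 h
  obtain ⟨s5, h5, h⟩ := runs_mul.1 h
  obtain ⟨s6, h6, h⟩ := runs_mul.1 h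
  obtain ⟨s7, h7, h⟩ := runs_mul.1 h
  obtain ⟨s8, h8, h⟩ := runs_mul.1 h
  obtain ⟨s9, h9, h10⟩ := runs_mul.1 h
  obtain ⟨a, b, j1, x1, g1, f1, o1⟩ := readSigns_sound h1
  rw [hJ] at j1
  rw [hX] at x1
  simp only [enc, List.cons_append, List.cons.injEq, Γ'.bit.injEq, List.append_assoc,
    List.nil_append] at j1 x1
  obtain ⟨rfl, j1⟩ := j1
  obtain ⟨rfl, x1⟩ := x1
  rw [hc .F (by decide)] at f1
  obtain ⟨r2, o2⟩ := copyW_sound (by rw [o1 _ (by decide), hc _ (by decide)])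
    (by rw [o1 _ (by decide), hc _ (by decide)]) (by rw [o1 _ (by decide), hc _ (by decide)]) h2
  have c2 : ∀ k ∈ addScratch, s2 k = [] := by
    intro k hk
    simp only [List.mem_cons, List.not_mem_nil, or_false] at hk
    rcases hk with rfl | rfl | rfl <;>
      rw [o2 _ (by decide), o1 _ (by decide), hc _ (by decide)]
  obtain ⟨j3, x3, g3, r3, o3⟩ := mulBoth_sound u.2.1 v.2.1 c2
    (by rw [o2 _ (by decide), o1 _ (by decide), hc _ (by decide)])
    (by rw [o2 _ (by decide), ← j1]) (by rw [o2 _ (by decide), ← x1]) h3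
  obtain ⟨r4, z4, o4⟩ := move_sound (by decide) h4
  obtain ⟨z5, q5, o5⟩ := move_sound (by decide) h5
  rw [o3 .Z2 (by decide), c2 .Z2 (by decide), List.append_nil] at z4
  rw [z4, List.reverse_reverse, o4 .S (by decide), o3 .S (by decide), o2 .S (by decide),
    o1 .S (by decide), hc .S (by decide), List.append_nil] at q5
  obtain ⟨l, r6, d6, o6⟩ := guess_sound (by decide) h6
  rw [o5 .R (by decide), r4, List.append_nil] at r6
  rw [o5 .C (by decide), o4 .C (by decide), o3 .C (by decide), o2 .C (by decide),
    o1 .C (by decide), hc .C (by decide), List.append_nil] at d6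
  have c6 : ∀ k ∈ addScratch, s6 k = [] := by
    intro k hk
    simp only [List.mem_cons, List.not_mem_nil, or_false] at hk
    rcases hk with rfl | rfl | rfl
    · rw [o6 _ (by decide), o5 _ (by decide), o4 _ (by decide), o3 _ (by decide), c2 _ (by decide)]
    · rw [o6 _ (by decide), z5]
    · rw [o6 _ (by decide), o5 _ (by decide), o4 _ (by decide), o3 _ (by decide), c2 _ (by decide)]
  obtain ⟨j7, x7, g7, r7, o7⟩ := mulBoth_sound u.2.2 v.2.2 c6
    (by rw [o6 _ (by decide), o5 _ (by decide), o4 _ (by decide), o3 _ (by decide),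
      o2 _ (by decide), o1 _ (by decide), hc _ (by decide)])
    (by rw [o6 _ (by decide), o5 _ (by decide), o4 _ (by decide), j3])
    (by rw [o6 _ (by decide), o5 _ (by decide), o4 _ (by decide), x3]) h7
  obtain ⟨e8, r8, q8, o8⟩ := eqCheck_sound (by decide) h8
  have c8 : ∀ k ∈ addScratch, s8 k = [] := by
    intro k hk
    rw [o8 k, o7 k, c6 k hk]
    all_goals
      simp only [List.mem_cons, List.not_mem_nil, or_false] at hk
      rcases hk with rfl | rfl | rfl <;> decide
  have fr : ∀ k ∉ [Reg.J, .X, .G, .Tr, .R, .Z2, .S, .F, .C], s8 k = s k := by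
    intro k hk
    simp only [List.mem_cons, List.not_mem_nil, or_false, not_or] at hk
    rw [o8 _ (by simp [hk]), o7 _ (by simp [hk]), o6 _ (by simp [hk]), o5 _ (by simp [hk]),
      o4 _ (by simp [hk]), o3 _ (by simp [hk]), o2 _ (by simp [hk]), o1 _ (by simp [hk])]
  have f8 : s8 .F = [.bit (xor u.1 v.1)] := by
    rw [o8 _ (by decide), o7 _ (by decide), o6 _ (by decide), o5 _ (by decide), o4 _ (by decide),
      o3 _ (by decide), o2 _ (by decide), f1]
  obtain ⟨f9, m9, p9, o9⟩ := accum_sound f8 c8 h9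
  obtain ⟨d10, o10⟩ := clear_sound h10
  have d8 : s8 .C = l.map .bit := by rw [o8 _ (by decide), o7 _ (by decide), d6]
  refine ⟨?_, ?_, ?_, ⟨val (l.map .bit), ?_, ?_, ?_⟩, fun k hk => ?_⟩
  · rw [o10 _ (by decide), o9 _ (by decide), o8 _ (by decide), j7]
  · rw [o10 _ (by decide), o9 _ (by decide), o8 _ (by decide), x7]
  · rw [o10 _ (by decide), o9 _ (by decide), o8 _ (by decide), g7, o6 _ (by decide),
      o5 _ (by decide), o4 _ (by decide), g3, o2 _ (by decide), g1]
    simp [enc]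
  · rw [r7, r6, o7 .S (by decide), o6 .S (by decide), q5, r3, r2, o1 .W (by decide)] at e8
    rw [numer, numer, denom, denom, ← e8]
    ring
  · rw [o10 _ (by decide), m9, d8, fr _ (by decide)]
  · rw [o10 _ (by decide), p9, d8, fr _ (by decide)]
  · simp only [List.mem_cons, List.not_mem_nil, or_false, not_or] at hk
    by_cases k1 : k = .C
    · subst k1; rw [d10, hc _ (by decide)]
    by_cases k2 : k = .F
    · subst k2; rw [o10 _ (by decide), f9, hc _ (by decide)]
    by_cases k3 : k = .S
    · subst k3; rw [o10 _ (by decide), o9 _ (by decide), q8, hc _ (by decide)]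
    by_cases k4 : k = .Z2
    · subst k4; rw [o10 _ (by decide), o9 _ (by decide), c8 _ (by decide), hc _ (by decide)]
    by_cases k5 : k = .R
    · subst k5; rw [o10 _ (by decide), o9 _ (by decide), r8, hc _ (by decide)]
    rw [o10 _ (by simp [k1]), o9 _ (by simp [hk, k2]), fr _ (by simp [k1, k2, k3, k4, k5, hk])]

/-- Two different bounds are needed: `n` for the numbers of this entry, and `k` for the accumulators
`P` and `M`, which may gain a bit with each entry. -/
theorem entry_complete {s : Mem} {u v : Quo} {restJ restX : List Γ'} {n k : ℕ} {c : List Bool}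
    (hc : ∀ k ∈ scratch, s k = []) (hJ : s .J = enc u ++ restJ) (hX : s .X = enc v ++ restX)
    (hval : val (c.map .bit) * (denom u * denom v) = numer u * numer v * val (s .W))
    (hW : IsBits (s .W)) (hP : IsBits (s .P)) (hM : IsBits (s .M))
    (nu1 : u.2.1.length ≤ n) (nu2 : u.2.2.length ≤ n) (nv1 : v.2.1.length ≤ n)
    (nv2 : v.2.2.length ≤ n) (nW : (s .W).length ≤ n) (nc : c.length ≤ n)
    (hnk : n ≤ k) (kP : (s .P).length ≤ k) (kM : (s .M).length ≤ k) :
    ∃ t, RunsIn entry (2000 * (k + 1) ^ 2) s t ∧ IsBits (t .P) ∧ IsBits (t .M) ∧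
      (t .P).length ≤ k + 1 ∧ (t .M).length ≤ k + 1 := by
  obtain ⟨s1, h1⟩ := readSigns_complete hJ hX
  obtain ⟨a, b, j1, x1, g1, f1, o1⟩ := readSigns_sound h1.runs
  rw [hJ] at j1
  rw [hX] at x1
  simp only [enc, List.cons_append, List.cons.injEq, Γ'.bit.injEq, List.append_assoc,
    List.nil_append] at j1 x1
  obtain ⟨rfl, j1⟩ := j1
  obtain ⟨rfl, x1⟩ := x1
  rw [hc .F (by decide)] at f1
  obtain ⟨s2, h2⟩ := copyW_complete (s := s1) (n := n) (by rwa [o1 _ (by decide)])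
    (by rwa [o1 _ (by decide)]) (by rw [o1 _ (by decide), hc _ (by decide)])
    (by rw [o1 _ (by decide), hc _ (by decide)])
  obtain ⟨r2, o2⟩ := copyW_sound (by rw [o1 _ (by decide), hc _ (by decide)])
    (by rw [o1 _ (by decide), hc _ (by decide)]) (by rw [o1 _ (by decide), hc _ (by decide)])
    h2.runs
  have c2 : ∀ k ∈ addScratch, s2 k = [] := by
    intro k hk
    simp only [List.mem_cons, List.not_mem_nil, or_false] at hk
    rcases hk with rfl | rfl | rfl <;>
      rw [o2 _ (by decide), o1 _ (by decide), hc _ (by decide)]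
  have z2 : s2 .Z = [] := by rw [o2 _ (by decide), o1 _ (by decide), hc _ (by decide)]
  have r2' : s2 .R = s .W := by rw [r2, o1 _ (by decide)]
  obtain ⟨s3, h3, b3, n3⟩ := mulBoth_complete (n := n) u.2.1 v.2.1 c2 z2
    (by rw [o2 _ (by decide), ← j1]) (by rw [o2 _ (by decide), ← x1])
    (by rwa [r2']) (by rwa [r2']) nu1 nv1
  obtain ⟨j3, x3, g3, r3, o3⟩ := mulBoth_sound u.2.1 v.2.1 c2 z2
    (by rw [o2 _ (by decide), ← j1]) (by rw [o2 _ (by decide), ← x1]) h3.runs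
  obtain ⟨s4, h4⟩ := move_complete (a := .R) (b := .Z2) (by decide) s3
  obtain ⟨r4, z4, o4⟩ := move_sound (by decide) h4.runs
  obtain ⟨s5, h5⟩ := move_complete (a := .Z2) (b := .S) (by decide) s4
  obtain ⟨z5, q5, o5⟩ := move_sound (by decide) h5.runs
  rw [o3 .Z2 (by decide), c2 .Z2 (by decide), List.append_nil] at z4
  rw [z4, List.reverse_reverse, o4 .S (by decide), o3 .S (by decide), o2 .S (by decide),
    o1 .S (by decide), hc .S (by decide), List.append_nil] at q5
  obtain ⟨s6, h6, r6, d6, o6⟩ := guess_complete (a := .R) (b := .C) (by decide) c s5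
  rw [o5 .R (by decide), r4, List.append_nil] at r6
  rw [o5 .C (by decide), o4 .C (by decide), o3 .C (by decide), o2 .C (by decide),
    o1 .C (by decide), hc .C (by decide), List.append_nil] at d6
  have c6 : ∀ k ∈ addScratch, s6 k = [] := by
    intro k hk
    simp only [List.mem_cons, List.not_mem_nil, or_false] at hk
    rcases hk with rfl | rfl | rfl
    · rw [o6 _ (by decide), o5 _ (by decide), o4 _ (by decide), o3 _ (by decide), c2 _ (by decide)]
    · rw [o6 _ (by decide), z5]
    · rw [o6 _ (by decide), o5 _ (by decide), o4 _ (by decide), o3 _ (by decide), c2 _ (by decide)]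
  have z6 : s6 .Z = [] := by
    rw [o6 _ (by decide), o5 _ (by decide), o4 _ (by decide), o3 _ (by decide), z2]
  have j6 : s6 .J = u.2.2.map .bit ++ .comma :: restJ := by
    rw [o6 _ (by decide), o5 _ (by decide), o4 _ (by decide), j3]
  have x6 : s6 .X = v.2.2.map .bit ++ .comma :: restX := by
    rw [o6 _ (by decide), o5 _ (by decide), o4 _ (by decide), x3]
  obtain ⟨s7, h7, b7, n7⟩ := mulBoth_complete (n := n) u.2.2 v.2.2 c6 z6 j6 x6
    (by rw [r6]; exact isBits_map _) (by rw [r6]; simpa using nc) nu2 nv2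
  obtain ⟨j7, x7, g7, r7, o7⟩ := mulBoth_sound u.2.2 v.2.2 c6 z6 j6 x6 h7.runs
  have q7 : s7 .S = s3 .R := by rw [o7 .S (by decide), o6 .S (by decide), q5]
  obtain ⟨s8, h8⟩ := eqCheck_complete (a := .R) (b := .S) (n := 3 * n + 2) (by decide) b7
    (by rwa [q7]) n7 (by rwa [q7]) (by
      rw [q7, r7, r6, r3, r2']
      rw [numer, numer, denom, denom] at hval
      rw [← hval]
      ring)
  obtain ⟨e8, r8, q8, o8⟩ := eqCheck_sound (by decide) h8.runs
  have c8 : ∀ k ∈ addScratch, s8 k = [] := by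
    intro k hk
    rw [o8 k, o7 k, c6 k hk]
    all_goals
      simp only [List.mem_cons, List.not_mem_nil, or_false] at hk
      rcases hk with rfl | rfl | rfl <;> decide
  have fr : ∀ k ∉ [Reg.J, .X, .G, .Tr, .R, .Z2, .S, .F, .C], s8 k = s k := by
    intro k hk
    simp only [List.mem_cons, List.not_mem_nil, or_false, not_or] at hk
    rw [o8 _ (by simp [hk]), o7 _ (by simp [hk]), o6 _ (by simp [hk]), o5 _ (by simp [hk]),
      o4 _ (by simp [hk]), o3 _ (by simp [hk]), o2 _ (by simp [hk]), o1 _ (by simp [hk])]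
  have f8 : s8 .F = [.bit (xor u.1 v.1)] := by
    rw [o8 _ (by decide), o7 _ (by decide), o6 _ (by decide), o5 _ (by decide), o4 _ (by decide),
      o3 _ (by decide), o2 _ (by decide), f1]
  have d8 : s8 .C = c.map .bit := by rw [o8 _ (by decide), o7 _ (by decide), d6]
  obtain ⟨s9, h9, b9, b9', n9, n9'⟩ := accum_complete (n := k) f8 c8
    (by rw [d8]; exact isBits_map _) (by rwa [fr _ (by decide)]) (by rwa [fr _ (by decide)])
    (by rw [d8]; simpa using nc.trans hnk) (by rwa [fr _ (by decide)]) (by rwa [fr _ (by decide)])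
  obtain ⟨f9, m9, p9, o9⟩ := accum_sound f8 c8 h9.runs
  obtain ⟨s10, h10⟩ := clear_complete .C s9
  obtain ⟨d10, o10⟩ := clear_sound h10.runs
  refine ⟨s10, (h1.mul (h2.mul (h3.mul (h4.mul (h5.mul (h6.mul (h7.mul (h8.mul
    (h9.mul h10))))))))).mono ?_, ?_, ?_, ?_, ?_⟩
  · rw [o9 _ (by decide), d8, z4, List.length_map, List.length_reverse]
    have : (n + 1) ^ 2 ≤ (k + 1) ^ 2 := Nat.pow_le_pow_left (by omega) 2
    nlinarith
  · rwa [o10 _ (by decide)]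
  · rwa [o10 _ (by decide)]
  · rwa [o10 _ (by decide)]
  · rwa [o10 _ (by decide)]

/-! ### Binary expansions and scalar products -/

theorem val_bits (n : ℕ) : val ((Nat.bits n).map .bit) = n := by
  induction n using Nat.binaryRec' with
  | zero => simp
  | bit b n h ih =>
    rw [Nat.bits_append_bit _ _ h, List.map_cons, val_bit, ih, Nat.bit_val]
    ring

theorem val_lt (l : List Bool) : val (l.map .bit) < 2 ^ l.length := by
  induction l with
  | nil => simp
  | cons b l ih =>
    simp only [List.map_cons, val_bit, List.length_cons, pow_succ]
    have : b.toNat ≤ 1 := b.toNat_le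
    omega

theorem length_bits (n : ℕ) : (Nat.bits n).length = n.size := (Nat.size_eq_bits_len n)

theorem length_bits_le {n k : ℕ} (h : n < 2 ^ k) : (Nat.bits n).length ≤ k := by
  rw [length_bits]
  exact Nat.size_le.2 h

/-- Guessed denominators are forced to be positive in this way: the program itself supplies a set
bit at the most significant end. -/
theorem val_append_true_pos (l : List Bool) : 0 < val ((l ++ [true]).map .bit) := by
  induction l with
  | nil => simp
  | cons b l ih =>
    rw [List.cons_append, List.map_cons, val_bit]
    omega

theorem exists_bits_eq {n : ℕ} (h : 0 < n) : ∃ l, Nat.bits n = l ++ [true] := by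
  induction n using Nat.binaryRec' with
  | zero => simp at h
  | bit b n hb ih =>
    rw [Nat.bits_append_bit _ _ hb]
    rcases Nat.eq_zero_or_pos n with rfl | hn
    · exact ⟨[], by simp [hb rfl]⟩
    · obtain ⟨l, hl⟩ := ih hn
      exact ⟨b :: l, by rw [hl]; rfl⟩

/-- The scalar product of two vectors of fractions. -/
def dot (us vs : List Quo) : ℚ := (List.zipWith (fun u v => value u * value v) us vs).sum

/-- The hypothesis says that `c` is the absolute value of `w * value u * value v`; the sign of the
product decides on which side `c` is counted. -/
theorem value_mul_value {u v : Quo} {c w : ℕ} (hu : 0 < denom u) (hv : 0 < denom v)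
    (h : c * (denom u * denom v) = numer u * numer v * w) :
    ((bif xor u.1 v.1 then 0 else c : ℕ) : ℚ) - (bif xor u.1 v.1 then c else 0 : ℕ) =
      w * (value u * value v) := by
  have hu' : (denom u : ℚ) ≠ 0 := by exact_mod_cast hu.ne'
  have hv' : (denom v : ℚ) ≠ 0 := by exact_mod_cast hv.ne'
  have h' : (c : ℚ) * (denom u * denom v) = numer u * numer v * w := by exact_mod_cast h
  have : (c : ℚ) = numer u * numer v * w / (denom u * denom v) := by
    rw [eq_div_iff (mul_ne_zero hu' hv'), h']
  rcases u with ⟨a, u⟩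
  rcases v with ⟨b, v⟩
  cases a <;> cases b <;> simp [value, this] <;> field_simp

/-- Each round changes `P - M` by `W` times one product. The number of rounds is forced: a round
must begin with a bit on `J`, and the loop must end with a bracket there. As `X` must then be empty,
both lists have the same length. -/
theorem entries_sound {us vs : List Quo} {rest rest' : List Γ'} {s t : Mem}
    (hc : ∀ k ∈ scratch, s k = []) (hJ : s .J = us.flatMap enc ++ .ket :: rest)
    (hX : s .X = vs.flatMap enc) (hu : ∀ u ∈ us, 0 < denom u) (hv : ∀ v ∈ vs, 0 < denom v)
    (h : Runs entry∗ s t) (htJ : t .J = .ket :: rest') (htX : t .X = []) :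
    rest' = rest ∧ us.length = vs.length ∧ t .G = (vs.flatMap enc).reverse ++ s .G ∧
      (val (t .P) : ℚ) - val (t .M) = val (s .P) - val (s .M) + val (s .W) * dot us vs ∧
      ∀ k ∉ [Reg.J, .X, .G, .Tr, .P, .M], t k = s k := by
  induction us generalizing vs s with
  | nil =>
    rcases runs_star_cases h with rfl | ⟨s1, h1, -⟩
    · rw [htX] at hX
      have : vs = [] := by
        cases vs with
        | nil => rfl
        | cons v vs => simp [enc] at hX
      subst this
      rw [htJ] at hJ
      simpa [dot] using hJ
    · obtain ⟨s2, h2, -⟩ := runs_mul.1 h1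
      obtain ⟨a, b, e, -⟩ := readSigns_sound h2
      simp [hJ] at e
  | cons u us ih =>
    rcases runs_star_cases h with rfl | ⟨s1, h1, h2⟩
    · rw [htJ] at hJ
      simp [enc] at hJ
    · cases vs with
      | nil =>
        obtain ⟨s2, h2, -⟩ := runs_mul.1 h1
        obtain ⟨a, b, -, e, -⟩ := readSigns_sound h2
        simp [hX] at e
      | cons v vs =>
        rw [List.flatMap_cons, List.append_assoc] at hJ
        rw [List.flatMap_cons] at hX
        obtain ⟨e1, e2, e3, ⟨c, ec, eM, eP⟩, e4⟩ := entry_sound hc hJ hX h1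
        obtain ⟨i1, i2, i3, i4, i5⟩ := ih (vs := vs) (s := s1)
          (fun k hk => by
            rw [e4 k, hc k hk]
            simp only [List.mem_cons, List.not_mem_nil, or_false] at hk
            rcases hk with rfl | rfl | rfl | rfl | rfl | rfl | rfl | rfl <;> decide)
          e1 e2 (fun u hu' => hu u (by simp [hu'])) (fun v hv' => hv v (by simp [hv'])) h2
        refine ⟨i1, by simp [i2], by rw [i3, e3]; simp, ?_, fun k hk => by rw [i5 k hk, e4 k hk]⟩
        have := value_mul_value (hu u (by simp)) (hv v (by simp)) ec
        rw [i4, eM, eP, e4 .W (by decide)]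
        simp only [dot, List.zipWith_cons_cons, List.sum_cons] at this ⊢
        push_cast
        linarith

theorem entries_complete {us vs : List Quo} {rest : List Γ'} {s : Mem} {n k : ℕ}
    (hc : ∀ k ∈ scratch, s k = []) (hJ : s .J = us.flatMap enc ++ .ket :: rest)
    (hX : s .X = vs.flatMap enc) (hlen : us.length = vs.length)
    (hdvd : ∀ p ∈ us.zip vs, denom p.1 * denom p.2 ∣ val (s .W))
    (hu : ∀ u ∈ us, 0 < denom u ∧ u.2.1.length ≤ n ∧ u.2.2.length ≤ n)
    (hv : ∀ v ∈ vs, 0 < denom v ∧ v.2.1.length ≤ n ∧ v.2.2.length ≤ n) {w : List Bool}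
    (hW : s .W = w.map .bit) (nW : w.length ≤ 2 * n)
    (hP : IsBits (s .P)) (hM : IsBits (s .M)) (hnk : 4 * n + us.length ≤ k)
    (kP : (s .P).length + us.length ≤ k) (kM : (s .M).length + us.length ≤ k) :
    ∃ t, RunsIn entry∗ (us.length * (2000 * (k + 1) ^ 2)) s t ∧ IsBits (t .P) ∧ IsBits (t .M) ∧
      (t .P).length ≤ k ∧ (t .M).length ≤ k ∧ t .J = .ket :: rest ∧ t .X = [] := by
  induction us generalizing vs s with
  | nil =>
    obtain rfl : vs = [] := List.length_eq_zero_iff.1 hlen.symm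
    exact ⟨s, RunsIn.star_nil.mono (by simp), hP, hM, by simpa using kP, by simpa using kM,
      by simpa using hJ, by simpa using hX⟩
  | cons u us ih =>
    cases vs with
    | nil => simp at hlen
    | cons v vs =>
      rw [List.flatMap_cons, List.append_assoc] at hJ
      rw [List.flatMap_cons] at hX
      simp only [List.length_cons] at hnk kP kM
      obtain ⟨hu0, hu1, hu2⟩ := hu u (by simp)
      obtain ⟨hv0, hv1, hv2⟩ := hv v (by simp)
      obtain ⟨q, hq⟩ := hdvd (u, v) (by simp)
      simp only at hq
      set c := numer u * numer v * q with hcdef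
      -- `q` is the quotient of `W` by the two denominators, hence at most `W` and below `2 ^ (2 *
      -- n)`; the two numerators account for `n` bits each.
      have hclt : c < 2 ^ (4 * n) := by
        have h1 : numer u < 2 ^ n := (val_lt _).trans_le (Nat.pow_le_pow_right (by simp) hu1)
        have h2 : numer v < 2 ^ n := (val_lt _).trans_le (Nat.pow_le_pow_right (by simp) hv1)
        have h3 : q < 2 ^ (2 * n) := by
          refine lt_of_le_of_lt ?_ ((val_lt w).trans_le (Nat.pow_le_pow_right (by simp) nW))
          rw [← hW, hq]
          exact Nat.le_mul_of_pos_left _ (Nat.mul_pos hu0 hv0)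
        calc c < 2 ^ n * 2 ^ n * 2 ^ (2 * n) := by
              rw [hcdef]
              exact Nat.mul_lt_mul_of_le_of_lt (Nat.mul_le_mul h1.le h2.le) h3
                (Nat.mul_pos (by positivity) (by positivity))
          _ = 2 ^ (4 * n) := by rw [← pow_add, ← pow_add]; congr 1; ring
      have hval : val ((Nat.bits c).map .bit) * (denom u * denom v) =
          numer u * numer v * val (s .W) := by
        rw [val_bits, hq, hcdef]; ring
      -- Here `us` is the tail of the list. The accumulators may use `k - us.length - 1` bits now,
      -- which reserves one bit for this entry and one for each of those to come.
      obtain ⟨s1, h1, b1, b2, b3, b4⟩ := entry_complete (n := 4 * n) (k := k - us.length - 1) hc hJ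
        hX hval (by rw [hW]; exact isBits_map _) hP hM (by omega) (by omega) (by omega) (by omega)
        (by rw [hW, List.length_map]; omega) (length_bits_le hclt) (by omega) (by omega) (by omega)
      obtain ⟨e1, e2, e3, -, e4⟩ := entry_sound hc hJ hX h1.runs
      obtain ⟨t, h2, i⟩ := ih (vs := vs) (s := s1)
          (fun k hk => by
            rw [e4 k, hc k hk]
            simp only [List.mem_cons, List.not_mem_nil, or_false] at hk
            rcases hk with rfl | rfl | rfl | rfl | rfl | rfl | rfl | rfl <;> decide)
          e1 e2 (by simpa using hlen)
          (fun p hp => by rw [e4 _ (by decide)]; exact hdvd p (by simp [hp]))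
          (fun u hu' => hu u (by simp [hu'])) (fun v hv' => hv v (by simp [hv']))
          (by rw [e4 _ (by decide), hW]) b1 b2 (by omega) (by omega) (by omega)
      refine ⟨t, (RunsIn.star_cons h1 h2).mono ?_, i⟩
      have : (k - us.length - 1 + 1) ^ 2 ≤ (k + 1) ^ 2 := Nat.pow_le_pow_left (by omega) 2
      rw [List.length_cons]
      nlinarith

/-! ### Verification of one inequality -/

/-- Verify one inequality: guess a common denominator `W`, add up all products in `P` and `M`,
and check `P + C = M` for a guessed `C`. -/
def row : Prog :=
  pop .J .bra * (push .W (.bit true) * (guess .W .Tr * (entry∗ * (pop .J .ket * (empty .X *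
    (guess .C .Tr * (add .C .P * (clear .C * (eqCheck .P .M * (clear .W * move .G .X))))))))))

theorem isRegular_row : row.IsRegular :=
  (isRegular_pop _ _).mul ((isRegular_push _ _).mul ((isRegular_guess _ _).mul
    (isRegular_entry.kstar.mul ((isRegular_pop _ _).mul ((isRegular_empty _).mul
      ((isRegular_guess _ _).mul ((isRegular_add _ _).mul ((isRegular_clear _).mul
        ((isRegular_eqCheck _ _).mul ((isRegular_clear _).mul (isRegular_move _ _)))))))))))

/-- Encoding of a row. -/
def encRow (us : List Quo) : List Γ' := .bra :: (us.flatMap enc ++ [.ket])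

/-- The stacks that are empty before and after the treatment of a row. -/
abbrev rowScratch : List Reg := [.R, .Z, .R2, .Z2, .Cy, .F, .S, .C, .W, .P, .M, .G]

/-- The scalar product is `(P - M) / W` with `W > 0`, so it is nonpositive if `P + C = M` for a
natural number `C`. Moving `G` back to `X` restores the vector for the next row. -/
theorem row_sound {us vs : List Quo} {rest : List Γ'} {s t : Mem}
    (hc : ∀ k ∈ rowScratch, s k = []) (hJ : s .J = encRow us ++ rest)
    (hX : s .X = vs.flatMap enc) (hu : ∀ u ∈ us, 0 < denom u) (hv : ∀ v ∈ vs, 0 < denom v)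
    (h : Runs row s t) :
    t .J = rest ∧ us.length = vs.length ∧ dot us vs ≤ 0 ∧ ∀ k ∉ [Reg.J, .Tr], t k = s k := by
  obtain ⟨s1, h1, h⟩ := runs_mul.1 h
  obtain ⟨s2, h2, h⟩ := runs_mul.1 h
  obtain ⟨s3, h3, h⟩ := runs_mul.1 h
  obtain ⟨s4, h4, h⟩ := runs_mul.1 h
  obtain ⟨s5, h5, h⟩ := runs_mul.1 h
  obtain ⟨s6, h6, h⟩ := runs_mul.1 h
  obtain ⟨s7, h7, h⟩ := runs_mul.1 h
  obtain ⟨s8, h8, h⟩ := runs_mul.1 h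
  obtain ⟨s9, h9, h⟩ := runs_mul.1 h
  obtain ⟨s10, h10, h⟩ := runs_mul.1 h
  obtain ⟨s11, h11, h12⟩ := runs_mul.1 h
  obtain ⟨l, hl, rfl⟩ := runs_pop.1 h1
  rw [hJ] at hl
  simp only [encRow, List.cons_append, List.append_assoc, List.nil_append, List.cons.injEq,
    true_and] at hl
  subst hl
  rw [runs_push] at h2
  subst h2
  obtain ⟨w, w3, tr3, o3⟩ := guess_sound (by decide) h3
  have o3' : ∀ k ∉ [Reg.J, .W, .Tr], s3 k = s k := by
    intro k hk
    simp only [List.mem_cons, List.not_mem_nil, or_false, not_or] at hk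
    rw [o3 k (by simp [hk])]
    simp [hk]
  obtain ⟨rest', j5, rfl⟩ := runs_pop.1 h5
  obtain ⟨x6, rfl⟩ := runs_empty.1 h6
  obtain ⟨rfl, hlen, g4, d4, o4⟩ := entries_sound (us := us) (vs := vs) (rest := rest)
    (fun k hk => by
      rw [o3' k, hc k]
      all_goals
        simp only [List.mem_cons, List.not_mem_nil, or_false] at hk
        rcases hk with rfl | rfl | rfl | rfl | rfl | rfl | rfl | rfl <;> decide)
    (by rw [o3 _ (by decide)]; simp) (by rw [o3' _ (by decide), hX]) hu hv h4 j5
    (by simpa using x6)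
  obtain ⟨l, c7, tr7, o7⟩ := guess_sound (by decide) h7
  have c7' : ∀ k ∈ addScratch, s7 k = [] := by
    intro k hk
    simp only [List.mem_cons, List.not_mem_nil, or_false] at hk
    rcases hk with rfl | rfl | rfl <;>
      rw [o7 _ (by decide), Function.update_of_ne (by decide), o4 _ (by decide), o3' _ (by decide),
        hc _ (by decide)]
  obtain ⟨p8, o8⟩ := add_sound (by decide) (by decide) (by decide) c7' h8
  obtain ⟨c9, o9⟩ := clear_sound h9
  obtain ⟨q10, p10, m10, o10⟩ := eqCheck_sound (by decide) h10
  obtain ⟨w11, o11⟩ := clear_sound h11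
  obtain ⟨g12, x12, o12⟩ := move_sound (by decide) h12
  have fr : ∀ k ∉ [Reg.J, .X, .G, .Tr, .P, .M, .C, .W], t k = s k := by
    intro k hk
    simp only [List.mem_cons, List.not_mem_nil, or_false, not_or] at hk
    rw [o12 _ (by simp [hk]), o11 _ (by simp [hk]), o10 _ (by simp [hk]), o9 _ (by simp [hk]),
      o8 _ (by simp [hk]), o7 _ (by simp [hk]), Function.update_of_ne hk.1, o4 _ (by simp [hk]),
      o3' _ (by simp [hk])]
  refine ⟨?_, hlen, ?_, fun k hk => ?_⟩
  · rw [o12 _ (by decide), o11 _ (by decide), o10 _ (by decide), o9 _ (by decide),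
      o8 _ (by decide), o7 _ (by decide)]
    simp
  · rw [o9 .P (by decide), o9 .M (by decide), o8 .M (by decide), p8, o7 .P (by decide),
      o7 .M (by decide), Function.update_of_ne (by decide), Function.update_of_ne (by decide)] at q10
    rw [o3' .P (by decide), o3' .M (by decide), hc .P (by decide), hc .M (by decide)] at d4
    -- The bit `true` was pushed before the guessed bits, so it is the most significant one.
    have hw : 0 < val (s3 .W) := by
      rw [w3]
      simpa [hc .W (by decide)] using val_append_true_pos w
    have q : (val (s4 .P) : ℚ) + val (s7 .C) = val (s4 .M) := by exact_mod_cast q10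
    have h0 : (0 : ℚ) ≤ val (s7 .C) := by positivity
    by_contra! hd
    have := mul_pos (Nat.cast_pos (α := ℚ).2 hw) hd
    linarith
  · simp only [List.mem_cons, List.not_mem_nil, or_false, not_or] at hk
    by_cases k1 : k = .X
    · subst k1
      rw [x12, o11 _ (by decide), o10 _ (by decide), o9 _ (by decide), o8 _ (by decide),
        o7 _ (by decide), Function.update_of_ne (by decide), g4, o3' _ (by decide),
        hc _ (by decide), o11 _ (by decide), o10 _ (by decide), o9 _ (by decide), o8 _ (by decide),
        o7 _ (by decide), x6, hX]
      simp
    by_cases k2 : k = .G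
    · subst k2; rw [g12, hc _ (by decide)]
    by_cases k3 : k = .P
    · subst k3; rw [o12 _ (by decide), o11 _ (by decide), p10, hc _ (by decide)]
    by_cases k4 : k = .M
    · subst k4; rw [o12 _ (by decide), o11 _ (by decide), m10, hc _ (by decide)]
    by_cases k5 : k = .C
    · subst k5; rw [o12 _ (by decide), o11 _ (by decide), o10 _ (by decide), c9, hc _ (by decide)]
    by_cases k6 : k = .W
    · subst k6; rw [o12 _ (by decide), w11, hc _ (by decide)]
    exact fr k (by simp [hk, k1, k2, k3, k4, k5, k6])

theorem length_le_of_mem {us : List Quo} {u : Quo} (h : u ∈ us) :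
    u.2.1.length + u.2.2.length ≤ (us.flatMap enc).length := by
  induction us with
  | nil => simp at h
  | cons v us ih =>
    rw [List.flatMap_cons, List.length_append]
    rcases List.mem_cons.1 h with rfl | h
    · simp [enc]; omega
    · have := ih h; omega

theorem length_le_length_flatMap (us : List Quo) : us.length ≤ (us.flatMap enc).length := by
  induction us with
  | nil => simp
  | cons v us ih => simp [enc]; omega

theorem prod_denom_le (us : List Quo) :
    (us.map denom).prod ≤ 2 ^ (us.flatMap enc).length := by
  induction us with
  | nil => simp
  | cons v us ih =>
    rw [List.flatMap_cons, List.length_append, List.map_cons, List.prod_cons, pow_add]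
    refine Nat.mul_le_mul ?_ ih
    refine (val_lt _).le.trans (Nat.pow_le_pow_right (by simp) ?_)
    simp [enc]; omega

theorem row_complete {us vs : List Quo} {rest : List Γ'} {s : Mem} {n : ℕ}
    (hc : ∀ k ∈ rowScratch, s k = []) (hJ : s .J = encRow us ++ rest)
    (hX : s .X = vs.flatMap enc) (hu : ∀ u ∈ us, 0 < denom u) (hv : ∀ v ∈ vs, 0 < denom v)
    (hlen : us.length = vs.length) (hdot : dot us vs ≤ 0)
    (nu : (us.flatMap enc).length < n) (nv : (vs.flatMap enc).length < n) :
    ∃ t, RunsIn row (3000 * (6 * n + 1) ^ 3) s t := by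
  have h1 := runsIn_pop (s := s) (k := .J) (a := Γ'.bra) (l := us.flatMap enc ++ .ket :: rest)
    (by rw [hJ]; simp [encRow])
  set s1 := Function.update s Reg.J (us.flatMap enc ++ .ket :: rest) with hs1
  have h2 := runsIn_push (s := s1) .W (Γ'.bit true)
  set s2 := Function.update s1 Reg.W (.bit true :: s1 .W) with hs2
  -- The common denominator to guess is the product of all denominators of the row and of the
  -- vector. The leading bit of its expansion is already supplied by the program.
  have hpos : 0 < (us.map denom).prod * (vs.map denom).prod := by
    refine Nat.mul_pos (List.prod_pos fun a ha => ?_) (List.prod_pos fun a ha => ?_)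
    · obtain ⟨u, h, rfl⟩ := List.mem_map.1 ha
      exact hu u h
    · obtain ⟨u, h, rfl⟩ := List.mem_map.1 ha
      exact hv u h
  obtain ⟨w, hw⟩ := exists_bits_eq hpos
  have nw : w.length + 1 ≤ 2 * n := by
    have : (w ++ [true]).length ≤ 2 * n := by
      rw [← hw]
      refine length_bits_le ?_
      calc _ ≤ 2 ^ (us.flatMap enc).length * 2 ^ (vs.flatMap enc).length :=
            Nat.mul_le_mul (prod_denom_le us) (prod_denom_le vs)
        _ = 2 ^ ((us.flatMap enc).length + (vs.flatMap enc).length) := (pow_add _ _ _).symm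
        _ < 2 ^ (2 * n) := Nat.pow_lt_pow_right (by simp) (by omega)
    simpa using this
  obtain ⟨s3, h3, w3, -, o3⟩ := guess_complete (a := .W) (b := .Tr) (by decide) w s2
  have o3' : ∀ k ∉ [Reg.J, .W, .Tr], s3 k = s k := by
    intro k hk
    simp only [List.mem_cons, List.not_mem_nil, or_false, not_or] at hk
    rw [o3 k (by simp [hk])]
    simp [hs1, hs2, hk]
  have w3' : s3 .W = (w ++ [true]).map .bit := by
    rw [w3]
    simp [hs1, hs2, hc .W (by decide)]
  have c3 : ∀ k ∈ scratch, s3 k = [] := fun k hk => by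
    rw [o3' k, hc k]
    all_goals
      simp only [List.mem_cons, List.not_mem_nil, or_false] at hk
      rcases hk with rfl | rfl | rfl | rfl | rfl | rfl | rfl | rfl <;> decide
  have j3 : s3 .J = us.flatMap enc ++ .ket :: rest := by rw [o3 _ (by decide)]; simp [hs1, hs2]
  have x3 : s3 .X = vs.flatMap enc := by rw [o3' _ (by decide), hX]
  have p3 : s3 .P = [] := by rw [o3' _ (by decide), hc _ (by decide)]
  have m3 : s3 .M = [] := by rw [o3' _ (by decide), hc _ (by decide)]
  have lu := length_le_length_flatMap us
  -- `k = 5 * n`: each product has at most `4 * n` bits, and fewer than `n` additions contribute at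
  -- most one bit each.
  obtain ⟨s4, h4, b4, b4', l4, l4', j4, x4⟩ := entries_complete (n := n) (k := 5 * n) c3 j3 x3 hlen
    (by
      rintro ⟨u, v⟩ hp
      obtain ⟨h1, h2⟩ := List.of_mem_zip hp
      rw [w3', ← hw, val_bits]
      exact mul_dvd_mul (List.dvd_prod (List.mem_map_of_mem h1))
        (List.dvd_prod (List.mem_map_of_mem h2)))
    (fun u h => by have := length_le_of_mem h; exact ⟨hu u h, by omega, by omega⟩)
    (fun u h => by have := length_le_of_mem h; exact ⟨hv u h, by omega, by omega⟩)
    w3' (by simpa using nw) (by simp [p3]) (by simp [m3]) (by omega)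
    (by simp [p3]; omega) (by simp [m3]; omega)
  obtain ⟨-, -, g4, d4, o4⟩ := entries_sound c3 j3 x3 hu hv h4.runs j4 x4
  have h5 := runsIn_pop j4
  set s5 := Function.update s4 Reg.J rest with hs5
  have o5 : ∀ k ∉ [Reg.J], s5 k = s4 k := by
    intro k hk
    simp only [List.mem_cons, List.not_mem_nil, or_false] at hk
    simp [hs5, hk]
  have h6 := runsIn_empty (s := s5) (k := .X) (by rw [o5 _ (by decide), x4])
  rw [p3, m3, val_nil, Nat.cast_zero] at d4
  have hle : val (s4 .P) ≤ val (s4 .M) := by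
    have : (val (s3 .W) : ℚ) * dot us vs ≤ 0 := mul_nonpos_of_nonneg_of_nonpos (by positivity) hdot
    have : (val (s4 .P) : ℚ) ≤ val (s4 .M) := by linarith
    exact_mod_cast this
  have bl : ∀ {l : List Γ'}, IsBits l → ∃ l' : List Bool, l = l'.map .bit := by
    intro l hl
    induction l with
    | nil => exact ⟨[], rfl⟩
    | cons x l ih =>
      obtain ⟨⟨b, rfl⟩, h⟩ := isBits_cons.1 hl
      obtain ⟨l', rfl⟩ := ih h
      exact ⟨b :: l', rfl⟩
  -- The slack to guess is `M - P`, no longer than `M`.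
  have nd : (Nat.bits (val (s4 .M) - val (s4 .P))).length ≤ 5 * n := by
    obtain ⟨l', hl'⟩ := bl b4'
    refine length_bits_le (lt_of_le_of_lt (Nat.sub_le _ _) ?_)
    rw [hl'] at l4' ⊢
    exact (val_lt l').trans_le (Nat.pow_le_pow_right (by simp) (by simpa using l4'))
  obtain ⟨s7, h7, c7, -, o7⟩ := guess_complete (a := .C) (b := .Tr) (by decide)
    (Nat.bits (val (s4 .M) - val (s4 .P))) s5
  rw [o5 .C (by decide), o4 .C (by decide), c3 .C (by decide), List.append_nil] at c7
  have c7' : ∀ k ∈ addScratch, s7 k = [] := by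
    intro k hk
    simp only [List.mem_cons, List.not_mem_nil, or_false] at hk
    rcases hk with rfl | rfl | rfl <;>
      rw [o7 _ (by decide), o5 _ (by decide), o4 _ (by decide), c3 _ (by decide)]
  have p7 : s7 .P = s4 .P := by rw [o7 _ (by decide), o5 _ (by decide)]
  have m7 : s7 .M = s4 .M := by rw [o7 _ (by decide), o5 _ (by decide)]
  obtain ⟨s8, h8, b8, l8⟩ := add_complete (r := .C) (z := .P) (n := 5 * n) (by decide) (by decide)
    (by decide) c7' (by rw [c7]; exact isBits_map _) (by rwa [p7]) (by rw [c7]; simpa using nd)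
    (by rwa [p7])
  obtain ⟨p8, o8⟩ := add_sound (by decide) (by decide) (by decide) c7' h8.runs
  obtain ⟨s9, h9⟩ := clear_complete .C s8
  obtain ⟨c9, o9⟩ := clear_sound h9.runs
  have p9 : s9 .P = s8 .P := o9 _ (by decide)
  have m9 : s9 .M = s4 .M := by rw [o9 _ (by decide), o8 _ (by decide), m7]
  obtain ⟨s10, h10⟩ := eqCheck_complete (a := .P) (b := .M) (s := s9) (n := 5 * n + 1) (by decide)
    (by rwa [p9]) (by rwa [m9]) (by rwa [p9]) (by rw [m9]; omega)
    (by rw [p9, m9, p8, p7, c7, val_bits]; omega)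
  obtain ⟨-, -, -, o10⟩ := eqCheck_sound (by decide) h10.runs
  obtain ⟨s11, h11⟩ := clear_complete .W s10
  obtain ⟨w11, o11⟩ := clear_sound h11.runs
  obtain ⟨s12, h12⟩ := move_complete (a := .G) (b := .X) (by decide) s11
  refine ⟨s12, (h1.mul (h2.mul (h3.mul (h4.mul (h5.mul (h6.mul (h7.mul (h8.mul (h9.mul (h10.mul
    (h11.mul h12))))))))))).mono ?_⟩
  have e1 : (s8 .C).length ≤ 5 * n := by rw [o8 _ (by decide), c7]; simpa using nd
  have e2 : (s10 .W).length ≤ 2 * n := by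
    rw [o10 _ (by decide), o9 _ (by decide), o8 _ (by decide), o7 _ (by decide), o5 _ (by decide),
      o4 _ (by decide), w3']
    simpa using nw
  have e3 : (s11 .G).length ≤ n := by
    rw [o11 _ (by decide), o10 _ (by decide), o9 _ (by decide), o8 _ (by decide), o7 _ (by decide),
      o5 _ (by decide), g4, o3' _ (by decide), hc _ (by decide)]
    simpa using nv.le
  have e4 : us.length * (2000 * (5 * n + 1) ^ 2) ≤ n * (2000 * (5 * n + 1) ^ 2) :=
    Nat.mul_le_mul_right _ (by omega)
  have e5 : 1 ≤ n := by omega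
  have e6 : n * (2000 * (5 * n + 1) ^ 2) + 300 * n ≤ 3000 * (6 * n + 1) ^ 3 := by
    clear * -
    have : (5 * n + 1) ^ 2 ≤ (6 * n + 1) ^ 2 := Nat.pow_le_pow_left (by omega) 2
    nlinarith [Nat.zero_le n]
  linarith

/-! ### Guessing the solution -/

/-- Guess the value of one variable, after reading its type. -/
def gen : Prog := choice fun a => choice fun b =>
  pop .J (.bit a) * (push .G (.bit b) * (guess .G .Tr * (push .G .comma *
    ((bif a then 1 else guess .G .Tr) * (push .G (.bit true) * push .G .comma)))))

theorem isRegular_gen : gen.IsRegular :=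
  isRegular_choice fun a => isRegular_choice fun b => (isRegular_pop _ _).mul
    ((isRegular_push _ _).mul ((isRegular_guess _ _).mul ((isRegular_push _ _).mul
      (Language.IsRegular.mul (by cases a; exacts [isRegular_guess _ _, Language.isRegular_one])
        ((isRegular_push _ _).mul (isRegular_push _ _))))))

/-- The fraction `u` is allowed as a value of a variable of type `a`. -/
def Fits (a : Bool) (u : Quo) : Prop := 0 < denom u ∧ (a = true → denom u = 1)

/-- The bit `true` pushed after the guessed bits is the leading bit of the denominator, since `G`
holds the fraction in reverse. For an integer variable nothing else is pushed there, so the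
denominator is 1. -/
theorem gen_sound {s t : Mem} (h : Runs gen s t) :
    ∃ a u, Fits a u ∧ s .J = .bit a :: t .J ∧ t .G = (enc u).reverse ++ s .G ∧
      ∀ k ∉ [Reg.J, .G, .Tr], t k = s k := by
  obtain ⟨a, h⟩ := runs_choice.1 h
  obtain ⟨b, h⟩ := runs_choice.1 h
  obtain ⟨s1, h1, h⟩ := runs_mul.1 h
  obtain ⟨s2, h2, h⟩ := runs_mul.1 h
  obtain ⟨s3, h3, h⟩ := runs_mul.1 h
  obtain ⟨s4, h4, h⟩ := runs_mul.1 h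
  obtain ⟨s5, h5, h⟩ := runs_mul.1 h
  obtain ⟨s6, h6, h7⟩ := runs_mul.1 h
  obtain ⟨j, hj, rfl⟩ := runs_pop.1 h1
  rw [runs_push] at h2 h4 h6 h7
  obtain ⟨l, g3, -, o3⟩ := guess_sound (by decide) h3
  have key : ∃ l' : List Bool, s5 .G = l'.map .bit ++ s4 .G ∧ (a = true → l' = []) ∧
      ∀ k ∉ [Reg.G, .Tr], s5 k = s4 k := by
    cases a
    · obtain ⟨l, g, -, o⟩ := guess_sound (by decide) h5
      exact ⟨l, g, by simp, o⟩
    · rw [cond_true, runs_one] at h5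
      subst h5
      exact ⟨[], by simp⟩
  obtain ⟨l', g5, e5, o5⟩ := key
  subst h2 h4 h6 h7
  refine ⟨a, (b, l.reverse, l'.reverse ++ [true]), ⟨val_append_true_pos _, fun ha => ?_⟩, ?_, ?_,
    fun k hk => ?_⟩
  · simp [denom, e5 ha]
  · simp [hj, o5, o3]
  · simp [enc, g5, g3]
  · simp only [List.mem_cons, List.not_mem_nil, or_false, not_or] at hk
    simp [o5, o3, hk]

theorem gen_complete {s : Mem} {a : Bool} {u : Quo} {j : List Γ'} (hJ : s .J = .bit a :: j)
    {d : List Bool} (hu : u.2.2 = d ++ [true]) (ha : a = true → d = []) :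
    ∃ t, RunsIn gen (2 * (enc u).length + 5) s t ∧ t .J = j ∧ t .G = (enc u).reverse ++ s .G ∧
      ∀ k ∉ [Reg.J, .G, .Tr], t k = s k := by
  have h1 := runsIn_pop hJ
  set s1 := Function.update s Reg.J j with hs1
  have h2 := runsIn_push (s := s1) Reg.G (Γ'.bit u.1)
  set s2 := Function.update s1 Reg.G (Γ'.bit u.1 :: s1 .G) with hs2
  obtain ⟨s3, h3, g3, -, o3⟩ := guess_complete (a := .G) (b := .Tr) (by decide) u.2.1.reverse s2
  have h4 := runsIn_push (s := s3) Reg.G Γ'.comma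
  set s4 := Function.update s3 Reg.G (Γ'.comma :: s3 .G) with hs4
  have key : ∃ s5, RunsIn (bif a then 1 else guess .G .Tr : Prog) (2 * d.length) s4 s5 ∧
      s5 .G = d.reverse.map .bit ++ s4 .G ∧ ∀ k ∉ [Reg.G, .Tr], s5 k = s4 k := by
    cases a
    · obtain ⟨s5, h5, g5, -, o5⟩ := guess_complete (a := .G) (b := .Tr) (by decide) d.reverse s4
      exact ⟨s5, by simpa using h5, g5, o5⟩
    · exact ⟨s4, runsIn_one.mono (by simp), by simp [ha]⟩
  obtain ⟨s5, h5, g5, o5⟩ := key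
  have h6 := runsIn_push (s := s5) Reg.G (Γ'.bit true)
  set s6 := Function.update s5 Reg.G (Γ'.bit true :: s5 .G) with hs6
  have h7 := runsIn_push (s := s6) Reg.G Γ'.comma
  refine ⟨_, (RunsIn.choice (b := a) (RunsIn.choice (b := u.1) (h1.mul (h2.mul (h3.mul (h4.mul
    (h5.mul (h6.mul h7)))))))).mono ?_, ?_, ?_, fun k hk => ?_⟩
  · simp [enc, hu]; omega
  · simp [hs6, o5, hs4, o3, hs2, hs1]
  · simp [hs6, g5, hs4, g3, hs2, hs1, enc, hu]
  · simp only [List.mem_cons, List.not_mem_nil, or_false, not_or] at hk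
    simp [hs6, o5, hs4, o3, hs2, hs1, hk]

theorem gens_sound {tys : List Bool} {rest : List Γ'} {s t : Mem}
    (hJ : s .J = tys.map .bit ++ rest) (hrest : ∀ b, rest.head? ≠ some (.bit b))
    (h : Runs gen∗ s t) (ht : ∀ b, (t .J).head? ≠ some (.bit b)) :
    ∃ vs, List.Forall₂ Fits tys vs ∧ t .J = rest ∧ t .G = (vs.flatMap enc).reverse ++ s .G ∧
      ∀ k ∉ [Reg.J, .G, .Tr], t k = s k := by
  induction tys generalizing s with
  | nil =>
    rcases runs_star_cases h with rfl | ⟨s1, h1, -⟩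
    · exact ⟨[], by simp, by simpa using hJ, by simp, by simp⟩
    · obtain ⟨a, u, -, e, -⟩ := gen_sound h1
      rw [List.map_nil, List.nil_append] at hJ
      rw [← hJ, e] at hrest
      simp at hrest
  | cons b tys ih =>
    rcases runs_star_cases h with rfl | ⟨s1, h1, h2⟩
    · rw [hJ] at ht
      simp at ht
    · obtain ⟨a, u, hf, e1, e2, e3⟩ := gen_sound h1
      rw [hJ] at e1
      simp only [List.map_cons, List.cons_append, List.cons.injEq, Γ'.bit.injEq] at e1
      obtain ⟨rfl, e1⟩ := e1
      obtain ⟨vs, i1, i2, i3, i4⟩ := ih e1.symm h2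
      exact ⟨u :: vs, .cons hf i1, i2, by rw [i3, e2]; simp, fun k hk => by rw [i4 k hk, e3 k hk]⟩

theorem gens_complete {tys : List Bool} {vs : List Quo} {rest : List Γ'} {s : Mem}
    (hJ : s .J = tys.map .bit ++ rest)
    (hv : List.Forall₂ (fun a u => ∃ d, u.2.2 = d ++ [true] ∧ (a = true → d = [])) tys vs) :
    ∃ t, RunsIn gen∗ (7 * (vs.flatMap enc).length) s t ∧ t .J = rest ∧
      t .G = (vs.flatMap enc).reverse ++ s .G ∧ ∀ k ∉ [Reg.J, .G, .Tr], t k = s k := by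
  induction hv generalizing s with
  | nil => exact ⟨s, RunsIn.star_nil.mono (by simp), by simpa using hJ, by simp, by simp⟩
  | cons h _ ih =>
    obtain ⟨d, h1, h2⟩ := h
    obtain ⟨s1, r1, e1, e2, e3⟩ := gen_complete hJ h1 h2
    obtain ⟨t, r2, i1, i2, i3⟩ := ih e1
    refine ⟨t, (RunsIn.star_cons r1 r2).mono ?_, i1, by rw [i2, e2]; simp,
      fun k hk => by rw [i3 k hk, e3 k hk]⟩
    simp [enc]; omega

/-- The fraction `-1`. -/
def negOne : Quo := (true, [true], [true])

@[simp] theorem value_negOne : value negOne = -1 := by simp [value, negOne, numer, denom]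

/-- Push the last coordinate `-1` of the vector of variables. -/
def pushNegOne : Prog := push .G (.bit true) * (push .G (.bit true) * (push .G .comma *
  (push .G (.bit true) * push .G .comma)))

theorem isRegular_pushNegOne : pushNegOne.IsRegular :=
  (isRegular_push _ _).mul ((isRegular_push _ _).mul ((isRegular_push _ _).mul
    ((isRegular_push _ _).mul (isRegular_push _ _))))

theorem pushNegOne_sound {s t : Mem} (h : Runs pushNegOne s t) :
    t .G = (enc negOne).reverse ++ s .G ∧ ∀ k ∉ [Reg.G], t k = s k := by
  simp only [pushNegOne, runs_mul, runs_push, exists_eq_left] at h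
  subst h
  refine ⟨by simp [enc, negOne], fun k hk => ?_⟩
  simp only [List.mem_cons, List.not_mem_nil, or_false] at hk
  simp [hk]

theorem pushNegOne_complete (s : Mem) : ∃ t, RunsIn pushNegOne 5 s t :=
  ⟨_, (runsIn_push _ _).mul ((runsIn_push _ _).mul ((runsIn_push _ _).mul
    ((runsIn_push _ _).mul (runsIn_push _ _))))⟩

/-- Check that there is no type left. -/
def checkRows : Prog := pop .J .bra * push .J .bra + empty .J

theorem isRegular_checkRows : checkRows.IsRegular :=
  ((isRegular_pop _ _).mul (isRegular_push _ _)).add (isRegular_empty _)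

/-- Rows begin with a bracket and types are bits, so the top of `J` shows whether every variable has
received a value. -/
theorem checkRows_sound {s t : Mem} (h : Runs checkRows s t) :
    t = s ∧ ∀ b, (s .J).head? ≠ some (.bit b) := by
  rcases runs_add.1 h with h | h
  · obtain ⟨s1, h1, h2⟩ := runs_mul.1 h
    obtain ⟨l, hl, rfl⟩ := runs_pop.1 h1
    rw [runs_push] at h2
    subst h2
    refine ⟨?_, by simp [hl]⟩
    rw [Function.update_self, Function.update_idem, ← hl, Function.update_eq_self]
  · obtain ⟨h, rfl⟩ := runs_empty.1 h
    simp [h]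

theorem checkRows_complete {s : Mem} {rows : List (List Quo)} (hJ : s .J = rows.flatMap encRow) :
    ∃ t, RunsIn checkRows 2 s t := by
  cases rows with
  | nil => exact ⟨_, (runsIn_empty hJ).inr.mono (by simp)⟩
  | cons us rows => exact ⟨_, ((runsIn_pop hJ).mul (runsIn_push _ _)).inl⟩

/-! ### Verification of all inequalities and the complete program -/

theorem rows_sound {rows : List (List Quo)} {vs : List Quo} {s t : Mem}
    (hc : ∀ k ∈ rowScratch, s k = []) (hJ : s .J = rows.flatMap encRow)
    (hX : s .X = vs.flatMap enc) (hu : ∀ us ∈ rows, ∀ u ∈ us, 0 < denom u)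
    (hv : ∀ v ∈ vs, 0 < denom v) (h : Runs row∗ s t) (ht : t .J = []) :
    ∀ us ∈ rows, us.length = vs.length ∧ dot us vs ≤ 0 := by
  induction rows generalizing s with
  | nil => simp
  | cons us rows ih =>
    rcases runs_star_cases h with rfl | ⟨s1, h1, h2⟩
    · rw [hJ] at ht
      simp [encRow] at ht
    · rw [List.flatMap_cons] at hJ
      obtain ⟨e1, e2, e3, e4⟩ := row_sound hc hJ hX (hu us (by simp)) hv h1
      have := ih (s := s1) (fun k hk => by
        rw [e4 k, hc k hk]
        simp only [List.mem_cons, List.not_mem_nil, or_false] at hk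
        rcases hk with rfl | rfl | rfl | rfl | rfl | rfl | rfl | rfl | rfl | rfl | rfl | rfl <;>
          decide) e1 (by rw [e4 _ (by decide), hX]) (fun us hus => hu us (by simp [hus])) h2
      simpa [e2, e3] using this

theorem rows_complete {rows : List (List Quo)} {vs : List Quo} {s : Mem} {n : ℕ}
    (hc : ∀ k ∈ rowScratch, s k = []) (hJ : s .J = rows.flatMap encRow)
    (hX : s .X = vs.flatMap enc) (hu : ∀ us ∈ rows, ∀ u ∈ us, 0 < denom u)
    (hv : ∀ v ∈ vs, 0 < denom v) (hrows : ∀ us ∈ rows, us.length = vs.length ∧ dot us vs ≤ 0)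
    (nu : ∀ us ∈ rows, (us.flatMap enc).length < n) (nv : (vs.flatMap enc).length < n) :
    ∃ t, RunsIn row∗ (rows.length * (3000 * (6 * n + 1) ^ 3)) s t ∧ t .J = [] := by
  induction rows generalizing s with
  | nil => exact ⟨s, RunsIn.star_nil.mono (by simp), by simpa using hJ⟩
  | cons us rows ih =>
    rw [List.flatMap_cons] at hJ
    obtain ⟨l1, l2⟩ := hrows us (by simp)
    obtain ⟨s1, h1⟩ := row_complete hc hJ hX (hu us (by simp)) hv l1 l2 (nu us (by simp)) nv
    obtain ⟨e1, e2, e3, e4⟩ := row_sound hc hJ hX (hu us (by simp)) hv h1.runs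
    obtain ⟨t, h2, ht⟩ := ih (s := s1) (fun k hk => by
        rw [e4 k, hc k hk]
        simp only [List.mem_cons, List.not_mem_nil, or_false] at hk
        rcases hk with rfl | rfl | rfl | rfl | rfl | rfl | rfl | rfl | rfl | rfl | rfl | rfl <;>
          decide) e1 (by rw [e4 _ (by decide), hX]) (fun us hus => hu us (by simp [hus]))
        (fun us hus => hrows us (by simp [hus])) (fun us hus => nu us (by simp [hus]))
    exact ⟨t, (RunsIn.star_cons h1 h2).mono (by rw [List.length_cons]; linarith), ht⟩

/-- The verifier for mixed-integer feasibility. -/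
def main : Prog :=
  move .I .J * (gen∗ * (checkRows * (pushNegOne * (move .G .X * (row∗ * empty .J)))))

theorem isRegular_main : main.IsRegular :=
  (isRegular_move _ _).mul (isRegular_gen.kstar.mul (isRegular_checkRows.mul
    (isRegular_pushNegOne.mul ((isRegular_move _ _).mul (isRegular_row.kstar.mul
      (isRegular_empty _))))))

/-- The initial contents of the stacks. -/
def start (w : List Γ') : Mem := Function.update (fun _ => []) .I w.reverse

theorem head_encRows (rows : List (List Quo)) (b : Bool) :
    (rows.flatMap encRow).head? ≠ some (.bit b) := by
  cases rows <;> simp [encRow]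

theorem denom_negOne_pos {vs : List Quo} (h : ∀ v ∈ vs, 0 < denom v) :
    ∀ v ∈ vs ++ [negOne], 0 < denom v := by
  intro v hv
  rcases List.mem_append.1 hv with hv | hv
  · exact h v hv
  · rw [List.mem_singleton.1 hv]
    simp [denom, negOne]

/-- With the extra coordinate `-1` of the vector, `A x ≤ b` says that the scalar products with the
rows of `[A b]` are nonpositive. -/
theorem main_sound {tys : List Bool} {rows : List (List Quo)} {t : Mem}
    (hu : ∀ us ∈ rows, ∀ u ∈ us, 0 < denom u)
    (h : Runs main (start (tys.map .bit ++ rows.flatMap encRow)) t) :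
    ∃ vs, List.Forall₂ Fits tys vs ∧
      ∀ us ∈ rows, us.length = vs.length + 1 ∧ dot us (vs ++ [negOne]) ≤ 0 := by
  obtain ⟨s1, h1, h⟩ := runs_mul.1 h
  obtain ⟨s2, h2, h⟩ := runs_mul.1 h
  obtain ⟨s3, h3, h⟩ := runs_mul.1 h
  obtain ⟨s4, h4, h⟩ := runs_mul.1 h
  obtain ⟨s5, h5, h⟩ := runs_mul.1 h
  obtain ⟨s6, h6, h7⟩ := runs_mul.1 h
  obtain ⟨-, j1, o1⟩ := move_sound (by decide) h1
  obtain ⟨rfl, j2⟩ := checkRows_sound h3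
  obtain ⟨vs, hvs, j3, g3, o3⟩ := gens_sound (tys := tys) (rest := rows.flatMap encRow)
    (by rw [j1]; simp [start]) (head_encRows rows) h2 j2
  obtain ⟨g4, o4⟩ := pushNegOne_sound h4
  obtain ⟨g5, x5, o5⟩ := move_sound (by decide) h5
  obtain ⟨j7, rfl⟩ := runs_empty.1 h7
  have hv : ∀ v ∈ vs, 0 < denom v := by
    clear * - hvs
    induction hvs with
    | nil => simp
    | cons h _ ih => exact List.forall_mem_cons.2 ⟨h.1, ih⟩
  refine ⟨vs, hvs, fun us hus => ?_⟩
  have := rows_sound (vs := vs ++ [negOne]) (rows := rows) (s := s5) ?_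
    (by rw [o5 _ (by decide), o4 _ (by decide), j3]) ?_ hu (denom_negOne_pos hv) h6 j7 us hus
  · simpa using this
  · intro k hk
    by_cases hG : k = .G
    · rw [hG, g5]
    have : k ≠ .I ∧ k ≠ .J ∧ k ≠ .X ∧ k ≠ .Tr := by
      simp only [List.mem_cons, List.not_mem_nil, or_false] at hk
      rcases hk with rfl | rfl | rfl | rfl | rfl | rfl | rfl | rfl | rfl | rfl | rfl | rfl <;> simp
    rw [o5 _ (by simp [hG, this]), o4 _ (by simp [hG]), o3 _ (by simp [hG, this]),
      o1 _ (by simp [this]), start, Function.update_of_ne this.1]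
  · rw [x5, g4, g3, o4 _ (by decide), o3 _ (by decide), o1 _ (by decide), o1 _ (by decide)]
    simp [start]

/-- `n` exceeds the length of the input and that of the encoded vector. The cost is dominated by at
most `n` rows of cubic cost. -/
theorem main_complete {tys : List Bool} {rows : List (List Quo)} {vs : List Quo} {n : ℕ}
    (hu : ∀ us ∈ rows, ∀ u ∈ us, 0 < denom u)
    (hvs : List.Forall₂ (fun a u => ∃ d, u.2.2 = d ++ [true] ∧ (a = true → d = [])) tys vs)
    (hrows : ∀ us ∈ rows, us.length = vs.length + 1 ∧ dot us (vs ++ [negOne]) ≤ 0)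
    (hn : (tys.map Γ'.bit ++ rows.flatMap encRow).length < n)
    (nv : ((vs ++ [negOne]).flatMap enc).length < n) :
    ∃ t, RunsIn main (4000 * (6 * n + 1) ^ 4) (start (tys.map .bit ++ rows.flatMap encRow)) t := by
  obtain ⟨s1, h1⟩ := move_complete (a := .I) (b := .J) (by decide)
    (start (tys.map .bit ++ rows.flatMap encRow))
  obtain ⟨-, j1, o1⟩ := move_sound (by decide) h1.runs
  obtain ⟨s2, h2, j2, g2, o2⟩ := gens_complete (s := s1) (rest := rows.flatMap encRow)
    (by rw [j1]; simp [start]) hvs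
  obtain ⟨s3, h3⟩ := checkRows_complete j2
  obtain ⟨rfl, -⟩ := checkRows_sound h3.runs
  obtain ⟨s4, h4⟩ := pushNegOne_complete s3
  obtain ⟨g4, o4⟩ := pushNegOne_sound h4.runs
  obtain ⟨s5, h5⟩ := move_complete (a := .G) (b := .X) (by decide) s4
  obtain ⟨g5, x5, o5⟩ := move_sound (by decide) h5.runs
  have hv : ∀ v ∈ vs, 0 < denom v := by
    clear * - hvs
    induction hvs with
    | nil => simp
    | cons h _ ih =>
      obtain ⟨d, hd, -⟩ := h
      rw [List.forall_mem_cons]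
      exact ⟨by rw [denom, hd]; exact val_append_true_pos d, ih⟩
  have g4' : s4 .G = ((vs ++ [negOne]).flatMap enc).reverse := by
    rw [g4, g2, o1 _ (by decide)]
    simp [start]
  have lr : ∀ us ∈ rows, (us.flatMap enc).length < n ∧ rows.length ≤ n := by
    intro us hus
    rw [List.length_append] at hn
    have h1 : (encRow us).length ≤ (rows.flatMap encRow).length := by
      clear * - hus
      induction rows with
      | nil => simp at hus
      | cons r rows ih =>
        rw [List.flatMap_cons, List.length_append]
        rcases List.mem_cons.1 hus with rfl | h
        · omega
        · have := ih h; omega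
    have h2 : rows.length ≤ (rows.flatMap encRow).length := by
      clear * -
      induction rows with
      | nil => simp
      | cons r rows ih => simp [encRow]; omega
    simp only [encRow, List.length_cons, List.length_append, List.length_nil] at h1
    omega
  obtain ⟨s6, h6, j6⟩ := rows_complete (vs := vs ++ [negOne]) (rows := rows) (s := s5) (n := n) (by
      intro k hk
      by_cases hG : k = .G
      · rw [hG, g5]
      have : k ≠ .I ∧ k ≠ .J ∧ k ≠ .X ∧ k ≠ .Tr := by
        simp only [List.mem_cons, List.not_mem_nil, or_false] at hk
        rcases hk with rfl | rfl | rfl | rfl | rfl | rfl | rfl | rfl | rfl | rfl | rfl | rfl <;> simp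
      rw [o5 _ (by simp [hG, this]), o4 _ (by simp [hG]), o2 _ (by simp [hG, this]),
        o1 _ (by simp [this]), start, Function.update_of_ne this.1])
    (by rw [o5 _ (by decide), o4 _ (by decide), j2])
    (by
      rw [x5, g4', o4 _ (by decide), o2 _ (by decide), o1 _ (by decide)]
      simp [start]) hu (denom_negOne_pos hv) (fun us hus => by simpa using hrows us hus)
    (fun us hus => (lr us hus).1) nv
  have h7 := runsIn_empty j6
  refine ⟨_, (h1.mul (h2.mul (h3.mul (h4.mul (h5.mul (h6.mul h7)))))).mono ?_⟩
  have e1 : (start (tys.map .bit ++ rows.flatMap encRow) .I).length ≤ n := by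
    simp only [start, Function.update_self, List.length_reverse]
    exact hn.le
  have e2 : (s4 .G).length ≤ n := by rw [g4', List.length_reverse]; exact nv.le
  have e3 : (vs.flatMap enc).length ≤ n := by
    rw [List.flatMap_append, List.length_append] at nv
    omega
  have e4 : rows.length ≤ n := by
    rcases rows.eq_nil_or_concat with h | ⟨r, us, h⟩
    · simp [h]
    · exact (lr us (by simp [h])).2
  have e5 : rows.length * (3000 * (6 * n + 1) ^ 3) ≤ n * (3000 * (6 * n + 1) ^ 3) :=
    Nat.mul_le_mul_right _ e4
  have e6 : n * (3000 * (6 * n + 1) ^ 3) + 11 * n + 20 ≤ 4000 * (6 * n + 1) ^ 4 := by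
    clear * -
    have : 1 ≤ (6 * n + 1) ^ 3 := Nat.one_le_pow _ _ (by omega)
    rw [pow_succ (6 * n + 1) 3]
    nlinarith [Nat.zero_le n, Nat.mul_le_mul_left n this]
  linarith

end MIPVerifier

/-! ### Polyhedra given by linear functionals -/

namespace LinearSystem

variable {V τ : Type*} [AddCommGroup V] [Module ℝ V] (φ : τ → V →ₗ[ℝ] ℝ) (β : τ → ℝ)

/-- The solution set of a system of linear inequalities. -/
def sol : Set V := {x | ∀ i, φ i x ≤ β i}

/-- The kernel of the constraints that are tight at `x`. -/
def lineality (x : V) : Submodule ℝ V where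
  carrier := {d | ∀ i, φ i x = β i → φ i d = 0}
  add_mem' := fun ha hb i hi => by rw [map_add, ha i hi, hb i hi, add_zero]
  zero_mem' := fun i _ => map_zero _
  smul_mem' := fun c a ha i hi => by rw [map_smul, ha i hi, smul_zero]

variable {φ β}

theorem mem_lineality {x d : V} : d ∈ lineality φ β x ↔ ∀ i, φ i x = β i → φ i d = 0 := Iff.rfl

theorem convex_sol : Convex ℝ (sol φ β) := by
  intro x hx y hy a b ha hb hab i
  rw [map_add, map_smul, map_smul, smul_eq_mul, smul_eq_mul]
  calc a * φ i x + b * φ i y ≤ a * β i + b * β i :=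
        add_le_add (mul_le_mul_of_nonneg_left (hx i) ha) (mul_le_mul_of_nonneg_left (hy i) hb)
    _ = β i := by rw [← add_mul, hab, one_mul]

theorem add_mem_sol {x c : V} (hx : x ∈ sol φ β) (hc : c ∈ sol φ 0) : x + c ∈ sol φ β := by
  intro i
  rw [map_add]
  have := hx i
  have h2 : φ i c ≤ 0 := hc i
  linarith

theorem smul_mem_sol_zero {c : V} (hc : c ∈ sol φ 0) {t : ℝ} (ht : 0 ≤ t) : t • c ∈ sol φ 0 := by
  intro i
  rw [map_smul]
  exact mul_nonpos_of_nonneg_of_nonpos ht (hc i)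

theorem zero_mem_sol_zero : (0 : V) ∈ sol φ 0 := fun i => by simp

theorem sum_mem_sol_zero {κ : Type*} (S : Finset κ) {f : κ → V} (h : ∀ k ∈ S, f k ∈ sol φ 0) :
    ∑ k ∈ S, f k ∈ sol φ 0 := by
  classical
  induction S using Finset.induction_on with
  | empty => simpa using zero_mem_sol_zero
  | insert a S ha ih =>
    rw [Finset.sum_insert ha]
    exact add_mem_sol (h a (by simp)) (ih fun k hk => h k (by simp [hk]))

/-- Move from `x` in the direction `d` until a new constraint becomes tight. -/
theorem exists_move [Finite τ] {x d : V} (hx : x ∈ sol φ β) (hd : d ∈ lineality φ β x)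
    (hpos : ∃ i, 0 < φ i d) :
    ∃ t : ℝ, 0 ≤ t ∧ x + t • d ∈ sol φ β ∧ lineality φ β (x + t • d) ≤ lineality φ β x ∧
      d ∉ lineality φ β (x + t • d) := by
  -- Ratio test: `i` is a constraint that is reached first. It is tight at the new point but not
  -- constant along `d`, which removes `d` from the lineality space; the constraints tight at `x`
  -- stay tight because `φ j d = 0` for them.
  obtain ⟨i, hi, hmin⟩ := Set.exists_min_image {i | 0 < φ i d} (fun i => (β i - φ i x) / φ i d)
    (Set.toFinite _) hpos
  have hi : 0 < φ i d := hi
  have ht : 0 ≤ (β i - φ i x) / φ i d := div_nonneg (sub_nonneg.2 (hx i)) hi.le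
  refine ⟨_, ht, fun j => ?_, fun e he j hj => he j ?_, fun h => hi.ne' (h i ?_)⟩
  · rw [map_add, map_smul, smul_eq_mul]
    rcases lt_or_ge 0 (φ j d) with hj | hj
    · have := hmin j hj
      have := mul_le_mul_of_nonneg_right this hj.le
      rw [div_mul_cancel₀ _ hj.ne'] at this
      linarith
    · have := hx j
      have := mul_nonpos_of_nonneg_of_nonpos ht hj
      linarith
  · rw [map_add, map_smul, hd j hj, smul_zero, add_zero, hj]
  · rw [map_add, map_smul, smul_eq_mul, div_mul_cancel₀ _ hi.ne']
    ring

theorem lineality_lt {x d : V} {t : ℝ} (hd : d ∈ lineality φ β x)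
    (h1 : lineality φ β (x + t • d) ≤ lineality φ β x) (h2 : d ∉ lineality φ β (x + t • d)) :
    lineality φ β (x + t • d) < lineality φ β x :=
  lt_of_le_of_ne h1 fun h => h2 (h ▸ hd)

/-- The vertices of the solution set. -/
def vertices (φ : τ → V →ₗ[ℝ] ℝ) (β : τ → ℝ) : Set V := {v | v ∈ sol φ β ∧ lineality φ β v = ⊥}

theorem convexHull_vertices_subset : convexHull ℝ (vertices φ β) ⊆ sol φ β :=
  convexHull_min (fun _ h => h.1) convex_sol

theorem exists_pos_or_neg {d : V} (hinj : ∀ d, (∀ i, φ i d = 0) → d = 0) (hd : d ≠ 0) :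
    (∃ i, 0 < φ i d) ∨ ∃ i, 0 < φ i (-d) := by
  by_contra! h
  refine hd (hinj d fun i => le_antisymm (h.1 i) ?_)
  have := h.2 i
  rw [map_neg] at this
  linarith

/-- Induction on the dimension of the minimal face that contains `x`; its direction space is
`lineality φ β x`. Follow a direction of this space until a new constraint becomes tight: the
endpoint lies in a face of smaller dimension. -/
theorem exists_vertex_add_cone [Finite τ] [FiniteDimensional ℝ V]
    (hinj : ∀ d, (∀ i, φ i d = 0) → d = 0) {x : V} (hx : x ∈ sol φ β) :
    ∃ v ∈ convexHull ℝ (vertices φ β), ∃ c ∈ sol φ 0, x = v + c := by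
  induction hn : Module.finrank ℝ (lineality φ β x) using Nat.strong_induction_on generalizing x with
  | _ n ih =>
  by_cases hbot : lineality φ β x = ⊥
  · exact ⟨x, subset_convexHull _ _ ⟨hx, hbot⟩, 0, zero_mem_sol_zero, by simp⟩
  obtain ⟨d, hd, hd0, hdpos⟩ : ∃ d ∈ lineality φ β x, d ≠ 0 ∧ ∃ i, 0 < φ i d := by
    obtain ⟨d, hd, hd0⟩ := Submodule.exists_mem_ne_zero_of_ne_bot hbot
    rcases exists_pos_or_neg hinj hd0 with h | h
    · exact ⟨d, hd, hd0, h⟩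
    · exact ⟨-d, neg_mem hd, by simpa using hd0, h⟩
  obtain ⟨t, ht, h1, h2, h3⟩ := exists_move hx hd hdpos
  obtain ⟨v1, hv1, c1, hc1, e1⟩ := ih _
    (by rw [← hn]; exact Submodule.finrank_lt_finrank_of_lt (lineality_lt hd h2 h3)) h1 rfl
  -- If the line leaves the polyhedron on both sides, then `x` is a convex combination of the two
  -- endpoints. Otherwise `-d` belongs to the recession cone, and going back from the single
  -- endpoint to `x` adds an element of this cone.
  by_cases hneg : ∃ i, 0 < φ i (-d)
  · obtain ⟨s, hs, k1, k2, k3⟩ := exists_move hx (neg_mem hd) hneg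
    obtain ⟨v2, hv2, c2, hc2, e2⟩ := ih _ (by
      rw [← hn]
      exact Submodule.finrank_lt_finrank_of_lt (lineality_lt (neg_mem hd) k2 k3)) k1 rfl
    have hst : 0 < s + t := by
      rcases ht.eq_or_lt with rfl | ht
      · rw [zero_smul, add_zero] at h3
        exact absurd hd h3
      · linarith
    have ha : 0 ≤ s / (s + t) := by positivity
    have hb : 0 ≤ t / (s + t) := by positivity
    have hab : s / (s + t) + t / (s + t) = 1 := by rw [← add_div, div_self hst.ne']
    refine ⟨(s / (s + t)) • v1 + (t / (s + t)) • v2, convex_convexHull ℝ _ hv1 hv2 ha hb hab,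
      (s / (s + t)) • c1 + (t / (s + t)) • c2,
      add_mem_sol (smul_mem_sol_zero hc1 ha) (smul_mem_sol_zero hc2 hb), ?_⟩
    have : (s / (s + t)) • (x + t • d) + (t / (s + t)) • (x + s • -d) = x := by
      rw [smul_add, smul_add, smul_smul, smul_smul, smul_neg, add_add_add_comm, ← add_smul, hab,
        one_smul, div_mul_eq_mul_div, div_mul_eq_mul_div, mul_comm s t, add_neg_cancel, add_zero]
    rw [← this, e1, e2]
    module
  · push Not at hneg
    refine ⟨v1, hv1, c1 + t • -d, add_mem_sol hc1 (smul_mem_sol_zero (fun i => hneg i) ht), ?_⟩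
    rw [← add_assoc, ← e1]
    module

theorem nonempty_vertices [Finite τ] [FiniteDimensional ℝ V]
    (hinj : ∀ d, (∀ i, φ i d = 0) → d = 0) (hne : (sol φ β).Nonempty) :
    (vertices φ β).Nonempty := by
  obtain ⟨x, hx⟩ := hne
  obtain ⟨v, hv, -⟩ := exists_vertex_add_cone hinj hx
  exact convexHull_nonempty_iff.1 ⟨v, hv⟩

/-! ### Extreme rays of a pointed cone -/

/-- The nonzero vector `r` of the cone spans the kernel of the constraints that are tight at `r`. -/
def IsExtremal (φ : τ → V →ₗ[ℝ] ℝ) (r : V) : Prop :=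
  r ∈ sol φ 0 ∧ r ≠ 0 ∧ lineality φ 0 r ≤ Submodule.span ℝ {r}

theorem self_mem_lineality (r : V) : r ∈ lineality φ 0 r := fun _ h => h

theorem lineality_smul {r : V} {s : ℝ} (hs : s ≠ 0) :
    lineality φ 0 (s • r) = lineality φ 0 r := by
  ext d
  simp [mem_lineality, hs]

theorem IsExtremal.smul {r : V} (h : IsExtremal φ r) {s : ℝ} (hs : 0 < s) :
    IsExtremal φ (s • r) :=
  ⟨smul_mem_sol_zero h.1 hs.le, smul_ne_zero hs.ne' h.2.1, by
    rw [lineality_smul hs.ne', Submodule.span_singleton_smul_eq (IsUnit.mk0 s hs.ne')]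
    exact h.2.2⟩

theorem exists_neg {r : V} (hinj : ∀ d, (∀ i, φ i d = 0) → d = 0) (hr : r ∈ sol φ 0)
    (h0 : r ≠ 0) : ∃ i, φ i r < 0 := by
  by_contra! h
  exact h0 (hinj r fun i => le_antisymm (hr i) (h i))

/-- Where a constraint vanishes at `r`, it vanishes at both summands, being nonpositive at each. So
`x` lies in the lineality space of `r`, which is the line of `r`; pointedness excludes a negative
multiple. -/
theorem IsExtremal.eq_smul {r x y : V} (hinj : ∀ d, (∀ i, φ i d = 0) → d = 0)
    (hr : IsExtremal φ r) (hx : x ∈ sol φ 0) (hy : y ∈ sol φ 0) (hxy : x + y = r) :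
    ∃ t : ℝ, 0 ≤ t ∧ x = t • r := by
  have : x ∈ lineality φ 0 r := by
    intro i hi
    rw [← hxy, map_add] at hi
    have h1 : φ i x ≤ 0 := hx i
    have h2 : φ i y ≤ 0 := hy i
    simp only [Pi.zero_apply] at hi
    linarith
  obtain ⟨t, rfl⟩ := Submodule.mem_span_singleton.1 (hr.2.2 this)
  refine ⟨t, ?_, rfl⟩
  obtain ⟨i, hi⟩ := exists_neg hinj hr.1 hr.2.1
  have h1 : φ i (t • r) ≤ 0 := hx i
  rw [map_smul, smul_eq_mul] at h1
  by_contra! h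
  have := mul_pos_of_neg_of_neg h hi
  linarith

/-- Descend to smaller faces of the cone. As long as the minimal face of `c` has a direction off the
line of `c`, moving along it makes a further constraint tight, and the endpoint is nonzero because
the direction is not a multiple of `c`. -/
theorem exists_isExtremal [Finite τ] [FiniteDimensional ℝ V]
    (hinj : ∀ d, (∀ i, φ i d = 0) → d = 0) {c : V} (hc : c ∈ sol φ 0) (h0 : c ≠ 0) :
    ∃ r, IsExtremal φ r ∧ lineality φ 0 r ≤ lineality φ 0 c := by
  induction hn : Module.finrank ℝ (lineality φ 0 c) using Nat.strong_induction_on generalizing c with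
  | _ n ih =>
  by_cases hle : lineality φ 0 c ≤ Submodule.span ℝ {c}
  · exact ⟨c, ⟨hc, h0, hle⟩, le_rfl⟩
  obtain ⟨d, hd, hdc⟩ := SetLike.not_le_iff_exists.1 hle
  have hd0 : d ≠ 0 := by
    rintro rfl
    exact hdc (zero_mem _)
  obtain ⟨d, hd, hdc, hpos⟩ : ∃ d ∈ lineality φ 0 c, d ∉ Submodule.span ℝ {c} ∧
      ∃ i, 0 < φ i d := by
    rcases exists_pos_or_neg hinj hd0 with h | h
    · exact ⟨d, hd, hdc, h⟩
    · exact ⟨-d, neg_mem hd, by rwa [neg_mem_iff], h⟩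
  obtain ⟨t, ht, h1, h2, h3⟩ := exists_move hc hd hpos
  have hne : c + t • d ≠ 0 := by
    intro h
    rcases ht.eq_or_lt with rfl | ht
    · exact h0 (by simpa using h)
    · refine hdc (Submodule.mem_span_singleton.2 ⟨-t⁻¹, ?_⟩)
      rw [eq_neg_of_add_eq_zero_left h, smul_neg, neg_smul, neg_neg, smul_smul,
        inv_mul_cancel₀ ht.ne', one_smul]
  obtain ⟨r, hr, hrc⟩ := ih _
    (by rw [← hn]; exact Submodule.finrank_lt_finrank_of_lt (lineality_lt hd h2 h3)) h1 hne rfl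
  exact ⟨r, hr, hrc.trans h2⟩

/-- Every vector of a pointed cone is a nonnegative combination of linearly independent extremal
vectors, taken from a set of representatives. -/
theorem exists_nonneg_combination [Finite τ] [FiniteDimensional ℝ V]
    (hinj : ∀ d, (∀ i, φ i d = 0) → d = 0) {E : Set V}
    (hE : ∀ r, IsExtremal φ r → ∃ s : ℝ, 0 < s ∧ s • r ∈ E) {c : V} (hc : c ∈ sol φ 0) :
    ∃ (S : Finset V) (l : V → ℝ), (∀ e ∈ S, e ∈ E ∧ e ∈ lineality φ 0 c) ∧
      LinearIndepOn ℝ id (S : Set V) ∧ (∀ e, 0 ≤ l e) ∧ c = ∑ e ∈ S, l e • e := by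
  classical
  induction hn : Module.finrank ℝ (lineality φ 0 c) using Nat.strong_induction_on generalizing c with
  | _ n ih =>
  by_cases h0 : c = 0
  · exact ⟨∅, 0, by simp, by simp, by simp, by simp [h0]⟩
  obtain ⟨r, hr, hrc⟩ := exists_isExtremal hinj hc h0
  obtain ⟨s, hs, he⟩ := hE r hr
  set e := s • r with hedef
  have hre := hr.smul hs
  have hec : -e ∈ lineality φ 0 c :=
    neg_mem (hrc (Submodule.smul_mem _ _ (self_mem_lineality r)))
  obtain ⟨i, hi⟩ := exists_neg hinj hre.1 hre.2.1
  -- Subtract from `c` the largest multiple of `e` for which the rest stays in the cone.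
  obtain ⟨t, ht, h1, h2, h3⟩ := exists_move hc hec ⟨i, by rw [map_neg]; linarith⟩
  obtain ⟨S, l, hS, hli, hl, hsum⟩ := ih _
    (by rw [← hn]; exact Submodule.finrank_lt_finrank_of_lt (lineality_lt hec h2 h3)) h1 rfl
  -- Independence comes for free: all vectors used for the rest lie in its lineality space, and `e`
  -- has just left that space.
  have heS : e ∉ Submodule.span ℝ (id '' (S : Set V)) := by
    intro h
    refine h3 (neg_mem ((Submodule.span_le.2 ?_) h))
    rintro _ ⟨a, ha, rfl⟩
    exact (hS a ha).2
  have heS' : e ∉ S := fun h => heS (Submodule.subset_span ⟨e, h, rfl⟩)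
  refine ⟨insert e S, Function.update l e t, ?_, ?_, fun a => ?_, ?_⟩
  · intro a ha
    rcases Finset.mem_insert.1 ha with rfl | ha
    · exact ⟨he, by simpa using neg_mem hec⟩
    · exact ⟨(hS a ha).1, h2 (hS a ha).2⟩
  · rw [Finset.coe_insert]
    exact hli.insert heS
  · by_cases h : a = e
    · rw [h, Function.update_self]; exact ht
    · rw [Function.update_of_ne h]; exact hl a
  · rw [Finset.sum_insert heS', Function.update_self]
    have : ∑ a ∈ S, Function.update l e t a • a = ∑ a ∈ S, l a • a :=
      Finset.sum_congr rfl fun a ha => by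
        rw [Function.update_of_ne (ne_of_mem_of_not_mem ha heS')]
    rw [this, ← hsum]
    module

end LinearSystem

/-! ### Cramer's rule and bounds for the vertices and the rays of a polyhedron -/

open Matrix in
/-- A real matrix with independent columns has an invertible square submatrix with the same
number of columns. -/
theorem exists_isUnit_submatrix {τ ι : Type*} [Finite τ] [Fintype ι] [DecidableEq ι]
    (A : Matrix τ ι ℝ) (hA : ∀ d : ι → ℝ, (∀ t, ∑ j, A t j * d j = 0) → d = 0) :
    ∃ f : ι → τ, IsUnit (A.submatrix f id) := by
  have := Fintype.ofFinite τ
  have hinj : Function.Injective A.mulVecLin := by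
    rw [← LinearMap.ker_eq_bot, LinearMap.ker_eq_bot']
    exact fun d hd => hA d fun t => congrFun hd t
  -- Row rank equals column rank, so the rows span the whole space; a basis chosen among them is the
  -- submatrix.
  have hspan : Submodule.span ℝ (Set.range A.row) = ⊤ := by
    apply Submodule.eq_top_of_finrank_eq
    rw [← Matrix.rank_eq_finrank_span_row, Matrix.rank, LinearMap.finrank_range_of_inj hinj]
  obtain ⟨b, hb, hbs, hbl⟩ := exists_linearIndependent ℝ (Set.range A.row)
  rw [hspan] at hbs
  let B := Module.Basis.mk hbl (by rw [Subtype.range_coe, hbs])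
  have : Fintype b := FiniteDimensional.fintypeBasisIndex B
  have hcard : Fintype.card ι = Fintype.card b := by
    rw [← Module.finrank_eq_card_basis B, Module.finrank_fintype_fun_eq_card]
  let e := Fintype.equivOfCardEq hcard
  choose f hf using fun x : b => hb x.2
  refine ⟨f ∘ e, ?_⟩
  rw [← Matrix.linearIndependent_rows_iff_isUnit]
  have : (A.submatrix (f ∘ e) id).row = fun i => ((e i : b) : ι → ℝ) := by
    funext i
    exact hf (e i)
  rw [this]
  exact hbl.comp e e.injective

open Matrix in
/-- The unique solution of an integer linear system is a vector of fractions with a small common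
denominator and small numerators. -/
theorem exists_small_solution {τ ι : Type*} [Finite τ] [Fintype ι] (w : τ → ι → ℤ) (β : τ → ℤ)
    {N : ℤ} (hw : ∀ t j, |w t j| ≤ N) (hβ : ∀ t, |β t| ≤ N) {x : ι → ℝ}
    (hx : ∀ t, ∑ j, (w t j : ℝ) * x j = β t)
    (huniq : ∀ d : ι → ℝ, (∀ t, ∑ j, (w t j : ℝ) * d j = 0) → d = 0) :
    ∃ (D : ℤ) (u : ι → ℤ), 0 < D ∧ D ≤ (Fintype.card ι).factorial * N ^ Fintype.card ι ∧
      ∀ j, D * x j = u j ∧ |u j| ≤ (Fintype.card ι).factorial * N ^ Fintype.card ι := by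
  classical
  obtain ⟨f, hf⟩ := exists_isUnit_submatrix (fun t j => (w t j : ℝ)) huniq
  let M : Matrix ι ι ℤ := fun i j => w (f i) j
  let c : ι → ℤ := fun i => β (f i)
  have hM : (M.map (Int.cast : ℤ → ℝ)).det ≠ 0 := by
    have := (Matrix.isUnit_iff_isUnit_det _).1 hf
    exact this.ne_zero
  have hdet : M.det ≠ 0 := by
    intro h
    apply hM
    have := Int.cast_det (R := ℝ) M
    rw [h] at this
    simpa using this.symm
  have hsol : (M.map (Int.cast : ℤ → ℝ)) *ᵥ x = fun i => (c i : ℝ) := by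
    funext i
    exact hx (f i)
  have hcr : ∀ j, (M.det : ℝ) * x j = (M.cramer c j : ℤ) := by
    intro j
    have h1 : (M.map (Int.cast : ℤ → ℝ)).adjugate *ᵥ ((M.map (Int.cast : ℤ → ℝ)) *ᵥ x) =
        (M.det : ℝ) • x := by
      rw [Matrix.mulVec_mulVec, Matrix.adjugate_mul, Matrix.smul_mulVec, Matrix.one_mulVec,
        Int.cast_det]
    have h2 : (M.map (Int.cast : ℤ → ℝ)).adjugate = M.adjugate.map (Int.cast : ℤ → ℝ) :=
      ((Int.castRingHom ℝ).map_adjugate M).symm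
    rw [hsol, h2] at h1
    have := congrFun h1 j
    rw [Pi.smul_apply, smul_eq_mul] at this
    rw [← this, Matrix.cramer_eq_adjugate_mulVec]
    simp [Matrix.mulVec, dotProduct]
  -- Leibniz expansion: `n!` terms, each at most `N ^ n` in absolute value, where `n` is the number
  -- of columns.
  have hbd : ∀ K : Matrix ι ι ℤ, (∀ i j, |K i j| ≤ N) →
      |K.det| ≤ (Fintype.card ι).factorial * N ^ Fintype.card ι := by
    intro K hK
    have := Matrix.det_le (A := K) (abv := AbsoluteValue.abs) (x := N) hK
    simpa using this
  have hcb : ∀ j, |M.cramer c j| ≤ (Fintype.card ι).factorial * N ^ Fintype.card ι := by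
    intro j
    rw [Matrix.cramer_apply]
    refine hbd _ fun i k => ?_
    by_cases hk : k = j
    · subst hk
      rw [Matrix.updateCol_self]
      exact hβ _
    · rw [Matrix.updateCol_ne hk]
      exact hw _ _
  -- The sign of the determinant is moved to the numerators to make the common denominator positive.
  refine ⟨|M.det|, fun j => SignType.sign M.det * M.cramer c j, abs_pos.2 hdet,
    hbd _ fun i j => hw _ _, fun j => ⟨?_, ?_⟩⟩
  · rcases hdet.lt_or_gt with h | h
    · rw [abs_of_neg h, sign_neg h]
      rw [Int.cast_neg, Int.cast_mul, neg_mul, hcr]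
      simp
    · rw [abs_of_pos h, sign_pos h]
      rw [Int.cast_mul, hcr]
      simp
  · rcases hdet.lt_or_gt with h | h
    · simpa [sign_neg h] using hcb j
    · simpa [sign_pos h] using hcb j

/-! ### Size bounds for vertices and extreme rays -/

/-- The linear functional with coefficients `a`. -/
def rowMap {ι : Type*} [Fintype ι] (a : ι → ℝ) : (ι → ℝ) →ₗ[ℝ] ℝ := ∑ j, a j • LinearMap.proj j

theorem rowMap_apply {ι : Type*} [Fintype ι] (a x : ι → ℝ) : rowMap a x = ∑ j, a j * x j := by
  simp [rowMap]

namespace LinearSystem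

variable {τ ι : Type*} [Finite τ] [Fintype ι] {w : τ → ι → ℤ} {β : τ → ℤ} {N : ℤ}

/-- The bound for numerators and denominators from Cramer's rule. -/
def cramerBound (ι : Type*) [Fintype ι] (N : ℤ) : ℤ :=
  (Fintype.card ι).factorial * N ^ Fintype.card ι

/-- The constraints that are tight at a vertex, read as equations, have the vertex as their unique
solution. -/
theorem exists_small_vertex (hw : ∀ t j, |w t j| ≤ N) (hβ : ∀ t, |β t| ≤ N) {v : ι → ℝ}
    (hv : v ∈ vertices (fun t => rowMap fun j => (w t j : ℝ)) fun t => (β t : ℝ)) :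
    ∃ (D : ℤ) (u : ι → ℤ), 0 < D ∧ D ≤ cramerBound ι N ∧
      ∀ j, D * v j = u j ∧ |u j| ≤ cramerBound ι N := by
  refine exists_small_solution (τ := {t // rowMap (fun j => (w t j : ℝ)) v = β t})
    (fun t => w t) (fun t => β t) (fun t => hw t) (fun t => hβ t)
    (fun t => by rw [← rowMap_apply]; exact t.2) fun d hd => ?_
  have : d ∈ lineality (fun t => rowMap fun j => (w t j : ℝ)) (fun t => (β t : ℝ)) v := by
    intro t ht
    rw [rowMap_apply]
    exact hd ⟨t, ht⟩
  rw [hv.2] at this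
  simpa using this

theorem abs_le_of_mem_vertices (hw : ∀ t j, |w t j| ≤ N) (hβ : ∀ t, |β t| ≤ N) {v : ι → ℝ}
    (hv : v ∈ vertices (fun t => rowMap fun j => (w t j : ℝ)) fun t => (β t : ℝ)) (j : ι) :
    |v j| ≤ cramerBound ι N := by
  obtain ⟨D, u, h0, -, h⟩ := exists_small_vertex hw hβ hv
  obtain ⟨h1, h2⟩ := h j
  have hD : (1 : ℝ) ≤ D := by exact_mod_cast h0
  calc |v j| ≤ D * |v j| := le_mul_of_one_le_left (abs_nonneg _) hD
    _ = |(D : ℝ) * v j| := by rw [abs_mul, abs_of_nonneg (by linarith : (0 : ℝ) ≤ D)]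
    _ = |(u j : ℝ)| := by rw [h1]
    _ ≤ _ := by exact_mod_cast h2

theorem abs_le_of_mem_convexHull (hw : ∀ t j, |w t j| ≤ N) (hβ : ∀ t, |β t| ≤ N) {v : ι → ℝ}
    (hv : v ∈ convexHull ℝ
      (vertices (fun t => rowMap fun j => (w t j : ℝ)) fun t => (β t : ℝ))) (j : ι) :
    |v j| ≤ cramerBound ι N := by
  have hconv : Convex ℝ {x : ι → ℝ | |x j| ≤ cramerBound ι N} := by
    have : {x : ι → ℝ | |x j| ≤ cramerBound ι N} =
        (LinearMap.proj j : (ι → ℝ) →ₗ[ℝ] ℝ) ⁻¹' Set.Icc (-(cramerBound ι N : ℝ)) (cramerBound ι N) := by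
      ext x
      simp [abs_le]
    rw [this]
    exact (convex_Icc _ _).linear_preimage _
  exact convexHull_min (fun x hx => abs_le_of_mem_vertices hw hβ hx j) hconv hv

/-- The constraints tight at `r` determine only the line of `r`. Scale a nonzero coordinate to `±1`
and add this value as an equation: now the solution is unique, and multiplication by its common
denominator gives an integral generator. -/
theorem exists_small_isExtremal (hw : ∀ t j, |w t j| ≤ N) (hN : 1 ≤ N) {r : ι → ℝ}
    (hr : IsExtremal (fun t => rowMap fun j => (w t j : ℝ)) r) :
    ∃ (s : ℝ) (u : ι → ℤ), 0 < s ∧ ∀ j, s * r j = u j ∧ |u j| ≤ cramerBound ι N := by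
  classical
  obtain ⟨k, hk⟩ := Function.ne_iff.1 hr.2.1
  simp only [Pi.zero_apply] at hk
  have hk' : 0 < |r k|⁻¹ := inv_pos.2 (abs_pos.2 hk)
  have hr' := hr.smul hk'
  set c := |r k|⁻¹ • r with hc
  obtain ⟨ε, hε, hε1⟩ : ∃ ε : ℤ, c k = ε ∧ |ε| = 1 := by
    simp only [hc, Pi.smul_apply, smul_eq_mul]
    rcases hk.lt_or_gt with h | h
    · exact ⟨-1, by rw [abs_of_neg h]; push_cast; field_simp, by simp⟩
    · exact ⟨1, by rw [abs_of_pos h]; push_cast; field_simp, by simp⟩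
  have hck : c k ≠ 0 := by
    rw [hε]
    intro h
    have : ε = 0 := by exact_mod_cast h
    simp [this] at hε1
  obtain ⟨D, u, h0, -, h⟩ := exists_small_solution
    (τ := Option {t // rowMap (fun j => (w t j : ℝ)) c = 0})
    (fun t => t.elim (Pi.single k 1) fun t => w t) (fun t => t.elim ε fun _ => 0) (N := N) (x := c)
    (by
      rintro (_ | t) j
      · by_cases hj : j = k
        · subst hj; simpa using hN
        · simp only [Option.elim_none, Pi.single_eq_of_ne hj, abs_zero]; omega
      · exact hw t j)
    (by
      rintro (_ | t)
      · simpa [hε1] using hN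
      · simp only [Option.elim_some, abs_zero]; omega)
    (by
      rintro (_ | t)
      · simp [Pi.single_apply, hε]
      · have := t.2
        rw [rowMap_apply] at this
        simpa using this)
    (by
      intro d hd
      have hdl : d ∈ lineality (fun t => rowMap fun j => (w t j : ℝ)) 0 c := by
        intro t ht
        rw [rowMap_apply]
        exact hd (some ⟨t, ht⟩)
      obtain ⟨a, rfl⟩ := Submodule.mem_span_singleton.1 (hr'.2.2 hdl)
      have := hd none
      simp only [Option.elim_none, Pi.single_apply, Int.cast_ite, Int.cast_one, Int.cast_zero,
        Pi.smul_apply, smul_eq_mul, ite_mul, one_mul, zero_mul, Finset.sum_ite_eq',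
        Finset.mem_univ, if_true, mul_eq_zero, hck, or_false] at this
      simp [this])
  refine ⟨D * |r k|⁻¹, u, mul_pos (by exact_mod_cast h0) hk', fun j => ⟨?_, (h j).2⟩⟩
  rw [← (h j).1, hc, Pi.smul_apply, smul_eq_mul, mul_assoc]

end LinearSystem

/-! ### Simple cones -/

theorem exists_polyhedron_eq {ι κ : Type*} [Fintype ι] [Finite κ] (ψ : κ → (ι → ℝ) →ₗ[ℝ] ℝ) :
    ∃ (m : ℕ) (A : Matrix (Fin m) ι ℝ), {x | ∀ k, ψ k x ≤ 0} = polyhedron A 0 := by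
  classical
  obtain ⟨m, ⟨e⟩⟩ := Finite.exists_equiv_fin κ
  refine ⟨m, fun i j => ψ (e.symm i) (Pi.single j 1), ?_⟩
  ext x
  have key : ∀ k, ∑ j, ψ k (Pi.single j 1) * x j = ψ k x := by
    intro k
    conv_rhs => rw [← Finset.univ_sum_single x, map_sum]
    refine Finset.sum_congr rfl fun j _ => ?_
    rw [mul_comm, ← smul_eq_mul, ← map_smul, ← Pi.single_smul, smul_eq_mul, mul_one]
  simp only [polyhedron, Set.mem_ofPred_eq, key, Pi.zero_apply]
  exact ⟨fun h i => h _, fun h k => by simpa using h (e k)⟩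

/-- The conic hull of a family of vectors. -/
def familyCone {ι κ : Type*} [Fintype κ] (v : κ → ι → ℝ) : Set (ι → ℝ) :=
  {x | ∃ c : κ → ℝ, (∀ k, 0 ≤ c k) ∧ x = ∑ k, c k • v k}

section FamilyCone

variable {ι κ : Type*} [Fintype κ] {v : κ → ι → ℝ}

theorem mem_familyCone_self (k : κ) : v k ∈ familyCone v := by
  classical
  exact ⟨Pi.single k 1, fun j => by rw [Pi.single_apply]; split_ifs <;> simp, by
    simp [Pi.single_apply]⟩

theorem zero_mem_familyCone : (0 : ι → ℝ) ∈ familyCone v := ⟨0, by simp, by simp⟩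

theorem smul_mem_familyCone {x : ι → ℝ} (hx : x ∈ familyCone v) {t : ℝ} (ht : 0 ≤ t) :
    t • x ∈ familyCone v := by
  obtain ⟨c, hc, rfl⟩ := hx
  exact ⟨fun k => t * c k, fun k => mul_nonneg ht (hc k), by simp [Finset.smul_sum, smul_smul]⟩

theorem mem_halfLine_self (r : ι → ℝ) : r ∈ halfLine r := ⟨1, by simp, by simp⟩

theorem halfLine_smul (r : ι → ℝ) {t : ℝ} (ht : 0 < t) : halfLine (t • r) = halfLine r := by
  ext x
  constructor
  · rintro ⟨s, hs, rfl⟩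
    exact ⟨s * t, by positivity, by rw [smul_smul]⟩
  · rintro ⟨s, hs, rfl⟩
    exact ⟨s / t, by positivity, by rw [smul_smul, div_mul_cancel₀ _ ht.ne']⟩

/-- `f` is a left inverse of the map that forms linear combinations, and `g` lists the coordinates
of the residual of `x`. Thus `g = 0` describes the span, and together with `f ≥ 0` the cone. -/
theorem exists_coordinates [Fintype ι] (hv : LinearIndependent ℝ v) :
    ∃ (σ : Type) (_ : Finite σ) (f : κ → (ι → ℝ) →ₗ[ℝ] ℝ) (g : σ → (ι → ℝ) →ₗ[ℝ] ℝ),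
      (∀ c : κ → ℝ, ∀ k, f k (∑ k, c k • v k) = c k) ∧ (∀ c : κ → ℝ, ∀ k, g k (∑ k, c k • v k) = 0) ∧
      ∀ x, (∀ k, g k x = 0) → x = ∑ k, f k x • v k := by
  classical
  obtain ⟨l, hl⟩ := (Fintype.linearCombination ℝ v).exists_leftInverse_of_injective
    (LinearMap.ker_eq_bot.2 (linearIndependent_iff_injective_fintypeLinearCombination.1 hv))
  have hl' : ∀ c : κ → ℝ, l (∑ k, c k • v k) = c := by
    intro c
    have := LinearMap.congr_fun hl c
    simpa [Fintype.linearCombination_apply] using this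
  let P : (ι → ℝ) →ₗ[ℝ] (ι → ℝ) := LinearMap.id - Fintype.linearCombination ℝ v ∘ₗ l
  have hP : ∀ x, P x = x - ∑ k, l x k • v k := by
    intro x
    simp [P, Fintype.linearCombination_apply]
  obtain ⟨m, ⟨e⟩⟩ := Finite.exists_equiv_fin ι
  refine ⟨Fin m, inferInstance, fun k => LinearMap.proj k ∘ₗ l, fun i =>
    LinearMap.proj (e.symm i) ∘ₗ P, fun c k => ?_, fun c i => ?_, fun x hx => ?_⟩
  · simp only [LinearMap.comp_apply, LinearMap.proj_apply, hl']
  · simp only [LinearMap.comp_apply, LinearMap.proj_apply, hP, hl', sub_self, Pi.zero_apply]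
  · have : P x = 0 := by
      funext i
      simpa using hx (e i)
    rw [hP, sub_eq_zero] at this
    simpa using this

/-- Coefficients are unique by independence. Those of two summands of `v k` are nonnegative and add
up to zero away from `k`, so they vanish there. -/
theorem generatesExtremeRay_familyCone (hv : LinearIndependent ℝ v) (k : κ) :
    GeneratesExtremeRay (familyCone v) (v k) := by
  classical
  refine ⟨mem_familyCone_self k, hv.ne_zero k, ?_⟩
  rintro _ ⟨c, hc, rfl⟩ _ ⟨d, hd, rfl⟩ h
  have hcd : ∀ j, j ≠ k → c j = 0 ∧ d j = 0 := by
    have h' : ∑ j, (c j + d j) • v j = ∑ j, (Pi.single k 1 : κ → ℝ) j • v j := by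
      simp only [add_smul, Finset.sum_add_distrib, h]
      simp [Pi.single_apply]
    have hinj := linearIndependent_iff_injective_fintypeLinearCombination.1 hv
    have h2 : (fun j => c j + d j) = (Pi.single k 1 : κ → ℝ) :=
      hinj (by simpa [Fintype.linearCombination_apply] using h')
    intro j hj
    have := congrFun h2 j
    simp only [Pi.single_eq_of_ne hj] at this
    have := hc j
    have := hd j
    constructor <;> linarith
  constructor
  · refine ⟨c k, hc k, Finset.sum_eq_single k (fun j _ hj => ?_) (by simp)⟩
    rw [(hcd j hj).1, zero_smul]
  · refine ⟨d k, hd k, Finset.sum_eq_single k (fun j _ hj => ?_) (by simp)⟩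
    rw [(hcd j hj).2, zero_smul]

/-- If `c k` is a positive coefficient of the generator `r` of an extreme ray, then `c k • v k` is a
summand of `r` in the cone; extremality puts it on the ray of `r`. -/
theorem extremeRays_familyCone (hv : LinearIndependent ℝ v) :
    extremeRays (familyCone v) = Set.range fun k => halfLine (v k) := by
  classical
  ext L
  constructor
  · rintro ⟨r, ⟨⟨c, hc, hr⟩, hr0, hext⟩, rfl⟩
    obtain ⟨k, hk⟩ : ∃ k, c k ≠ 0 := by
      by_contra! h
      exact hr0 (by rw [hr]; simp [h])
    have hk : 0 < c k := lt_of_le_of_ne (hc k) hk.symm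
    obtain ⟨⟨t, ht, e⟩, -⟩ := hext (c k • v k)
      (smul_mem_familyCone (mem_familyCone_self k) hk.le)
      (∑ j, (if j = k then 0 else c j) • v j)
      ⟨_, fun j => by split_ifs; exacts [le_rfl, hc j], rfl⟩ (by
        rw [hr, ← Finset.add_sum_erase _ _ (Finset.mem_univ k),
          ← Finset.add_sum_erase _ (fun j => c j • v j) (Finset.mem_univ k)]
        simp only [if_true, zero_smul, zero_add]
        congr 1
        exact Finset.sum_congr rfl fun j hj => by rw [if_neg (Finset.ne_of_mem_erase hj)])
    have ht0 : 0 < t := by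
      refine lt_of_le_of_ne ht ?_
      rintro rfl
      rw [zero_smul] at e
      exact (smul_ne_zero hk.ne' (hv.ne_zero k)) e
    exact ⟨k, by dsimp only; rw [← halfLine_smul (v k) hk, e, halfLine_smul r ht0]⟩
  · rintro ⟨k, rfl⟩
    exact ⟨v k, generatesExtremeRay_familyCone hv k, rfl⟩

/-- In the coordinates above the cone is `f ≥ 0`, `g = 0`, a pointed polyhedron. The vectors lie on
distinct rays and are a basis of the span, so the number of rays and the dimension are both the
number of vectors. -/
theorem isSimpleCone_familyCone [Fintype ι] (hv : LinearIndependent ℝ v) : IsSimpleCone (familyCone v) := by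
  classical
  obtain ⟨σ, hσ, f, g, hf, hg, hx⟩ := exists_coordinates hv
  have hmem : ∀ x, x ∈ familyCone v ↔ (∀ k, 0 ≤ f k x) ∧ ∀ k, g k x = 0 := by
    intro x
    constructor
    · rintro ⟨c, hc, rfl⟩
      exact ⟨fun k => by rw [hf]; exact hc k, fun k => hg c k⟩
    · rintro ⟨h1, h2⟩
      exact ⟨_, h1, hx x h2⟩
  refine ⟨?_, ?_, ?_, ?_⟩
  · obtain ⟨m, A, h⟩ := exists_polyhedron_eq (κ := κ ⊕ (σ ⊕ σ))
      (Sum.elim (fun k => -f k) (Sum.elim g fun k => -g k))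
    refine ⟨m, A, ?_⟩
    rw [← h]
    ext x
    rw [hmem]
    simp only [Set.mem_ofPred_eq, Sum.forall, Sum.elim_inl, Sum.elim_inr, LinearMap.neg_apply,
      Left.neg_nonpos_iff]
    refine and_congr_right fun _ => ⟨fun h => ⟨fun k => (h k).le, fun k => (h k).ge⟩,
      fun h k => le_antisymm (h.1 k) (h.2 k)⟩
  · intro x hx' w hw
    have hcone : ∀ c : ℝ, ∀ a : ℝ, (∀ t : ℝ, 0 ≤ a + t * c) → c = 0 := by
      intro c a h
      by_contra hc
      have := h (-(a + 1) / c)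
      rw [div_mul_cancel₀ _ hc] at this
      linarith
    have hw2 : ∀ k, g k w = 0 := by
      intro k
      have h1 := ((hmem _).1 (hw 1)).2 k
      have h2 := ((hmem _).1 hx').2 k
      rw [map_add, h2, one_smul, zero_add] at h1
      exact h1
    rw [hx w hw2]
    refine Finset.sum_eq_zero fun k _ => ?_
    rw [hcone (f k w) (f k x) fun t => ?_, zero_smul]
    have := ((hmem _).1 (hw t)).1 k
    rwa [map_add, map_smul, smul_eq_mul] at this
  · rw [extremeRays_familyCone hv]
    exact Set.finite_range _
  · have hinj : Function.Injective fun k => halfLine (v k) := by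
      intro k j h
      have : v k ∈ halfLine (v j) := by
        have := mem_halfLine_self (v k)
        rwa [show halfLine (v k) = halfLine (v j) from h] at this
      obtain ⟨t, ht, e⟩ := this
      by_contra hkj
      refine hv.notMem_span_image (s := {j}) (x := k) (by simpa using hkj) ?_
      rw [Set.image_singleton, e]
      exact Submodule.smul_mem _ _ (Submodule.mem_span_singleton_self _)
    have hspan : vectorSpan ℝ (familyCone v) = Submodule.span ℝ (Set.range v) := by
      rw [vectorSpan_eq_span_vsub_set_right ℝ zero_mem_familyCone]
      simp only [vsub_eq_sub, sub_zero, Set.image_id']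
      refine le_antisymm (Submodule.span_le.2 ?_) (Submodule.span_mono ?_)
      · rintro _ ⟨c, -, rfl⟩
        exact Submodule.sum_mem _ fun k _ => Submodule.smul_mem _ _ (Submodule.subset_span ⟨k, rfl⟩)
      · rintro _ ⟨k, rfl⟩
        exact mem_familyCone_self k
    rw [extremeRays_familyCone hv, hspan, finrank_span_eq_card hv, ← Set.image_univ,
      Set.ncard_image_of_injective _ hinj, Set.ncard_univ, Nat.card_eq_fintype_card]

end FamilyCone

theorem isSimpleCone_coneHull {ι : Type*} [Fintype ι] {R : Finset (ι → ℚ)}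
    (hR : LinearIndependent ℝ fun r : R => castVec r.1) : IsSimpleCone (coneHull R) := by
  classical
  have : coneHull R = familyCone fun r : R => castVec r.1 := by
    ext x
    constructor
    · rintro ⟨c, hc, rfl⟩
      exact ⟨fun r => c r, fun r => hc r r.2, (Finset.sum_coe_sort R fun r => c r • castVec r).symm⟩
    · rintro ⟨c, hc, rfl⟩
      refine ⟨fun r => if h : r ∈ R then c ⟨r, h⟩ else 0, fun r hr => ?_, ?_⟩
      · simp only [hr, dif_pos]
        exact hc _
      · rw [← Finset.sum_coe_sort R]
        exact Finset.sum_congr rfl fun r _ => by simp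
  rw [this]
  exact isSimpleCone_familyCone hR

/-! ### Integer systems -/

/-- Clear the denominators of a rational vector. -/
theorem exists_int_multiple {κ : Type*} [Fintype κ] (r : κ → ℚ) :
    ∃ (d : ℚ) (w : κ → ℤ), 0 < d ∧ ∀ k, (w k : ℚ) = d * r k ∧ |w k| ≤ 2 ^ vecSize r := by
  classical
  -- Multiply by all denominators. The `k`-th entry becomes its numerator times the other
  -- denominators, so its bits are among those counted by `vecSize r`.
  refine ⟨∏ j, ((r j).den : ℚ), fun k => (r k).num * ∏ j ∈ Finset.univ.erase k, ((r j).den : ℤ),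
    Finset.prod_pos fun j _ => by exact_mod_cast (r j).pos, fun k => ⟨?_, ?_⟩⟩
  · rw [← Finset.mul_prod_erase _ _ (Finset.mem_univ k)]
    push_cast
    have : ((r k).den : ℚ) * r k = (r k).num := by rw [mul_comm]; exact Rat.mul_den_eq_num _
    rw [mul_right_comm, this]
  · have h1 : |(r k).num| ≤ 2 ^ Nat.size (r k).num.natAbs := by
      rw [Int.abs_eq_natAbs]
      exact_mod_cast (Nat.lt_size_self _).le
    have h2 : ∏ j ∈ Finset.univ.erase k, ((r j).den : ℤ) ≤
        ∏ j ∈ Finset.univ.erase k, 2 ^ Nat.size (r j).den :=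
      Finset.prod_le_prod (fun _ _ => by positivity) fun j _ => by
        exact_mod_cast (Nat.lt_size_self _).le
    rw [Finset.prod_pow_eq_pow_sum] at h2
    have h3 : 0 ≤ ∏ j ∈ Finset.univ.erase k, ((r j).den : ℤ) :=
      Finset.prod_nonneg fun _ _ => Int.natCast_nonneg _
    rw [abs_mul, abs_of_nonneg h3]
    refine (mul_le_mul h1 h2 h3 (by positivity)).trans ?_
    rw [← pow_add]
    refine pow_le_pow_right₀ (by norm_num) ?_
    rw [vecSize, ← Finset.add_sum_erase _ _ (Finset.mem_univ k)]
    refine add_le_add (by rw [ratSize]; omega) (Finset.sum_le_sum fun j _ => by rw [ratSize]; omega)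

/-- The right-hand side is treated as one more coordinate `none`, so that the whole inequality is
scaled by the same positive factor. -/
theorem exists_int_row {ι : Type*} [Fintype ι] (a : ι → ℚ) (c : ℚ) :
    ∃ (w : ι → ℤ) (γ : ℤ), (∀ j, |w j| ≤ 2 ^ (vecSize a + ratSize c)) ∧
      |γ| ≤ 2 ^ (vecSize a + ratSize c) ∧
      ∀ x : ι → ℝ, ∑ j, (w j : ℝ) * x j ≤ γ ↔ ∑ j, (a j : ℝ) * x j ≤ c := by
  obtain ⟨d, w, hd, h⟩ := exists_int_multiple (fun k : Option ι => k.elim c a)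
  have hs : vecSize (fun k : Option ι => k.elim c a) = vecSize a + ratSize c := by
    simp [vecSize, Fintype.sum_option, add_comm]
  rw [hs] at h
  refine ⟨fun j => w (some j), w none, fun j => (h _).2, (h _).2, fun x => ?_⟩
  have h1 : ∀ j, (w (some j) : ℝ) = d * a j := fun j => by exact_mod_cast (h (some j)).1
  have h2 : (w none : ℝ) = d * c := by exact_mod_cast (h none).1
  have hd' : (0 : ℝ) < d := by exact_mod_cast hd
  simp only [h1, h2, mul_assoc, ← Finset.mul_sum]
  exact mul_le_mul_iff_right₀ hd'

namespace LinearSystem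

/-- The constraints with integer coefficients `w`. -/
abbrev intForms {τ ι : Type*} [Fintype ι] (w : τ → ι → ℤ) : τ → (ι → ℝ) →ₗ[ℝ] ℝ :=
  fun t => rowMap fun j => (w t j : ℝ)

/-! ### One integral generator for each extreme ray -/

section Rays

variable {τ ι : Type*} [Fintype ι] (w : τ → ι → ℤ) (N : ℤ)

/-- Small integral generators of extreme rays. -/
def smallRays : Set (ι → ℚ) :=
  {u | IsExtremal (intForms w) (castVec u) ∧ ∀ j, ∃ z : ℤ, u j = z ∧ |z| ≤ cramerBound ι N}

/-- The chosen representative of the ray of `u`. -/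
noncomputable def representative (u : ι → ℚ) : ι → ℚ :=
  Classical.epsilon fun u' => u' ∈ smallRays w N ∧ SameRay ℝ (castVec u') (castVec u)

/-- One small integral generator for every extreme ray. -/
def representatives : Set (ι → ℚ) := {u | u ∈ smallRays w N ∧ representative w N u = u}

variable {w N}

theorem finite_smallRays : (smallRays w N).Finite := by
  have : (Set.univ.pi fun _ : ι => ((↑) : ℤ → ℚ) '' Set.Icc (-cramerBound ι N) (cramerBound ι N)).Finite :=
    Set.Finite.pi fun _ => (Set.finite_Icc _ _).image _
  refine this.subset fun u hu j _ => ?_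
  obtain ⟨z, hz, hz'⟩ := hu.2 j
  exact ⟨z, abs_le.1 hz', hz.symm⟩

/-- On a common ray the predicates that define the two choices are equal, so the choices coincide:
the representative depends only on the ray. -/
theorem representative_eq {u v : ι → ℚ} (hu : u ∈ smallRays w N) (hv : v ∈ smallRays w N)
    (h : SameRay ℝ (castVec u) (castVec v)) : representative w N u = representative w N v := by
  have : (fun u' => u' ∈ smallRays w N ∧ SameRay ℝ (castVec u') (castVec u)) =
      fun u' => u' ∈ smallRays w N ∧ SameRay ℝ (castVec u') (castVec v) := by
    funext u'
    refine propext (and_congr_right fun _ => ⟨fun h' => h'.trans h fun h0 => ?_,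
      fun h' => h'.trans h.symm fun h0 => ?_⟩)
    · exact absurd h0 hu.1.2.1
    · exact absurd h0 hv.1.2.1
  rw [representative, this, representative]

theorem representative_spec {u : ι → ℚ} (hu : u ∈ smallRays w N) :
    representative w N u ∈ representatives w N ∧
      SameRay ℝ (castVec (representative w N u)) (castVec u) := by
  have h := Classical.epsilon_spec (p := fun u' => u' ∈ smallRays w N ∧
    SameRay ℝ (castVec u') (castVec u)) ⟨u, hu, SameRay.refl _⟩
  exact ⟨⟨h.1, representative_eq h.1 hu h.2⟩, h.2⟩

theorem eq_of_sameRay {u v : ι → ℚ} (hu : u ∈ representatives w N) (hv : v ∈ representatives w N)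
    (h : SameRay ℝ (castVec u) (castVec v)) : u = v := by
  rw [← hu.2, ← hv.2, representative_eq hu.1 hv.1 h]

theorem exists_smul_mem_representatives [Finite τ] (hw : ∀ t j, |w t j| ≤ N) (hN : 1 ≤ N)
    {r : ι → ℝ} (hr : IsExtremal (intForms w) r) :
    ∃ s : ℝ, 0 < s ∧ s • r ∈ castVec '' representatives w N := by
  obtain ⟨s, u, hs, hu⟩ := exists_small_isExtremal hw hN hr
  have e : castVec (fun j => (u j : ℚ)) = s • r := by
    funext j
    simp [castVec, (hu j).1]
  have hmem : (fun j => (u j : ℚ)) ∈ smallRays w N :=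
    ⟨by rw [e]; exact hr.smul hs, fun j => ⟨u j, rfl, (hu j).2⟩⟩
  obtain ⟨h1, h2⟩ := representative_spec hmem
  obtain ⟨a, b, ha, hb, hab⟩ := h2.exists_pos h1.1.1.2.1 hmem.1.2.1
  refine ⟨a⁻¹ * (b * s), by positivity, _, h1, ?_⟩
  rw [mul_smul, mul_smul, ← e, ← hab, smul_smul, inv_mul_cancel₀ ha.ne', one_smul]

end Rays

theorem castVec_injective {ι : Type*} : Function.Injective (castVec : (ι → ℚ) → ι → ℝ) := by
  intro u v h
  funext j
  have := congrFun h j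
  simpa [castVec] using this

/-- Every solution is the sum of a small solution and of a nonnegative integral combination of
linearly independent integral generators of extreme rays. -/
theorem exists_small_add_intCone {τ ι : Type*} [Finite τ] [Fintype ι] {w : τ → ι → ℤ} {β : τ → ℤ}
    {N : ℤ} (hw : ∀ t j, |w t j| ≤ N) (hβ : ∀ t, |β t| ≤ N) (hN : 1 ≤ N)
    (hinj : ∀ d, (∀ t, intForms w t d = 0) → d = 0) {x : ι → ℝ}
    (hx : x ∈ sol (intForms w) fun t => (β t : ℝ)) :
    ∃ R : Finset (ι → ℚ), (R : Set (ι → ℚ)) ⊆ representatives w N ∧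
      LinearIndependent ℝ (fun r : R => castVec r.1) ∧ ∃ (n : (ι → ℚ) → ℕ) (y : ι → ℝ),
        y ∈ sol (intForms w) (fun t => (β t : ℝ)) ∧
        (∀ j, |y j| ≤ (Fintype.card ι + 1) * cramerBound ι N) ∧
        x = y + ∑ r ∈ R, n r • castVec r := by
  classical
  obtain ⟨v, hv, c, hc, rfl⟩ := exists_vertex_add_cone hinj hx
  obtain ⟨S, l, hS, hli, hl, rfl⟩ := exists_nonneg_combination hinj
    (fun r hr => exists_smul_mem_representatives hw hN hr) hc
  obtain ⟨R, hR, rfl⟩ := Finset.subset_set_image_iff.1 fun e he => (hS e he).1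
  have hli' : LinearIndependent ℝ (fun r : R => castVec r.1) := by
    rw [Finset.coe_image, ← linearIndepOn_iff_image castVec_injective.injOn] at hli
    exact hli
  have hcard : R.card ≤ Fintype.card ι := by
    have := hli'.fintype_card_le_finrank
    simpa using this
  have hB : (0 : ℝ) ≤ cramerBound ι N := by
    have : 0 ≤ cramerBound ι N := by
      rw [cramerBound]
      positivity
    exact_mod_cast this
  have hray : ∀ r ∈ R, castVec r ∈ sol (intForms w) 0 ∧ ∀ j, |castVec r j| ≤ cramerBound ι N := by
    intro r hr
    have h := (hR hr).1
    refine ⟨h.1.1, fun j => ?_⟩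
    obtain ⟨z, hz, hz'⟩ := h.2 j
    rw [castVec, hz]
    exact_mod_cast hz'
  -- The integer parts of the multipliers go to the integral combination, the fractional parts to
  -- `y`. By independence at most `card ι` rays occur, each with coefficient at most 1, whence the
  -- factor `card ι + 1` when the part in the convex hull of the vertices is included.
  refine ⟨R, hR, hli', fun r => ⌊l (castVec r)⌋₊,
    v + ∑ r ∈ R, (l (castVec r) - ⌊l (castVec r)⌋₊) • castVec r, ?_, fun j => ?_, ?_⟩
  · refine add_mem_sol (convexHull_vertices_subset hv) (sum_mem_sol_zero _ fun r hr => ?_)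
    exact smul_mem_sol_zero (hray r hr).1 (sub_nonneg.2 (Nat.floor_le (hl _)))
  · rw [Pi.add_apply, Finset.sum_apply]
    have h1 := abs_le_of_mem_convexHull hw hβ hv j
    have h2 : |∑ r ∈ R, ((l (castVec r) - ⌊l (castVec r)⌋₊) • castVec r) j| ≤
        R.card * (cramerBound ι N : ℝ) := by
      refine (Finset.abs_sum_le_sum_abs _ _).trans ?_
      rw [← nsmul_eq_mul]
      refine Finset.sum_le_card_nsmul _ _ _ fun r hr => ?_
      rw [Pi.smul_apply, smul_eq_mul, abs_mul,
        abs_of_nonneg (sub_nonneg.2 (Nat.floor_le (hl _)))]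
      have h3 : l (castVec r) - ⌊l (castVec r)⌋₊ ≤ 1 := by
        have := (Nat.lt_floor_add_one (l (castVec r))).le
        linarith
      calc _ ≤ 1 * |castVec r j| := mul_le_mul_of_nonneg_right h3 (abs_nonneg _)
        _ ≤ _ := by rw [one_mul]; exact (hray r hr).2 j
    have h3 : (R.card : ℝ) ≤ Fintype.card ι := by exact_mod_cast hcard
    have h4 := abs_add_le (v j) (∑ r ∈ R, ((l (castVec r) - ⌊l (castVec r)⌋₊) • castVec r) j)
    have h5 := mul_le_mul_of_nonneg_right h3 hB
    linarith
  · rw [Finset.sum_image castVec_injective.injOn, add_assoc, ← Finset.sum_add_distrib]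
    congr 1
    refine Finset.sum_congr rfl fun r _ => ?_
    rw [← Nat.cast_smul_eq_nsmul ℝ, ← add_smul, sub_add_cancel]

theorem isInt_coord_sum {ι : Type*} {R : Finset (ι → ℚ)} {j : ι} (n : (ι → ℚ) → ℕ)
    (hR : ∀ r ∈ R, ∃ z : ℤ, r j = z) : ∃ z : ℤ, (∑ r ∈ R, n r • castVec r) j = z := by
  classical
  rw [Finset.sum_apply]
  induction R using Finset.induction_on with
  | empty => exact ⟨0, by simp⟩
  | insert a R ha ih =>
    obtain ⟨z, hz⟩ := ih fun r hr => hR r (by simp [hr])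
    obtain ⟨z', hz'⟩ := hR a (by simp)
    refine ⟨n a * z' + z, ?_⟩
    rw [Finset.sum_insert ha, hz]
    simp [castVec, hz']

end LinearSystem

/-! ### The decomposition of the mixed-integer points of a pointed polyhedron -/

open LinearSystem

theorem ratSize_pos (r : ℚ) : 1 ≤ ratSize r := by
  rw [ratSize]; omega

/-- One sign bit, at most `k + 1` digits, and one digit for the denominator 1. -/
theorem ratSize_intCast_le {z : ℤ} {k : ℕ} (h : |z| ≤ 2 ^ k) : ratSize z ≤ k + 3 := by
  have : z.natAbs ≤ 2 ^ k := by
    rw [Int.abs_eq_natAbs] at h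
    exact_mod_cast h
  have := Nat.size_le.2 (this.trans_lt (Nat.pow_lt_pow_right (by norm_num) (Nat.lt_succ_self k)))
  simp only [ratSize, Rat.num_intCast, Rat.den_intCast, Nat.size_one]
  omega

theorem vecSize_le {ι : Type*} [Fintype ι] {r : ι → ℚ} {k : ℕ} (h : ∀ j, ratSize (r j) ≤ k) :
    vecSize r ≤ Fintype.card ι * k := by
  rw [vecSize, ← smul_eq_mul]
  exact Finset.sum_le_card_nsmul _ _ _ fun j _ => h j

theorem card_le_vecSize {ι : Type*} [Fintype ι] (r : ι → ℚ) : Fintype.card ι ≤ vecSize r := by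
  rw [vecSize, ← Finset.card_univ, Finset.card_eq_sum_ones]
  exact Finset.sum_le_sum fun j _ => ratSize_pos _

theorem vecSize_single_le {ι : Type*} [Fintype ι] [DecidableEq ι] (i : ι) {z : ℤ} (hz : |z| ≤ 1) :
    vecSize (Pi.single i (z : ℚ) : ι → ℚ) ≤ Fintype.card ι * 3 := by
  refine vecSize_le fun j => ?_
  rw [Pi.single_apply]
  split_ifs
  · exact ratSize_intCast_le (k := 0) (by simpa using hz)
  · exact_mod_cast ratSize_intCast_le (z := 0) (k := 0) (by simp)

/-- A rational system with an arbitrary finite index set for its rows. -/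
theorem exists_ratPolyhedron_eq {ι κ : Type*} [Fintype ι] [Fintype κ] (A : κ → ι → ℚ) (b : κ → ℚ) :
    ∃ (m : ℕ) (A' : Matrix (Fin m) ι ℚ) (b' : Fin m → ℚ),
      {x : ι → ℝ | ∀ k, ∑ j, (A k j : ℝ) * x j ≤ b k} = ratPolyhedron A' b' ∧
      systemSize A' b' = ∑ k, (vecSize (A k) + ratSize (b k)) := by
  let e := Fintype.equivFin κ
  refine ⟨_, fun i => A (e.symm i), fun i => b (e.symm i), ?_, ?_⟩
  · ext x
    exact ⟨fun h i => h _, fun h k => by simpa using h (e k)⟩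
  · exact Equiv.sum_comp e.symm fun k => vecSize (A k) + ratSize (b k)

/-- Add constraints on single variables to a rational system. -/
theorem exists_ratPolyhedron_inter_eq {ι κ : Type*} [Fintype ι] [Fintype κ] {m k : ℕ}
    (A : Matrix (Fin m) ι ℚ) (b : Fin m → ℚ) (i : κ → ι) (c d : κ → ℤ) (hc : ∀ l, |c l| ≤ 1)
    (hd : ∀ l, |d l| ≤ 2 ^ k) :
    ∃ (m' : ℕ) (A' : Matrix (Fin m') ι ℚ) (b' : Fin m' → ℚ),
      ratPolyhedron A b ∩ {x | ∀ l, (c l : ℝ) * x (i l) ≤ d l} = ratPolyhedron A' b' ∧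
      systemSize A' b' ≤ systemSize A b +
        Fintype.card κ * (Fintype.card ι * 3 + (k + 3)) := by
  classical
  obtain ⟨m', A', b', h1, h2⟩ := exists_ratPolyhedron_eq (κ := Fin m ⊕ κ)
    (Sum.elim (fun t => A t) fun l => Pi.single (i l) (c l : ℚ))
    (Sum.elim b fun l => d l)
  refine ⟨m', A', b', ?_, ?_⟩
  · rw [← h1]
    ext x
    have hs : ∀ l, ∑ j, ((Pi.single (i l) (c l : ℚ) : ι → ℚ) j : ℝ) * x j = c l * x (i l) := by
      intro l
      rw [Finset.sum_eq_single (i l)]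
      · simp
      · intro j _ hj; simp [Pi.single_eq_of_ne hj]
      · simp
    constructor
    · rintro ⟨h1, h2⟩ (t | l)
      · exact h1 t
      · simp only [Sum.elim_inr, hs]
        exact_mod_cast h2 l
    · intro h
      refine ⟨fun t => h (.inl t), fun l => ?_⟩
      have := h (.inr l)
      simp only [Sum.elim_inr, hs] at this
      exact_mod_cast this
  · rw [h2, Fintype.sum_sum_type]
    refine Nat.add_le_add_left ?_ _
    rw [← smul_eq_mul, ← Finset.card_univ (α := κ)]
    exact Finset.sum_le_card_nsmul _ _ _ fun l _ =>
      add_le_add (vecSize_single_le _ (hc l)) (ratSize_intCast_le (hd l))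

theorem polyhedronSize_le {ι : Type*} [Fintype ι] {m : ℕ} (A : Matrix (Fin m) ι ℚ) (b : Fin m → ℚ) :
    polyhedronSize (ratPolyhedron A b) ≤ systemSize A b :=
  Nat.sInf_le ⟨m, A, b, rfl, rfl⟩

theorem exists_int_system {ι : Type*} [Fintype ι] {m : ℕ} (A : Matrix (Fin m) ι ℚ) (b : Fin m → ℚ) :
    ∃ (w : Fin m → ι → ℤ) (β : Fin m → ℤ), (∀ t j, |w t j| ≤ 2 ^ systemSize A b) ∧
      (∀ t, |β t| ≤ 2 ^ systemSize A b) ∧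
      ratPolyhedron A b = sol (intForms w) fun t => (β t : ℝ) := by
  choose w β hw hβ h using fun i => exists_int_row (A i) (b i)
  have hle : ∀ i, (2 : ℤ) ^ (vecSize (A i) + ratSize (b i)) ≤ 2 ^ systemSize A b := fun i =>
    pow_le_pow_right₀ (by norm_num) (Finset.single_le_sum
      (f := fun i => vecSize (A i) + ratSize (b i)) (fun _ _ => Nat.zero_le _) (Finset.mem_univ i))
  refine ⟨w, β, fun t j => (hw t j).trans (hle t), fun t => (hβ t).trans (hle t), ?_⟩
  ext x
  exact forall_congr' fun i => by
    rw [rowMap_apply]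
    exact (h i x).symm

/-- `n! ≤ n ^ n ≤ (2 ^ n) ^ n`, so the bound of Cramer's rule has polynomially many bits. -/
theorem cramerBound_le (ι : Type*) [Fintype ι] {N : ℤ} {s : ℕ} (h0 : 0 ≤ N) (h : N ≤ 2 ^ s) :
    cramerBound ι N ≤ 2 ^ (Fintype.card ι * Fintype.card ι + s * Fintype.card ι) := by
  have h1 : ((Fintype.card ι).factorial : ℤ) ≤ 2 ^ (Fintype.card ι * Fintype.card ι) := by
    rw [pow_mul]
    exact_mod_cast (Nat.factorial_le_pow _).trans (Nat.pow_le_pow_left Nat.lt_two_pow_self.le _)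
  rw [cramerBound, pow_add, pow_mul _ s]
  exact mul_le_mul h1 (pow_le_pow_left₀ h0 h _) (by positivity) (by positivity)

theorem cramerBound_nonneg (ι : Type*) [Fintype ι] {N : ℤ} (h0 : 0 ≤ N) : 0 ≤ cramerBound ι N := by
  rw [cramerBound]; positivity

theorem succ_mul_cramerBound_le (ι : Type*) [Fintype ι] {N : ℤ} {s : ℕ} (h0 : 0 ≤ N)
    (h : N ≤ 2 ^ s) : (Fintype.card ι + 1) * cramerBound ι N ≤
      2 ^ (Fintype.card ι + (Fintype.card ι * Fintype.card ι + s * Fintype.card ι)) := by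
  rw [pow_add]
  refine mul_le_mul ?_ (cramerBound_le ι h0 h) (cramerBound_nonneg ι h0) (by positivity)
  exact_mod_cast (Nat.lt_two_pow_self (n := Fintype.card ι))

/-! ### Recession cones and pointedness of solution sets -/

namespace LinearSystem

variable {τ ι : Type*}

/-- Nonemptiness matters: the recession cone of the empty set is the whole space. -/
theorem recessionCone_sol {φ : τ → (ι → ℝ) →ₗ[ℝ] ℝ} {β : τ → ℝ} (hne : (sol φ β).Nonempty) :
    recessionCone (sol φ β) = sol φ 0 := by
  ext v
  constructor
  · intro h i
    obtain ⟨x, hx⟩ := hne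
    by_contra! hpos
    simp only [Pi.zero_apply] at hpos
    have hxi : φ i x ≤ β i := hx i
    have := h x hx ((β i - φ i x + 1) / φ i v) (div_nonneg (by linarith) hpos.le) i
    rw [map_add, map_smul, smul_eq_mul, div_mul_cancel₀ _ hpos.ne'] at this
    linarith
  · exact fun h x hx t ht => add_mem_sol hx (smul_mem_sol_zero h ht)

theorem eq_zero_of_isPointed {φ : τ → (ι → ℝ) →ₗ[ℝ] ℝ} {β : τ → ℝ} (hne : (sol φ β).Nonempty)
    (hp : IsPointed (sol φ β)) (d : ι → ℝ) (hd : ∀ i, φ i d = 0) : d = 0 := by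
  obtain ⟨x, hx⟩ := hne
  refine hp x hx d fun t i => ?_
  rw [map_add, map_smul, hd, smul_zero, add_zero]
  exact hx i

theorem IsExtremal.generatesExtremeRay {φ : τ → (ι → ℝ) →ₗ[ℝ] ℝ} {r : ι → ℝ}
    (hinj : ∀ d, (∀ i, φ i d = 0) → d = 0) (hr : IsExtremal φ r) :
    GeneratesExtremeRay (sol φ 0) r :=
  ⟨hr.1, hr.2.1, fun _ hx _ hy h => ⟨hr.eq_smul hinj hx hy h,
    hr.eq_smul hinj hy hx (by rw [add_comm, h])⟩⟩

end LinearSystem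

/-- This turns bounds in the dimension and the size into bounds in the size alone. Every entry has
at least one bit, so a single row already suffices; without rows, a pointed nonempty polyhedron has
dimension 0. -/
theorem card_le_systemSize {ι : Type*} [Fintype ι] {m : ℕ} (A : Matrix (Fin m) ι ℚ) (b : Fin m → ℚ)
    (hne : (ratPolyhedron A b).Nonempty) (hp : IsPointed (ratPolyhedron A b)) :
    Fintype.card ι ≤ systemSize A b := by
  rcases Nat.eq_zero_or_pos m with rfl | hm
  · obtain ⟨x, hx⟩ := hne
    have : IsEmpty ι := by
      by_contra h
      rw [not_isEmpty_iff] at h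
      have := hp x hx 1 fun t i => i.elim0
      exact one_ne_zero this
    simp
  · refine (card_le_vecSize (A ⟨0, hm⟩)).trans ?_
    refine le_trans ?_ (Finset.single_le_sum (f := fun i => vecSize (A i) + ratSize (b i))
      (fun _ _ => Nat.zero_le _) (Finset.mem_univ ⟨0, hm⟩))
    exact Nat.le_add_right _ _

/-! ### Bounded slices with fixed integer coordinates -/

section Slice

variable {p q m : ℕ} (A : Matrix (Fin m) (Fin p ⊕ Fin q) ℚ) (b : Fin m → ℚ)

/-- The solutions with prescribed integer coordinates and bounded coordinates. -/
def boundedSlice (B : ℤ) (z : Fin p → ℤ) : Set (Fin p ⊕ Fin q → ℝ) :=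
  {x | x ∈ ratPolyhedron A b ∧ (∀ i, x (Sum.inl i) = z i) ∧ ∀ j, |x j| ≤ B}

/-- Two inequalities fix each integer variable and two bound each variable, so at most `4 * (p + q)`
rows are added. -/
theorem exists_boundedSlice_eq {B : ℤ} {z : Fin p → ℤ} {k : ℕ} (hz : ∀ i, |z i| ≤ B)
    (hB0 : 0 ≤ B) (hB : B ≤ 2 ^ k) :
    ∃ (m' : ℕ) (A' : Matrix (Fin m') (Fin p ⊕ Fin q) ℚ) (b' : Fin m' → ℚ),
      boundedSlice A b B z = ratPolyhedron A' b' ∧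
      systemSize A' b' ≤ systemSize A b + 4 * (p + q) * ((p + q) * 3 + (k + 3)) := by
  have hB' : |B| ≤ 2 ^ k := by rwa [abs_of_nonneg hB0]
  obtain ⟨m', A', b', h1, h2⟩ := exists_ratPolyhedron_inter_eq A b
    (κ := (Fin p ⊕ Fin p) ⊕ ((Fin p ⊕ Fin q) ⊕ (Fin p ⊕ Fin q))) (k := k)
    (Sum.elim (Sum.elim .inl .inl) (Sum.elim id id))
    (Sum.elim (Sum.elim (fun _ => 1) fun _ => -1) (Sum.elim (fun _ => 1) fun _ => -1))
    (Sum.elim (Sum.elim (fun i => z i) fun i => -z i) (Sum.elim (fun _ => B) fun _ => B))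
    (by rintro ((_ | _) | (_ | _)) <;> simp)
    (by
      rintro ((i | i) | (_ | _))
      · exact (hz i).trans hB
      · exact (abs_neg (z i)).trans_le ((hz i).trans hB)
      · exact hB'
      · exact hB')
  refine ⟨m', A', b', ?_, h2.trans ?_⟩
  · rw [← h1]
    ext x
    refine and_congr Iff.rfl ⟨?_, fun h => ⟨fun i => ?_, fun j => ?_⟩⟩
    · rintro ⟨h1, h2⟩ ((i | i) | (j | j))
      · simp [h1 i]
      · simp [h1 i]
      · simpa using (abs_le.1 (h2 j)).2
      · have := (abs_le.1 (h2 j)).1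
        simp only [Sum.elim_inr, Int.cast_neg, Int.cast_one, id]
        linarith
    · have e1 := h (.inl (.inl i))
      have e2 := h (.inl (.inr i))
      simp only [Sum.elim_inl, Sum.elim_inr, Int.cast_neg, Int.cast_one] at e1 e2
      exact le_antisymm (by linarith) (by linarith)
    · have e1 := h (.inr (.inl j))
      have e2 := h (.inr (.inr j))
      simp only [Sum.elim_inl, Sum.elim_inr, Int.cast_neg, Int.cast_one, id] at e1 e2
      exact abs_le.2 ⟨by linarith, by linarith⟩
  · simp only [Fintype.card_sum, Fintype.card_fin]
    refine Nat.add_le_add_left (Nat.mul_le_mul_right _ ?_) _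
    omega

theorem isBounded_boundedSlice (B : ℤ) (z : Fin p → ℤ) :
    Bornology.IsBounded (boundedSlice A b B z) := by
  rw [isBounded_iff_forall_norm_le]
  refine ⟨|(B : ℝ)|, fun x hx => (pi_norm_le_iff_of_nonneg (abs_nonneg _)).2 fun j => ?_⟩
  exact (hx.2.2 j).trans (le_abs_self _)

end Slice

/-- All slices are combined with all sets of rays. This adds no unwanted points, since an integral
combination of integral rays preserves both membership in the polyhedron and integrality of the
first `p` coordinates. -/
theorem exists_mixedInteger_decomposition :
    ∃ f : Polynomial ℕ, ∀ (p q m : ℕ) (A : Matrix (Fin m) (Fin p ⊕ Fin q) ℚ) (b : Fin m → ℚ),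
      IsPointed (ratPolyhedron A b) →
      ∃ (s t : ℕ) (P : Fin s → Set (Fin p ⊕ Fin q → ℝ))
        (R : Fin t → Finset (Fin p ⊕ Fin q → ℚ)),
        (∀ i, IsRatPolytope (P i)) ∧
        (∀ K, ∀ r ∈ R K, GeneratesExtremeRay (recessionCone (ratPolyhedron A b)) (castVec r)) ∧
        (∀ K K', ∀ r ∈ R K, ∀ r' ∈ R K', SameRay ℝ (castVec r) (castVec r') → r = r') ∧
        ratPolyhedron A b ∩ mixedInteger p q = ⋃ i, ⋃ K, (P i + intCone (R K)) ∧
        (∀ i, polyhedronSize (P i) ≤ f.eval (systemSize A b)) ∧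
        (∀ K, ∀ r ∈ R K, vecSize r ≤ f.eval (systemSize A b)) ∧
        (∀ K, ∀ r ∈ R K, ∀ j, ∃ z : ℤ, r j = z) ∧
        (∀ K, IsSimpleCone (coneHull (R K))) := by
  -- `X + 2 * X ^ 2` bounds the number of bits of the box size. At most `4 * X` rows are added to
  -- the system, each of size at most `3 * X + (X + 2 * X ^ 2 + 3)`.
  refine ⟨.X + 4 * .X * (3 * .X + (.X + 2 * .X ^ 2 + 3)), fun p q m A b hp => ?_⟩
  -- The empty polyhedron gets empty families; the description of the recession cone and the bound
  -- `p + q ≤ σ` need a point.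
  rcases (ratPolyhedron A b).eq_empty_or_nonempty with hemp | hne
  · exact ⟨0, 0, fun i => i.elim0, fun i => i.elim0, fun i => i.elim0, fun i => i.elim0,
      fun i => i.elim0, by simp [hemp], fun i => i.elim0, fun i => i.elim0, fun i => i.elim0,
      fun i => i.elim0⟩
  set σ := systemSize A b with hσ
  obtain ⟨w, β, hw, hβ, hP⟩ := exists_int_system A b
  rw [← hσ] at hw hβ
  have hn : p + q ≤ σ := by simpa using card_le_systemSize A b hne hp
  have hinj := eq_zero_of_isPointed (hP ▸ hne) (hP ▸ hp)
  have hrec : recessionCone (ratPolyhedron A b) = sol (intForms w) 0 := by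
    rw [hP]
    exact recessionCone_sol (hP ▸ hne)
  have hN : (1 : ℤ) ≤ 2 ^ σ := one_le_pow₀ (by norm_num)
  set C := cramerBound (Fin p ⊕ Fin q) (2 ^ σ) with hC
  set B : ℤ := (Fintype.card (Fin p ⊕ Fin q) + 1) * C with hB
  have hcard : Fintype.card (Fin p ⊕ Fin q) = p + q := by simp
  have hC0 : 0 ≤ C := cramerBound_nonneg (Fin p ⊕ Fin q) (by linarith)
  have hB0 : 0 ≤ B := mul_nonneg (by positivity) hC0
  have hle : p + q + ((p + q) * (p + q) + σ * (p + q)) ≤ σ + 2 * σ ^ 2 := by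
    nlinarith [Nat.mul_le_mul hn hn, Nat.mul_le_mul_left σ hn]
  have hBk : B ≤ 2 ^ (σ + 2 * σ ^ 2) := by
    refine (succ_mul_cramerBound_le (Fin p ⊕ Fin q) (by linarith) le_rfl).trans ?_
    rw [hcard]
    exact pow_le_pow_right₀ (by norm_num) hle
  have hCB : C ≤ B := by
    have : (1 : ℤ) ≤ Fintype.card (Fin p ⊕ Fin q) + 1 := by omega
    nlinarith
  -- One slice for every integer vector of the box; empty slices do no harm.
  let Z := {z : Fin p → ℤ // z ∈ Set.univ.pi fun _ => Set.Icc (-B) B}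
  have hZ : Finite Z := (Set.Finite.pi fun _ => Set.finite_Icc _ _).to_subtype
  let K := {R : Finset (Fin p ⊕ Fin q → ℚ) // (R : Set (Fin p ⊕ Fin q → ℚ)) ⊆ representatives w (2 ^ σ) ∧
    LinearIndependent ℝ (fun r : R => castVec r.1)}
  have hK : Finite K := by
    have hfin : (representatives w (2 ^ σ)).Finite := finite_smallRays.subset fun _ h => h.1
    exact (hfin.toFinset.powerset.finite_toSet.subset fun R hR => Finset.mem_coe.2
      (Finset.mem_powerset.2 fun r hr => hfin.mem_toFinset.2 (hR.1 hr))).to_subtype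
  obtain ⟨s, ⟨e⟩⟩ := Finite.exists_equiv_fin Z
  obtain ⟨t, ⟨e'⟩⟩ := Finite.exists_equiv_fin K
  have hz : ∀ z : Z, ∀ i, |z.1 i| ≤ B := fun z i => abs_le.2 (z.2 i trivial)
  have hslice := fun z : Z => exists_boundedSlice_eq A b (hz z) hB0 hBk
  have hsize : σ + 4 * (p + q) * ((p + q) * 3 + (σ + 2 * σ ^ 2 + 3)) ≤
      σ + 4 * σ * (3 * σ + (σ + 2 * σ ^ 2 + 3)) := by
    refine Nat.add_le_add_left (Nat.mul_le_mul (by omega) ?_) _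
    omega
  have heval : (Polynomial.X + 4 * Polynomial.X * (3 * Polynomial.X +
      (Polynomial.X + 2 * Polynomial.X ^ 2 + 3)) : Polynomial ℕ).eval σ =
      σ + 4 * σ * (3 * σ + (σ + 2 * σ ^ 2 + 3)) := by
    simp
  rw [heval]
  refine ⟨s, t, fun i => boundedSlice A b B (e.symm i).1, fun k => (e'.symm k).1, fun i => ?_,
    fun k r hr => ?_, fun k k' r hr r' hr' h => eq_of_sameRay ((e'.symm k).2.1 hr)
      ((e'.symm k').2.1 hr') h, ?_, fun i => ?_, fun k r hr => ?_, fun k r hr j => ?_,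
      fun k => isSimpleCone_coneHull (e'.symm k).2.2⟩
  · obtain ⟨m', A', b', h, -⟩ := hslice (e.symm i)
    exact ⟨isBounded_boundedSlice A b B _, m', A', b', h⟩
  · rw [hrec]
    exact ((e'.symm k).2.1 hr).1.1.generatesExtremeRay hinj
  · ext x
    simp only [Set.mem_iUnion]
    constructor
    · rintro ⟨hx, hxi⟩
      rw [hP] at hx
      obtain ⟨R, hR, hli, n, y, hy, hyB, rfl⟩ := exists_small_add_intCone hw hβ hN hinj hx
      have hyz : ∀ i : Fin p, ∃ z : ℤ, y (.inl i) = z := by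
        intro i
        obtain ⟨z, hz⟩ := hxi i
        obtain ⟨z', hz'⟩ := isInt_coord_sum (R := R) (j := .inl i) n fun r hr => by
          obtain ⟨z, hz, -⟩ := (hR hr).1.2 (.inl i)
          exact ⟨z, hz⟩
        rw [Pi.add_apply, hz'] at hz
        exact ⟨z - z', by push_cast; linarith⟩
      choose z hz using hyz
      have hyB' : ∀ j, |y j| ≤ (B : ℝ) := fun j => by
        rw [hB]
        push_cast
        exact hyB j
      have hzB : z ∈ Set.univ.pi fun _ : Fin p => Set.Icc (-B) B := by
        intro i _
        have := hyB' (.inl i)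
        rw [hz] at this
        exact abs_le.1 (by exact_mod_cast this)
      refine ⟨e ⟨z, hzB⟩, e' ⟨R, hR, hli⟩, ?_⟩
      rw [Equiv.symm_apply_apply, Equiv.symm_apply_apply]
      exact Set.add_mem_add ⟨hP ▸ hy, hz, hyB'⟩ ⟨n, rfl⟩
    · rintro ⟨i, k, hx⟩
      obtain ⟨y, ⟨hy, hyz, -⟩, _, ⟨n, rfl⟩, rfl⟩ := Set.mem_add.1 hx
      refine ⟨?_, fun i' => ?_⟩
      · rw [hP] at hy ⊢
        refine add_mem_sol hy (sum_mem_sol_zero _ fun r hr => ?_)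
        rw [← Nat.cast_smul_eq_nsmul ℝ]
        exact smul_mem_sol_zero ((e'.symm k).2.1 hr).1.1.1 (by positivity)
      · obtain ⟨z', hz'⟩ := isInt_coord_sum (R := (e'.symm k).1) (j := .inl i') n fun r hr => by
          obtain ⟨z, hz, -⟩ := ((e'.symm k).2.1 hr).1.2 (.inl i')
          exact ⟨z, hz⟩
        exact ⟨(e.symm i).1 i' + z', by rw [Pi.add_apply, hyz, hz']; push_cast; rfl⟩
  · obtain ⟨m', A', b', h, h'⟩ := hslice (e.symm i)
    dsimp only
    rw [h]
    exact (polyhedronSize_le A' b').trans (h'.trans hsize)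
  · have h : ∀ j, ratSize (r j) ≤ σ + 2 * σ ^ 2 + 3 := by
      intro j
      obtain ⟨z, hz, hz'⟩ := ((e'.symm k).2.1 hr).1.2 j
      rw [hz]
      exact ratSize_intCast_le ((hz'.trans hCB).trans hBk)
    refine (vecSize_le h).trans ?_
    rw [hcard]
    nlinarith [Nat.mul_le_mul_right (σ + 2 * σ ^ 2 + 3) hn]
  · obtain ⟨z, hz, -⟩ := ((e'.symm k).2.1 hr).1.2 j
    exact ⟨z, hz⟩

/-! ### Small solutions of mixed-integer systems -/

open LinearSystem

/-- A bound for the number of bits of the numerators and denominators of a small solution, for a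
system of size `σ` with `n` variables. -/
def solutionBound (σ n : ℕ) : ℕ :=
  -- `σ + n * (n * 3 + 3)` is the size after adding `n` sign constraints. At most `2 * n` further
  -- rows fix the integer variables at values with the number of bits given by the inner
  -- parenthesis. The shape `n * n + s * n` is the exponent of Cramer's bound for a system of size
  -- `s`.
  n * n + (σ + n * (n * 3 + 3) +
    2 * n * (n * 3 + (n + (n * n + (σ + n * (n * 3 + 3)) * n) + 3))) * n

theorem solutionBound_mono {σ n L : ℕ} (h : σ ≤ L) (h' : n ≤ L) :
    solutionBound σ n ≤ solutionBound L L := by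
  unfold solutionBound
  gcongr

theorem IsPointed.mono {ι : Type*} {S T : Set (ι → ℝ)} (h : IsPointed T) (hST : S ⊆ T) :
    IsPointed S := fun x hx v hv => h x (hST hx) v fun t => hST (hv t)

theorem isPointed_orthant {ι : Type*} {s : ι → ℤ} (hs : ∀ j, |s j| = 1) :
    IsPointed {x : ι → ℝ | ∀ j, (s j : ℝ) * x j ≤ (0 : ℤ)} := by
  intro x _ v hv
  funext j
  by_contra hne
  simp only [Pi.zero_apply] at hne
  have hs0 : (s j : ℝ) ≠ 0 := by
    intro h
    have : s j = 0 := by exact_mod_cast h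
    have := hs j
    simp_all
  have h0 : (s j : ℝ) * v j ≠ 0 := mul_ne_zero hs0 hne
  have := hv ((1 - s j * x j) / (s j * v j)) j
  rw [Pi.add_apply, Pi.smul_apply, smul_eq_mul, mul_add, mul_left_comm, div_mul_cancel₀ _ h0] at this
  simp at this
  linarith

/-- Cramer's rule gives the coordinates as `u j / D`. Passing to lowest terms only replaces
numerator and denominator by divisors. -/
theorem exists_rat_vertex {ι : Type*} [Fintype ι] {m s : ℕ} (A : Matrix (Fin m) ι ℚ) (b : Fin m → ℚ)
    (hs : systemSize A b ≤ s) (hne : (ratPolyhedron A b).Nonempty)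
    (hp : IsPointed (ratPolyhedron A b)) :
    ∃ x : ι → ℚ, castVec x ∈ ratPolyhedron A b ∧ ∀ j,
      (x j).num.natAbs ≤ 2 ^ (Fintype.card ι * Fintype.card ι + s * Fintype.card ι) ∧
      (x j).den ≤ 2 ^ (Fintype.card ι * Fintype.card ι + s * Fintype.card ι) := by
  obtain ⟨w, β, hw, hβ, hP⟩ := exists_int_system A b
  have hN : (2 : ℤ) ^ systemSize A b ≤ 2 ^ s := pow_le_pow_right₀ (by norm_num) hs
  obtain ⟨v, hv⟩ := nonempty_vertices (eq_zero_of_isPointed (hP ▸ hne) (hP ▸ hp)) (hP ▸ hne)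
  obtain ⟨D, u, hD, hDB, hu⟩ := exists_small_vertex hw hβ hv
  have hB := cramerBound_le ι (by positivity) hN
  set k := Fintype.card ι * Fintype.card ι + s * Fintype.card ι
  have e : castVec (fun j => Rat.divInt (u j) D) = v := by
    funext j
    have hD' : (D : ℝ) ≠ 0 := by exact_mod_cast hD.ne'
    rw [castVec, Rat.divInt_eq_div]
    push_cast
    rw [← (hu j).1, mul_div_cancel_left₀ _ hD']
  refine ⟨fun j => Rat.divInt (u j) D, by rw [e, hP]; exact hv.1, fun j => ⟨?_, ?_⟩⟩
  · rcases eq_or_ne (u j) 0 with h | h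
    · simp [h]
    · have h1 := Int.natAbs_dvd_natAbs.2 (Rat.num_dvd (u j) hD.ne')
      have h2 := Nat.le_of_dvd (Int.natAbs_pos.2 h) h1
      have h3 := (hu j).2.trans hB
      rw [Int.abs_eq_natAbs] at h3
      exact h2.trans (by exact_mod_cast h3)
  · have h1 := Int.le_of_dvd hD (Rat.den_dvd (u j) D)
    exact_mod_cast h1.trans (hDB.trans hB)

/-- The polyhedron need not be pointed, so it is first cut with an orthant that contains the given
solution. Removing integral multiples of rays leaves a solution `y` in a small box, but its
continuous coordinates may be irrational; they are replaced by those of a vertex of the slice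
through `y`. -/
theorem exists_small_mixedInteger_solution {p q m : ℕ} (A : Matrix (Fin m) (Fin p ⊕ Fin q) ℚ)
    (b : Fin m → ℚ) (hne : (ratPolyhedron A b ∩ mixedInteger p q).Nonempty) :
    ∃ x : Fin p ⊕ Fin q → ℚ, castVec x ∈ ratPolyhedron A b ∧ (∀ i : Fin p, (x (.inl i)).den = 1) ∧
      ∀ j, (x j).num.natAbs ≤ 2 ^ solutionBound (systemSize A b) (p + q) ∧
        (x j).den ≤ 2 ^ solutionBound (systemSize A b) (p + q) := by
  obtain ⟨x₀, hx₀, hx₀i⟩ := hne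
  have hcard : Fintype.card (Fin p ⊕ Fin q) = p + q := by simp
  -- The sign is chosen so that `s j * x₀ j ≤ 0`, the form of the constraints to be added.
  let s : Fin p ⊕ Fin q → ℤ := fun j => if 0 ≤ x₀ j then -1 else 1
  have hs : ∀ j, |s j| = 1 := fun j => by
    simp only [s]
    split_ifs <;> simp
  obtain ⟨m₁, A₁, b₁, h₁, hsize₁⟩ := exists_ratPolyhedron_inter_eq A b id s (fun _ => 0) (k := 0)
    (fun j => (hs j).le) (by simp)
  have hx₁ : x₀ ∈ ratPolyhedron A₁ b₁ := by
    rw [← h₁]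
    refine ⟨hx₀, fun j => ?_⟩
    simp only [s, id]
    split_ifs with h
    · push_cast; linarith
    · push_cast; linarith
  have hp₁ : IsPointed (ratPolyhedron A₁ b₁) := by
    rw [← h₁]
    exact (isPointed_orthant hs).mono Set.inter_subset_right
  obtain ⟨w, β, hw, hβ, hP⟩ := exists_int_system A₁ b₁
  have hN : (1 : ℤ) ≤ 2 ^ systemSize A₁ b₁ := one_le_pow₀ (by norm_num)
  rw [hP] at hx₁ hp₁
  obtain ⟨R, hR, -, n, y, hy, hyB, hxy⟩ := exists_small_add_intCone hw hβ hN
    (eq_zero_of_isPointed ⟨x₀, hx₁⟩ hp₁) hx₁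
  have hyz : ∀ i : Fin p, ∃ z : ℤ, y (.inl i) = z := by
    intro i
    obtain ⟨z, hz⟩ := hx₀i i
    obtain ⟨z', hz'⟩ := isInt_coord_sum (R := R) (j := .inl i) n fun r hr => by
      obtain ⟨z, hz, -⟩ := (hR hr).1.2 (.inl i)
      exact ⟨z, hz⟩
    rw [hxy, Pi.add_apply, hz'] at hz
    exact ⟨z - z', by push_cast; linarith⟩
  choose z hz using hyz
  rw [← hP] at hy hp₁
  rw [hcard, Nat.zero_add] at hsize₁
  have hB := succ_mul_cramerBound_le (Fin p ⊕ Fin q) (by linarith)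
    (pow_le_pow_right₀ (by norm_num) hsize₁ : (2 : ℤ) ^ systemSize A₁ b₁ ≤ _)
  rw [hcard] at hB
  set k := p + q + ((p + q) * (p + q) +
    (systemSize A b + (p + q) * ((p + q) * 3 + 3)) * (p + q)) with hk
  have hzB : ∀ i, |z i| ≤ 2 ^ k := by
    intro i
    have := hyB (.inl i)
    rw [hz, hcard] at this
    refine le_trans ?_ hB
    exact_mod_cast this
  obtain ⟨m₂, A₂, b₂, h₂, hsize₂⟩ := exists_ratPolyhedron_inter_eq A₁ b₁ (κ := Fin p ⊕ Fin p) (k := k)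
    (Sum.elim .inl .inl) (Sum.elim (fun _ => 1) fun _ => -1) (Sum.elim z fun i => -z i)
    (by rintro (_ | _) <;> simp)
    (by
      rintro (i | i)
      · exact hzB i
      · exact (abs_neg (z i)).trans_le (hzB i))
  have hy₂ : y ∈ ratPolyhedron A₂ b₂ := by
    rw [← h₂]
    refine ⟨hy, ?_⟩
    rintro (i | i) <;> simp [hz]
  -- The slice is nonempty because of `y`, and pointed as a subset of the orthant, so it has a
  -- vertex.
  obtain ⟨x, hx, hxB⟩ := exists_rat_vertex A₂ b₂ hsize₂ ⟨y, hy₂⟩ (by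
    rw [← h₂]
    exact hp₁.mono Set.inter_subset_left)
  rw [← h₂] at hx
  have hle : Fintype.card (Fin p ⊕ Fin q) * Fintype.card (Fin p ⊕ Fin q) +
      (systemSize A₁ b₁ + Fintype.card (Fin p ⊕ Fin p) * (Fintype.card (Fin p ⊕ Fin q) * 3 +
        (k + 3))) * Fintype.card (Fin p ⊕ Fin q) ≤ solutionBound (systemSize A b) (p + q) := by
    have hpp : Fintype.card (Fin p ⊕ Fin p) ≤ 2 * (p + q) := by simp; omega
    rw [hcard, solutionBound, ← hk]
    gcongr
  refine ⟨x, ?_, fun i => ?_, fun j => ⟨(hxB j).1.trans ?_, (hxB j).2.trans ?_⟩⟩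
  · have := hx.1
    rw [← h₁] at this
    exact this.1
  · have e1 := hx.2 (.inl i)
    have e2 := hx.2 (.inr i)
    simp only [Sum.elim_inl, Sum.elim_inr, Int.cast_neg, Int.cast_one] at e1 e2
    have : castVec x (.inl i) = z i := le_antisymm (by linarith) (by linarith)
    have : x (.inl i) = z i := by
      rw [castVec] at this
      exact_mod_cast this
    rw [this, Rat.den_intCast]
  · exact Nat.pow_le_pow_right (by norm_num) hle
  · exact Nat.pow_le_pow_right (by norm_num) hle

/-! ### Mixed-integer feasibility is in NP -/

namespace MIPVerifier

open Computability StackProg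

/-- The fraction that represents a rational number. -/
def quo (r : ℚ) : Quo := (decide (r < 0), Nat.bits r.num.natAbs, Nat.bits r.den)

@[simp] theorem numer_quo (r : ℚ) : numer (quo r) = r.num.natAbs := val_bits _

@[simp] theorem denom_quo (r : ℚ) : denom (quo r) = r.den := val_bits _

@[simp] theorem value_quo (r : ℚ) : value (quo r) = r := by
  rw [value, numer_quo, denom_quo]
  have h := Rat.num_div_den r
  rcases lt_or_ge r 0 with hr | hr
  · have hn : ((r.num.natAbs : ℤ) : ℚ) = -r.num := by
      rw [Int.ofNat_natAbs_of_nonpos (Rat.num_nonpos.2 hr.le)]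
      push_cast; rfl
    rw [Int.cast_natCast] at hn
    simp only [quo, hr, decide_true, cond_true, hn]
    rw [neg_one_mul, neg_div, neg_neg, h]
  · have hn : ((r.num.natAbs : ℤ) : ℚ) = r.num := by
      rw [Int.natAbs_of_nonneg (Rat.num_nonneg.2 hr)]
    rw [Int.cast_natCast] at hn
    simp only [quo, hr.not_gt, decide_false, cond_false, hn, one_mul, h]

theorem encodeRow_eq (l : List ℚ) : encodeRow l = encRow (l.map quo) := by
  rw [encodeRow, encRow, List.flatMap_map]
  rfl

/-- The types of the variables of an instance. -/
def types (I : MIPInstance) : List Bool := List.replicate I.p true ++ List.replicate I.q false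

/-- The rows of an instance. -/
def quoRows (I : MIPInstance) : List (List Quo) := (List.ofFn I.row).map (List.map quo)

theorem encodeMIP_eq (I : MIPInstance) :
    encodeMIP I = (types I).map .bit ++ (quoRows I).flatMap encRow := by
  rw [encodeMIP, types, quoRows, List.flatMap_map, List.map_append, List.map_replicate,
    List.map_replicate, List.append_assoc]
  congr 2
  exact List.flatMap_congr fun l _ => encodeRow_eq l

theorem dot_append {us us' vs vs' : List Quo} (h : us.length = vs.length) :
    dot (us ++ us') (vs ++ vs') = dot us vs + dot us' vs' := by
  rw [dot, List.zipWith_append h, List.sum_append]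
  rfl

theorem dot_ofFn {n : ℕ} (a v : Fin n → Quo) :
    dot (List.ofFn a) (List.ofFn v) = ∑ i, value (a i) * value (v i) := by
  induction n with
  | zero => simp [dot]
  | succ n ih =>
    rw [List.ofFn_succ, List.ofFn_succ, Fin.sum_univ_succ, ← ih]
    simp [dot]

theorem dot_row (I : MIPInstance) (i : Fin I.m) (f : Fin I.p → Quo) (g : Fin I.q → Quo) :
    dot ((I.row i).map quo) ((List.ofFn f ++ List.ofFn g) ++ [negOne]) =
      ∑ j, I.A i (.inl j) * value (f j) + ∑ j, I.A i (.inr j) * value (g j) - I.b i := by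
  rw [MIPInstance.row, List.map_append, List.map_append, List.map_ofFn, List.map_ofFn,
    List.append_assoc, dot_append (by simp), dot_append (by simp), dot_ofFn, dot_ofFn]
  simp [dot]
  ring

theorem exists_ofFn_of_fits {a : Bool} {n : ℕ} {vs : List Quo}
    (h : List.Forall₂ Fits (List.replicate n a) vs) :
    ∃ f : Fin n → Quo, vs = List.ofFn f ∧ ∀ i, Fits a (f i) := by
  induction n generalizing vs with
  | zero =>
    rw [List.replicate_zero, List.forall₂_nil_left_iff] at h
    exact ⟨Fin.elim0, by simp [h], fun i => i.elim0⟩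
  | succ n ih =>
    rw [List.replicate_succ, List.forall₂_cons_left_iff] at h
    obtain ⟨v, vs, hv, hvs, rfl⟩ := h
    obtain ⟨f, rfl, hf⟩ := ih hvs
    exact ⟨Fin.cons v f, by simp [List.ofFn_succ], Fin.cases hv hf⟩

theorem forall₂_replicate_ofFn {α β : Type*} {r : α → β → Prop} {a : α} {n : ℕ} {f : Fin n → β}
    (h : ∀ i, r a (f i)) : List.Forall₂ r (List.replicate n a) (List.ofFn f) := by
  induction n with
  | zero => simp
  | succ n ih =>
    rw [List.replicate_succ, List.ofFn_succ]
    exact .cons (h 0) (ih fun i => h _)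

theorem exists_int_value {u : Quo} (h : Fits true u) : ∃ z : ℤ, value u = z := by
  rw [value, h.2 rfl]
  rcases u with ⟨s, u⟩
  cases s
  · exact ⟨numer (false, u), by simp⟩
  · exact ⟨-numer (true, u), by simp⟩

theorem denom_pos_of_mem_quoRows (I : MIPInstance) : ∀ us ∈ quoRows I, ∀ u ∈ us, 0 < denom u := by
  intro us hus u hu
  obtain ⟨l, -, rfl⟩ := List.mem_map.1 hus
  obtain ⟨r, -, rfl⟩ := List.mem_map.1 hu
  rw [denom_quo]
  exact r.pos

theorem mem_quoRows {I : MIPInstance} {us : List Quo} :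
    us ∈ quoRows I ↔ ∃ i, (I.row i).map quo = us := by
  simp [quoRows]

theorem feasible_of_runs {I : MIPInstance} {t : Mem} (h : Runs main (start (encodeMIP I)) t) :
    I.Feasible := by
  rw [encodeMIP_eq] at h
  obtain ⟨vs, hvs, hrows⟩ := main_sound (denom_pos_of_mem_quoRows I) h
  have hvs' := hvs
  rw [← List.take_append_drop I.p vs] at hvs
  have hlen : vs.length = I.p + I.q := by
    rw [← hvs'.length_eq]
    simp [types]
  have h1 : List.Forall₂ Fits (List.replicate I.p true) (vs.take I.p) := by
    have := List.forall₂_take I.p hvs'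
    simpa [types] using this
  have h2 : List.Forall₂ Fits (List.replicate I.q false) (vs.drop I.p) := by
    have := List.forall₂_drop I.p hvs'
    simpa [types] using this
  obtain ⟨f, hf, hf'⟩ := exists_ofFn_of_fits h1
  obtain ⟨g, hg, -⟩ := exists_ofFn_of_fits h2
  refine ⟨castVec (Sum.elim (fun i => value (f i)) fun i => value (g i)), fun i => ?_, fun i => ?_⟩
  · have := (hrows _ (mem_quoRows.2 ⟨i, rfl⟩)).2
    rw [← List.take_append_drop I.p vs, hf, hg, dot_row, sub_nonpos] at this
    rw [Fintype.sum_sum_type]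
    simp only [castVec, Sum.elim_inl, Sum.elim_inr]
    exact_mod_cast this
  · obtain ⟨z, hz⟩ := exists_int_value (hf' i)
    refine ⟨z, ?_⟩
    simp only [castVec, Sum.elim_inl, hz]
    simp

theorem ratSize_le_length (r : ℚ) : ratSize r ≤ (encodeRat r).length := by
  simp only [ratSize, encodeRat, List.length_cons, List.length_append, List.length_map,
    List.length_nil, ← length_bits]
  omega

/-- The encoding spends one symbol on the type of each variable, so the number of variables is
bounded even for a system without rows. -/
theorem length_encodeMIP (I : MIPInstance) :
    I.p + I.q ≤ (encodeMIP I).length ∧ systemSize I.A I.b ≤ (encodeMIP I).length := by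
  have h : systemSize I.A I.b ≤ ((List.ofFn I.row).flatMap encodeRow).length := by
    rw [List.length_flatMap, List.map_ofFn, List.sum_ofFn, systemSize]
    refine Finset.sum_le_sum fun i _ => ?_
    simp only [Function.comp_apply, encodeRow, MIPInstance.row, List.length_cons,
      List.length_append, List.length_flatMap, List.map_append, List.map_ofFn, List.sum_append,
      List.sum_ofFn, List.map_cons, List.map_nil, List.sum_cons, List.sum_nil, List.length_nil]
    rw [vecSize, Fintype.sum_sum_type]
    have h1 : ∑ j, ratSize (I.A i (.inl j)) ≤ ∑ j, (encodeRat (I.A i (.inl j))).length :=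
      Finset.sum_le_sum fun j _ => ratSize_le_length _
    have h2 : ∑ j, ratSize (I.A i (.inr j)) ≤ ∑ j, (encodeRat (I.A i (.inr j))).length :=
      Finset.sum_le_sum fun j _ => ratSize_le_length _
    have h3 := ratSize_le_length (I.b i)
    omega
  rw [encodeMIP, List.length_append, List.length_append, List.length_replicate,
    List.length_replicate]
  omega

theorem length_enc_quo_le {r : ℚ} {k : ℕ} (h1 : r.num.natAbs ≤ 2 ^ k) (h2 : r.den ≤ 2 ^ k) :
    (enc (quo r)).length ≤ 2 * k + 5 := by
  have e1 := length_bits_le (h1.trans_lt (Nat.pow_lt_pow_right one_lt_two (Nat.lt_succ_self k)))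
  have e2 := length_bits_le (h2.trans_lt (Nat.pow_lt_pow_right one_lt_two (Nat.lt_succ_self k)))
  simp only [enc, quo, List.length_cons, List.length_append, List.length_map, List.length_nil]
  omega

/-- A coordinate of the small solution takes at most `2 * k + 5` symbols: a sign, two numbers of at
most `k + 1` bits, two commas. The last coordinate `-1` takes 5. -/
theorem exists_runsIn_of_feasible {I : MIPInstance} (h : I.Feasible) :
    ∃ t, RunsIn main (4000 * (6 * ((encodeMIP I).length *
      (2 * solutionBound (encodeMIP I).length (encodeMIP I).length + 5) +
        (encodeMIP I).length + 6) + 1) ^ 4) (start (encodeMIP I)) t := by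
  obtain ⟨x, hx, hxi, hxB⟩ := exists_small_mixedInteger_solution I.A I.b h
  obtain ⟨l1, l2⟩ := length_encodeMIP I
  have hb := solutionBound_mono l2 l1
  set L := (encodeMIP I).length with hL
  set k := solutionBound L L
  have hxk : ∀ j, (enc (quo (x j))).length ≤ 2 * k + 5 := fun j =>
    length_enc_quo_le ((hxB j).1.trans (Nat.pow_le_pow_right two_pos hb))
      ((hxB j).2.trans (Nat.pow_le_pow_right two_pos hb))
  have hlen : ∀ (n : ℕ) (f : Fin n → ℚ), (∀ i, (enc (quo (f i))).length ≤ 2 * k + 5) →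
      ((List.ofFn fun i => quo (f i)).flatMap enc).length ≤ n * (2 * k + 5) := by
    intro n f hf
    rw [List.length_flatMap, List.map_ofFn, List.sum_ofFn]
    have := Finset.sum_le_card_nsmul Finset.univ (fun i => (enc (quo (f i))).length) _
      fun i _ => hf i
    simpa using this
  rw [encodeMIP_eq]
  refine main_complete (vs := List.ofFn (fun i => quo (x (.inl i))) ++
    List.ofFn fun i => quo (x (.inr i))) (denom_pos_of_mem_quoRows I) ?_ ?_ ?_ ?_
  · refine List.rel_append (forall₂_replicate_ofFn fun i => ?_) (forall₂_replicate_ofFn fun i => ?_)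
    · exact ⟨[], by simp [quo, hxi i], fun _ => rfl⟩
    · obtain ⟨d, hd⟩ := exists_bits_eq (x (.inr i)).pos
      exact ⟨d, hd, by simp⟩
  · intro us hus
    obtain ⟨i, rfl⟩ := mem_quoRows.1 hus
    refine ⟨by simp [MIPInstance.row, add_assoc], ?_⟩
    rw [dot_row, sub_nonpos]
    simp only [value_quo]
    have := hx i
    rw [Fintype.sum_sum_type] at this
    simp only [castVec] at this
    exact_mod_cast this
  · rw [← encodeMIP_eq, ← hL]
    omega
  · rw [List.flatMap_append, List.flatMap_append, List.length_append, List.length_append]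
    have h1 := hlen _ (fun i => x (.inl i)) fun i => hxk _
    have h2 := hlen _ (fun i => x (.inr i)) fun i => hxk _
    have h3 := Nat.mul_le_mul_right (2 * k + 5) l1
    rw [add_mul] at h3
    have h4 : ([negOne].flatMap enc).length = 5 := by simp [enc, negOne]
    omega

theorem inNP_feasible : InNP mipEncoding {I | I.Feasible} := by
  let X : Polynomial ℕ := .X
  let k : Polynomial ℕ := X * X + (X + X * (X * 3 + 3) +
    2 * X * (X * 3 + (X + (X * X + (X + X * (X * 3 + 3)) * X) + 3))) * X
  have hk : ∀ L, k.eval L = solutionBound L L := fun L => by simp [k, X, solutionBound]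
  refine Verifier.inNP_of_isRegular mipEncoding _ Reg.I id isRegular_main
    (4000 * (6 * (X * (2 * k + 5) + X + 6) + 1) ^ 4) (fun I t h => ?_) fun I hI => ?_
  · rw [List.map_id] at h
    exact feasible_of_runs h
  · rw [List.map_id]
    simp only [Polynomial.eval_mul, Polynomial.eval_pow, Polynomial.eval_add, Polynomial.eval_one,
      Polynomial.eval_ofNat, hk, X, Polynomial.eval_X]
    exact exists_runsIn_of_feasible hI

end MIPVerifier

theorem proposition1 :
    (∃ f : Polynomial ℕ, ∀ (p q m : ℕ) (A : Matrix (Fin m) (Fin p ⊕ Fin q) ℚ) (b : Fin m → ℚ),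
      IsPointed (ratPolyhedron A b) →
      ∃ (s t : ℕ) (P : Fin s → Set (Fin p ⊕ Fin q → ℝ))
        (R : Fin t → Finset (Fin p ⊕ Fin q → ℚ)),
        -- every `P i` is a polytope
        (∀ i, IsRatPolytope (P i)) ∧
        -- every `R K` consists of extreme rays, each ray being represented by one fixed vector
        (∀ K, ∀ r ∈ R K, GeneratesExtremeRay (recessionCone (ratPolyhedron A b)) (castVec r)) ∧
        (∀ K K', ∀ r ∈ R K, ∀ r' ∈ R K', SameRay ℝ (castVec r) (castVec r') → r = r') ∧
        -- the decomposition of the mixed-integer points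
        ratPolyhedron A b ∩ mixedInteger p q = ⋃ i, ⋃ K, (P i + intCone (R K)) ∧
        -- complexity bounds
        (∀ i, polyhedronSize (P i) ≤ f.eval (systemSize A b)) ∧
        (∀ K, ∀ r ∈ R K, vecSize r ≤ f.eval (systemSize A b)) ∧
        -- integrality of the rays
        (∀ K, ∀ r ∈ R K, ∀ j, ∃ z : ℤ, r j = z) ∧
        -- the cones are simple
        (∀ K, IsSimpleCone (coneHull (R K)))) ∧
    -- mixed-integer linear feasibility is in NP
    InNP mipEncoding {I | I.Feasible} :=
  ⟨exists_mixedInteger_decomposition, MIPVerifier.inNP_feasible⟩
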